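/- Let $M^-=M^+=\mathbb{C}^6$ with standard bases $v_1^\sigma,\dots,v_6^\sigma$ ($\sigma=\pm$), which are dual with respect to the dot product $g:M^-\times M^+\to\mathbb{C}$. Write products in the exterior algebras $\bigwedge(M^\sigma)$ as $uv$. Let $\bigwedge(M^{-\sigma})$ act on $\bigwedge(M^\sigma)$ by the algebra homomorphism $a\mapsto(x\mapsto a\cdot x)$ that sends $v\in M^{-\sigma}$ to the anti-derivation of degree $-1$ with $w\mapsto g(v,w)$ for $w\in M^\sigma$ (thus $a\cdot x\in\mathbb{C}$ if $a,x$ have the same degree), and for $A\in\mathrm{End}(M^\sigma)$ let $x\mapsto A\circ x$ be the derivation of $\bigwedge(M^\sigma)$ extending $A$. Let $\mathcal{S}$ be the Lie algebra of all $(A^-,A^+)\in\mathrm{End}(M^-)\oplus\mathrm{End}(M^+)$ with $g(A^-v,w)+g(v,A^+w)=0$, acting on $\bigwedge(M^\sigma)$ by $(A^-,A^+)\circ x=A^\sigma\circ x$; put $\iota^+(A)=(-A^T,A)$ for $A\in M_6(\mathbb{C})$ and $h_M=\iota^+(\mathrm{id})$. For $x^\sigma\in\bigwedge^3(M^\sigma)$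 let $E(x^-,x^+)=(E^-,-E^+)\in\mathcal{S}$, where $E^-(v)=(v\cdot x^+)\cdot x^-$ and $E^+(v)=(v\cdot x^-)\cdot x^+$. Let $$\tilde{\mathcal{E}}=\bigwedge\nolimits^6(M^-)\oplus\bigwedge\nolimits^3(M^-)\oplus(\mathcal{S}\oplus\mathbb{C}h_0)\oplus\bigwedge\nolimits^3(M^+)\oplus\bigwedge\nolimits^6(M^+),$$ with summands in degrees $-2,-1,0,1,2$, carry the $\mathbb{Z}$-graded skew-symmetric product which on $\mathcal{S}$ is the commutator, has $[h_0,\mathcal{S}]=0$, and, for $A\in\mathcal{S}$ and $p_j,q_j$ of degree $j$, satisfies $[A,p_i]=A\circ p_i$ and $[h_0,p_i]=ip_i$ ($i=\pm1,\pm2$), $[p_{-1},q_1]=E(p_{-1},q_1)+(p_{-1}\cdot q_1)h_0$, $[p_{-2},q_2]=-(p_{-2}\cdot q_2)(h_M-2h_0)$, and $[p_i,q_i]=p_iq_i$, $[p_i,q_{-2i}]=p_i\cdot q_{-2i}$ for $i=\pm1$. Let $\mathcal{E}=\mathcal{E}(\mathbb{C}^6,\mathbb{C}^6,\cdot)\subseteq\tilde{\mathcal{E}}$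 be the subalgebra of all elements whose degree-$0$ component $(A^-,A^+)+ah_0$ satisfies $\mathrm{tr}(A^+)+3a=0$. With $E_{ij}$ the matrix units, let $h_i=\iota^+(E_{ii}-E_{i+1,i+1})$ for $1\le i\le5$, $h_6=\iota^+(E_{44}+E_{55}+E_{66})-h_0$, and for $S=\{i_1<\dots<i_\ell\}\subseteq[1,6]=\{1,\dots,6\}$ let $v_S^+=v_{i_1}^+\cdots v_{i_\ell}^+$ and $v_S^-=v_{i_\ell}^-\cdots v_{i_1}^-$. Put $$B_{\mathcal{E}}=\{h_i:1\le i\le6\}\cup\{\iota^+(E_{ij}):1\le i\ne j\le6\}\cup\{v_S^\sigma:\sigma=\pm,\ |S|=3\}\cup\{v_{[1,6]}^\sigma:\sigma=\pm\}.$$ Then $\mathcal{E}$ is a finite dimensional simple Lie algebra of type $E_6$, and $B_{\mathcal{E}}$ is a Chevalley basis of $\mathcal{E}$: it is a basis of $\mathcal{E}$, and for some Cartan subalgebra $\mathcal{H}$ and some base $\Pi$ of the root system of $(\mathcal{E},\mathcal{H})$, the $h_i$ are the coroots of the simple roots, and the other elements of $B_{\mathcal{E}}$ are root vectors $x_\mu$,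 one for each root $\mu$, such that $[x_\mu,x_{-\mu}]$ is the coroot of $\mu$ for every root $\mu$, and whenever $\mu,\nu,\mu+\nu$ are roots and $[x_\mu,x_\nu]=c\,x_{\mu+\nu}$, then $[x_{-\mu},x_{-\nu}]=-c\,x_{-\mu-\nu}$. -/

import Mathlib

open scoped DualNumber

noncomputable section

namespace ExteriorE6

/-! ## The exterior algebras of two modules paired by a bilinear form -/

section Exterior

variable {K N M : Type*} [CommRing K] [AddCommGroup N] [Module K N] [AddCommGroup M] [Module K M]

lemma left_ind {P : ExteriorAlgebra K M → Prop} (h0 : ∀ r : K, P (algebraMap K _ r))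
    (hadd : ∀ x y, P x → P y → P (x + y)) (hm : ∀ x m, P x → P (ExteriorAlgebra.ι K m * x))
    (x : ExteriorAlgebra K M) : P x :=
  CliffordAlgebra.left_induction _ h0 hadd hm x

lemma right_ind {P : ExteriorAlgebra K M → Prop} (h0 : ∀ r : K, P (algebraMap K _ r))
    (hadd : ∀ x y, P x → P y → P (x + y)) (hm : ∀ m x, P x → P (x * ExteriorAlgebra.ι K m))
    (x : ExteriorAlgebra K M) : P x :=
  CliffordAlgebra.right_induction _ h0 hadd hm x

/-- The contraction of an element of `⋀ M` by a linear form on `M`: the anti-derivation of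
degree `-1` of `⋀ M` that extends the linear form. -/
def con (d : Module.Dual K M) : ExteriorAlgebra K M →ₗ[K] ExteriorAlgebra K M :=
  CliffordAlgebra.contractLeft (Q := (0 : QuadraticForm K M)) d

lemma con_ι_mul (d : Module.Dual K M) (m : M) (x : ExteriorAlgebra K M) :
    con d (ExteriorAlgebra.ι K m * x) = d m • x - ExteriorAlgebra.ι K m * con d x :=
  CliffordAlgebra.contractLeft_ι_mul _ _ _

lemma con_algebraMap (d : Module.Dual K M) (r : K) : con d (algebraMap K _ r) = 0 :=
  CliffordAlgebra.contractLeft_algebraMap (Q := (0 : QuadraticForm K M)) d r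

lemma con_ι (d : Module.Dual K M) (m : M) :
    con d (ExteriorAlgebra.ι K m) = algebraMap K _ (d m) :=
  CliffordAlgebra.contractLeft_ι (Q := (0 : QuadraticForm K M)) d m

lemma con_con (d : Module.Dual K M) (x : ExteriorAlgebra K M) : con d (con d x) = 0 :=
  CliffordAlgebra.contractLeft_contractLeft (Q := (0 : QuadraticForm K M)) d x

lemma con_comm (d d' : Module.Dual K M) (x : ExteriorAlgebra K M) :
    con d (con d' x) = -con d' (con d x) :=
  CliffordAlgebra.contractLeft_comm (Q := (0 : QuadraticForm K M)) d d' x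

lemma con_add (d d' : Module.Dual K M) : con (d + d') = con d + con d' := by
  simp [con]

lemma con_smul (c : K) (d : Module.Dual K M) : con (c • d) = c • con d := by
  simp [con]

/-- For a bilinear form `g : N × M → K`, the left action `(a, x) ↦ a · x` of the algebra `⋀ N`
on `⋀ M`: the algebra homomorphism `⋀ N → End (⋀ M)` that sends `v ∈ N` to the unique
anti-derivation of degree `-1` of `⋀ M` with `w ↦ g v w` for `w ∈ M`.  The action of `⋀ M` on
`⋀ N` is `act g.flip`. -/
def act (g : N →ₗ[K] M →ₗ[K] K) :
    ExteriorAlgebra K N →ₐ[K] Module.End K (ExteriorAlgebra K M) :=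
  ExteriorAlgebra.lift K
    ⟨{ toFun := fun v => con (g v)
       map_add' := fun v w => by rw [map_add, con_add]
       map_smul' := fun c v => by rw [map_smul, con_smul, RingHom.id_apply] }, fun v =>
      LinearMap.ext fun x => con_con (g v) x⟩

/-- The scalar component of `a · x`.  If `a ∈ ⋀^k N` and `x ∈ ⋀^k M`, then `a · x ∈ ⋀^0 M = K`,
and this is `a · x` as a scalar. -/
def pair (g : N →ₗ[K] M →ₗ[K] K) (a : ExteriorAlgebra K N) (x : ExteriorAlgebra K M) : K :=
  ExteriorAlgebra.algebraMapInv (act g a x)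

/-- For `x ∈ ⋀^k M` and `a ∈ ⋀^k N` with `k ≥ 1`, the endomorphism `E(x, a) : v ↦ (v · a) · x`
of `M`, where `(v · a) · x ∈ ⋀^1 M` is identified with an element of `M`. -/
def endo (g : N →ₗ[K] M →ₗ[K] K) (x : ExteriorAlgebra K M) (a : ExteriorAlgebra K N) :
    Module.End K M where
  toFun v := ExteriorAlgebra.ιInv (act g (act g.flip (ExteriorAlgebra.ι K v) a) x)
  map_add' v w := by simp
  map_smul' c v := by simp

/-- The algebra homomorphism `⋀ M → ⋀ M ⊕ ε ⋀ M` with `v ↦ v + ε A v` for `v ∈ M`. -/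
def derAux (A : Module.End K M) : ExteriorAlgebra K M →ₐ[K] (ExteriorAlgebra K M)[ε] :=
  ExteriorAlgebra.lift K
    ⟨(TrivSqZeroExt.inlAlgHom K (ExteriorAlgebra K M) (ExteriorAlgebra K M)).toLinearMap ∘ₗ
          ExteriorAlgebra.ι K +
        (TrivSqZeroExt.inrHom (ExteriorAlgebra K M) (ExteriorAlgebra K M)).restrictScalars K ∘ₗ
          ExteriorAlgebra.ι K ∘ₗ A, fun v => by
      ext
      · simp
      · simp [ExteriorAlgebra.ι_add_mul_swap]⟩

/-- The unique derivation of `⋀ M` that extends the endomorphism `A` of `M`: the coefficient of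
`ε` of the algebra homomorphism `derAux A`, see `der_one`, `der_ι` and `der_mul`. -/
def der (A : Module.End K M) : ExteriorAlgebra K M →ₗ[K] ExteriorAlgebra K M where
  toFun x := (derAux A x).snd
  map_add' x y := by simp
  map_smul' c x := by simp

lemma derAux_fst (A : Module.End K M) (x : ExteriorAlgebra K M) : (derAux A x).fst = x := by
  have h : (TrivSqZeroExt.fstHom K (ExteriorAlgebra K M) (ExteriorAlgebra K M)).comp (derAux A) =
      AlgHom.id K _ := by
    ext v
    simp [derAux]
  exact congrArg (fun f => f x) h

lemma der_one (A : Module.End K M) : der A 1 = 0 := by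
  simp [der]

lemma der_ι (A : Module.End K M) (v : M) :
    der A (ExteriorAlgebra.ι K v) = ExteriorAlgebra.ι K (A v) := by
  simp [der, derAux]

lemma der_mul (A : Module.End K M) (x y : ExteriorAlgebra K M) :
    der A (x * y) = x * der A y + der A x * y := by
  simp [der, derAux_fst]

lemma act_ι (g : N →ₗ[K] M →ₗ[K] K) (v : N) (x : ExteriorAlgebra K M) :
    act g (ExteriorAlgebra.ι K v) x = con (g v) x := by
  simp [act]

/-! ### Degrees -/

lemma power_zero : ⋀[K]^0 M = 1 := pow_zero _

lemma power_succ (n : ℕ) :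
    ⋀[K]^(n + 1) M = LinearMap.range (ExteriorAlgebra.ι K : M →ₗ[K] _) * ⋀[K]^n M :=
  pow_succ' _ _

lemma power_add (m n : ℕ) : ⋀[K]^(m + n) M = ⋀[K]^m M * ⋀[K]^n M := pow_add _ _ _

lemma con_mem (d : Module.Dual K M) (n : ℕ) (x : ExteriorAlgebra K M)
    (hx : x ∈ ⋀[K]^(n + 1) M) :
    con d x ∈ ⋀[K]^n M := by
  induction n generalizing x with
  | zero =>
    simp only [zero_add, pow_one] at hx
    obtain ⟨m, rfl⟩ := hx
    rw [power_zero]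
    rw [con_ι]
    exact Submodule.algebraMap_mem _
  | succ n ih =>
    rw [power_succ] at hx
    induction hx using Submodule.mul_induction_on' with
    | mem_mul_mem m hm y hy =>
      obtain ⟨m, rfl⟩ := hm
      rw [con_ι_mul]
      refine Submodule.sub_mem _ (Submodule.smul_mem _ _ hy) ?_
      rw [power_succ]
      exact Submodule.mul_mem_mul ⟨m, rfl⟩ (ih y hy)
    | add x hx y hy h1 h2 =>
      rw [map_add]
      exact Submodule.add_mem _ h1 h2

lemma act_mem (g : N →ₗ[K] M →ₗ[K] K) (k : ℕ) (a : ExteriorAlgebra K N) (ha : a ∈ ⋀[K]^k N)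
    (n : ℕ) (x : ExteriorAlgebra K M) (hx : x ∈ ⋀[K]^(n + k) M) : act g a x ∈ ⋀[K]^n M := by
  induction k generalizing a n x with
  | zero =>
    rw [power_zero] at ha
    obtain ⟨r, rfl⟩ := Submodule.mem_one.mp ha
    rw [AlgHom.commutes]
    exact Submodule.smul_mem _ r hx
  | succ k ih =>
    rw [power_succ] at ha
    induction ha using Submodule.mul_induction_on' with
    | mem_mul_mem m hm y hy =>
      obtain ⟨m, rfl⟩ := hm
      rw [map_mul, Module.End.mul_apply, act_ι]
      exact con_mem _ _ _ (ih y hy (n + 1) x (by convert! hx using 2; ring))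
    | add a ha b hb h1 h2 =>
      rw [map_add]
      exact Submodule.add_mem _ h1 h2

lemma der_mem (A : Module.End K M) (n : ℕ) (x : ExteriorAlgebra K M) (hx : x ∈ ⋀[K]^n M) :
    der A x ∈ ⋀[K]^n M := by
  induction n generalizing x with
  | zero =>
    rw [power_zero] at hx
    obtain ⟨r, rfl⟩ := Submodule.mem_one.mp hx
    rw [Algebra.algebraMap_eq_smul_one, map_smul, der_one, smul_zero]
    exact Submodule.zero_mem _
  | succ n ih =>
    rw [power_succ] at hx
    induction hx using Submodule.mul_induction_on' with
    | mem_mul_mem m hm y hy =>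
      obtain ⟨m, rfl⟩ := hm
      rw [der_mul, der_ι, power_succ]
      exact Submodule.add_mem _ (Submodule.mul_mem_mul ⟨m, rfl⟩ (ih y hy))
        (Submodule.mul_mem_mul ⟨A m, rfl⟩ hy)
    | add a ha b hb h1 h2 =>
      rw [map_add]
      exact Submodule.add_mem _ h1 h2

/-- The action `a · x` for `a ∈ ⋀^3 N` and `x ∈ ⋀^6 M`, with values in `⋀^3 M`. -/
def act36 (g : N →ₗ[K] M →ₗ[K] K) (a : ⋀[K]^3 N) (x : ⋀[K]^6 M) : ⋀[K]^3 M :=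
  ⟨act g a x, act_mem g 3 a a.2 3 x x.2⟩

/-- The product of two elements of `⋀^3 M`, with values in `⋀^6 M`. -/
def mul33 (x y : ⋀[K]^3 M) : ⋀[K]^6 M :=
  ⟨(x : ExteriorAlgebra K M) * y, by
    rw [show (6 : ℕ) = 3 + 3 from rfl, power_add]
    exact Submodule.mul_mem_mul x.2 y.2⟩

/-- The action `A ∘ x` of `A ∈ End M` on `x ∈ ⋀^n M`. -/
def derPow (n : ℕ) (A : Module.End K M) (x : ⋀[K]^n M) : ⋀[K]^n M :=
  ⟨der A x, der_mem A n x x.2⟩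

/-! ### Linearity -/

lemma pair_add_left (g : N →ₗ[K] M →ₗ[K] K) (a b : ExteriorAlgebra K N) (x : ExteriorAlgebra K M) :
    pair g (a + b) x = pair g a x + pair g b x := by
  simp [pair]

lemma pair_smul_left (g : N →ₗ[K] M →ₗ[K] K) (c : K) (a : ExteriorAlgebra K N)
    (x : ExteriorAlgebra K M) : pair g (c • a) x = c * pair g a x := by
  simp [pair]

lemma pair_add_right (g : N →ₗ[K] M →ₗ[K] K) (a : ExteriorAlgebra K N)
    (x y : ExteriorAlgebra K M) : pair g a (x + y) = pair g a x + pair g a y := by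
  simp [pair]

lemma pair_smul_right (g : N →ₗ[K] M →ₗ[K] K) (c : K) (a : ExteriorAlgebra K N)
    (x : ExteriorAlgebra K M) : pair g a (c • x) = c * pair g a x := by
  simp [pair]

lemma endo_add_left (g : N →ₗ[K] M →ₗ[K] K) (x y : ExteriorAlgebra K M)
    (a : ExteriorAlgebra K N) : endo g (x + y) a = endo g x a + endo g y a := by
  ext v; simp [endo]

lemma endo_smul_left (g : N →ₗ[K] M →ₗ[K] K) (c : K) (x : ExteriorAlgebra K M)
    (a : ExteriorAlgebra K N) : endo g (c • x) a = c • endo g x a := by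
  ext v; simp [endo]

lemma endo_add_right (g : N →ₗ[K] M →ₗ[K] K) (x : ExteriorAlgebra K M)
    (a b : ExteriorAlgebra K N) : endo g x (a + b) = endo g x a + endo g x b := by
  ext v; simp [endo]

lemma endo_smul_right (g : N →ₗ[K] M →ₗ[K] K) (c : K) (x : ExteriorAlgebra K M)
    (a : ExteriorAlgebra K N) : endo g x (c • a) = c • endo g x a := by
  ext v; simp [endo]

lemma der_add (A B : Module.End K M) : der (A + B) = der A + der B := by
  refine LinearMap.ext fun x => ?_
  induction x using left_ind with
  | h0 r => simp [Algebra.algebraMap_eq_smul_one, der_one]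
  | hadd x y hx hy => rw [map_add, hx, hy, map_add]
  | hm x m hx =>
    rw [der_mul, LinearMap.add_apply, der_mul, der_mul, der_ι, der_ι, der_ι, hx,
      LinearMap.add_apply, LinearMap.add_apply, map_add, mul_add, add_mul]
    abel

lemma der_smul (c : K) (A : Module.End K M) : der (c • A) = c • der A := by
  refine LinearMap.ext fun x => ?_
  induction x using left_ind with
  | h0 r => simp [Algebra.algebraMap_eq_smul_one, der_one]
  | hadd x y hx hy => rw [map_add, hx, hy, map_add]
  | hm x m hx =>
    rw [der_mul, LinearMap.smul_apply, der_mul, der_ι, der_ι, hx]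
    simp [smul_add]


/-! ### Adjoints and traces of the endomorphisms `E(x, a)` -/

lemma act_add_apply (g : N →ₗ[K] M →ₗ[K] K) (a b : ExteriorAlgebra K N)
    (x : ExteriorAlgebra K M) : act g (a + b) x = act g a x + act g b x := by simp

lemma act_algebraMap (g : N →ₗ[K] M →ₗ[K] K) (r : K) (x : ExteriorAlgebra K M) :
    act g (algebraMap K _ r) x = r • x := by
  rw [AlgHom.commutes]; rfl

lemma pair_algebraMap (g : N →ₗ[K] M →ₗ[K] K) (r : K) (x : ExteriorAlgebra K M) :
    pair g (algebraMap K _ r) x = r * ExteriorAlgebra.algebraMapInv x := by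
  rw [pair, act_algebraMap, map_smul, smul_eq_mul]

lemma pair_mul (g : N →ₗ[K] M →ₗ[K] K) (a b : ExteriorAlgebra K N) (x : ExteriorAlgebra K M) :
    pair g (a * b) x = pair g a (act g b x) := by
  rw [pair, map_mul]; rfl

/-- The grading involution of `⋀ M`. -/
def invo : ExteriorAlgebra K M →ₐ[K] ExteriorAlgebra K M :=
  CliffordAlgebra.involute (Q := (0 : QuadraticForm K M))

lemma invo_ι (m : M) : invo (ExteriorAlgebra.ι K m) = -ExteriorAlgebra.ι K m :=
  CliffordAlgebra.involute_ι m

lemma invo_invo (x : ExteriorAlgebra K M) : invo (invo x) = x :=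
  CliffordAlgebra.involute_involute x

lemma con_invo (d : Module.Dual K M) (x : ExteriorAlgebra K M) :
    con d (invo x) = -invo (con d x) := by
  induction x using left_ind with
  | h0 r => rw [AlgHom.commutes, con_algebraMap, map_zero, neg_zero]
  | hadd x y hx hy => rw [map_add, map_add, hx, hy, map_add, map_add]; abel
  | hm x m hx =>
    rw [con_ι_mul, map_mul, invo_ι, neg_mul, map_neg, con_ι_mul, hx, map_sub, map_smul, map_mul,
      invo_ι, mul_neg, neg_mul]

lemma act_invo (g : N →ₗ[K] M →ₗ[K] K) (a : ExteriorAlgebra K N) (x : ExteriorAlgebra K M) :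
    act g (invo a) (invo x) = invo (act g a x) := by
  induction a using left_ind with
  | h0 r => rw [AlgHom.commutes, act_algebraMap, act_algebraMap, map_smul]
  | hadd a b ha hb => rw [map_add, act_add_apply, act_add_apply, map_add, ha, hb]
  | hm a n ha =>
    rw [map_mul, invo_ι, map_mul, map_mul, Module.End.mul_apply, Module.End.mul_apply, ha,
      map_neg, LinearMap.neg_apply, act_ι, act_ι, con_invo, neg_neg]

lemma scal_ι_mul (m : M) (x : ExteriorAlgebra K M) :
    ExteriorAlgebra.algebraMapInv (R := K) (ExteriorAlgebra.ι K m * x) = 0 := by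
  rw [map_mul]; simp [ExteriorAlgebra.algebraMapInv]

lemma scal_mul_ι (x : ExteriorAlgebra K M) (m : M) :
    ExteriorAlgebra.algebraMapInv (R := K) (x * ExteriorAlgebra.ι K m) = 0 := by
  rw [map_mul]; simp [ExteriorAlgebra.algebraMapInv]

lemma scal_invo (x : ExteriorAlgebra K M) :
    ExteriorAlgebra.algebraMapInv (invo x) = ExteriorAlgebra.algebraMapInv (R := K) x := by
  induction x using left_ind with
  | h0 r => rw [AlgHom.commutes]
  | hadd x y hx hy => rw [map_add, map_add, map_add, hx, hy]
  | hm x m hx => rw [map_mul, invo_ι, neg_mul, map_neg, scal_ι_mul, scal_ι_mul, neg_zero]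

lemma pair_invo (g : N →ₗ[K] M →ₗ[K] K) (a : ExteriorAlgebra K N) (x : ExteriorAlgebra K M) :
    pair g (invo a) x = pair g a (invo x) := by
  have h := act_invo g a (invo x)
  rw [invo_invo] at h
  rw [pair, h, scal_invo, pair]

lemma ι_mul_eq (m : M) (x : ExteriorAlgebra K M) :
    ExteriorAlgebra.ι K m * x = invo x * ExteriorAlgebra.ι K m := by
  induction x using left_ind with
  | h0 r => rw [AlgHom.commutes, Algebra.commutes]
  | hadd x y hx hy => rw [map_add, mul_add, add_mul, hx, hy]
  | hm x n hx =>
    rw [map_mul, invo_ι, mul_assoc, ← hx, ← mul_assoc, neg_mul, ← mul_assoc,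
      eq_neg_iff_add_eq_zero, ← add_mul, ExteriorAlgebra.ι_add_mul_swap, zero_mul]

lemma con_mul_ι (d : Module.Dual K M) (x : ExteriorAlgebra K M) (m : M) :
    con d (x * ExteriorAlgebra.ι K m) = con d x * ExteriorAlgebra.ι K m + d m • invo x := by
  induction x using left_ind with
  | h0 r =>
    rw [con_algebraMap, AlgHom.commutes, zero_mul, zero_add, Algebra.commutes, con_ι_mul,
      con_algebraMap, mul_zero, sub_zero]
  | hadd x y hx hy => rw [add_mul, map_add, map_add, map_add, hx, hy, add_mul, smul_add]; abel
  | hm x n hx =>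
    rw [mul_assoc, con_ι_mul, con_ι_mul, hx, map_mul, invo_ι, mul_add, sub_mul, mul_assoc,
      smul_mul_assoc, mul_smul_comm, neg_mul, smul_neg]
    abel

/-- Left contraction on one side is adjoint to right multiplication on the other. -/
lemma pair_mul_ι (g : N →ₗ[K] M →ₗ[K] K) (a : ExteriorAlgebra K N) (y : ExteriorAlgebra K M)
    (m : M) : pair g a (y * ExteriorAlgebra.ι K m) = pair g (con (g.flip m) a) y := by
  induction a using right_ind generalizing y with
  | h0 r => rw [pair_algebraMap, scal_mul_ι, con_algebraMap, mul_zero, pair, map_zero]; simp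
  | hadd a b ha hb => rw [pair_add_left, map_add, pair_add_left, ha, hb]
  | hm n a ha =>
    rw [pair_mul, act_ι, con_mul_ι, pair_add_right, ha, pair_smul_right, con_mul_ι,
      pair_add_left, pair_smul_left, pair_mul, act_ι, pair_invo, LinearMap.flip_apply]

lemma act_scal (g : N →ₗ[K] M →ₗ[K] K) (a : ExteriorAlgebra K N) (r : K) :
    act g a (algebraMap K _ r) = algebraMap K _ (r * ExteriorAlgebra.algebraMapInv a) := by
  induction a using left_ind with
  | h0 s => rw [act_algebraMap, ExteriorAlgebra.algebraMap_leftInverse, mul_comm, map_mul,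
      Algebra.smul_def]
  | hadd a b ha hb => rw [act_add_apply, ha, hb, map_add, mul_add, map_add]
  | hm a n ha =>
    rw [map_mul, Module.End.mul_apply, ha, act_ι, con_algebraMap, scal_ι_mul, mul_zero, map_zero]

lemma pair_comm (g : N →ₗ[K] M →ₗ[K] K) (a : ExteriorAlgebra K N) (x : ExteriorAlgebra K M) :
    pair g a x = pair g.flip x a := by
  induction x using right_ind generalizing a with
  | h0 r => rw [pair_algebraMap, pair, act_scal, ExteriorAlgebra.algebraMap_leftInverse]
  | hadd x y hx hy => rw [pair_add_right, pair_add_left, hx, hy]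
  | hm m x hx => rw [pair_mul_ι, hx, pair_mul, act_ι]

lemma ιInv_ι_mul (m : M) (x : ExteriorAlgebra K M) :
    ExteriorAlgebra.ιInv (ExteriorAlgebra.ι K m * x) =
      ExteriorAlgebra.algebraMapInv (R := K) x • m := by
  let _ : Module Kᵐᵒᵖ M := Module.compHom _ ((RingHom.id K).fromOpposite mul_comm)
  have : IsCentralScalar K M := ⟨fun r m => rfl⟩
  have h : ∀ y : ExteriorAlgebra K M, (ExteriorAlgebra.toTrivSqZeroExt y).fst =
      ExteriorAlgebra.algebraMapInv (R := K) y := by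
    intro y
    have : (TrivSqZeroExt.fstHom K K M).comp ExteriorAlgebra.toTrivSqZeroExt =
        ExteriorAlgebra.algebraMapInv (R := K) (M := M) := by
      ext v
      simp [ExteriorAlgebra.algebraMapInv, ExteriorAlgebra.toTrivSqZeroExt_ι]
    exact congrArg (fun f => f y) this
  simp only [ExteriorAlgebra.ιInv, LinearMap.comp_apply, AlgHom.toLinearMap_apply, map_mul,
    ExteriorAlgebra.toTrivSqZeroExt_ι, TrivSqZeroExt.sndHom_apply, TrivSqZeroExt.snd_mul, h]
  simp

lemma ιInv_algebraMap (r : K) :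
    ExteriorAlgebra.ιInv (algebraMap K (ExteriorAlgebra K M) r) = 0 := by
  let _ : Module Kᵐᵒᵖ M := Module.compHom _ ((RingHom.id K).fromOpposite mul_comm)
  have : IsCentralScalar K M := ⟨fun r m => rfl⟩
  simp only [ExteriorAlgebra.ιInv, LinearMap.comp_apply, AlgHom.toLinearMap_apply,
    AlgHom.commutes, TrivSqZeroExt.sndHom_apply]
  rfl

lemma apply_ιInv (d : Module.Dual K M) (x : ExteriorAlgebra K M) :
    d (ExteriorAlgebra.ιInv x) = ExteriorAlgebra.algebraMapInv (con d x) := by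
  induction x using left_ind with
  | h0 r => rw [con_algebraMap, map_zero, ιInv_algebraMap, map_zero]
  | hadd x y hx hy => rw [map_add, map_add, map_add, map_add, hx, hy]
  | hm x m hx =>
    rw [con_ι_mul, map_sub, scal_ι_mul, sub_zero, map_smul, ιInv_ι_mul, map_smul, smul_eq_mul,
      smul_eq_mul, mul_comm]

lemma apply_endo (g : N →ₗ[K] M →ₗ[K] K) (x : ExteriorAlgebra K M) (a : ExteriorAlgebra K N)
    (n : N) (m : M) :
    g n (endo g x a m) = pair g (con (g.flip m) a) (invo (con (g n) x)) := by
  simp only [endo, LinearMap.coe_mk, AddHom.coe_mk]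
  rw [apply_ιInv, ← act_ι, ← Module.End.mul_apply, ← map_mul, ι_mul_eq, ← pair, pair_mul,
    act_ι, act_ι, pair_invo]

/-- The endomorphisms `E(x, a)` of `M` and `E(a, x)` of `N` are adjoint to each other. -/
lemma endo_adjoint (g : N →ₗ[K] M →ₗ[K] K) (x : ExteriorAlgebra K M) (a : ExteriorAlgebra K N)
    (n : N) (m : M) : g (endo g.flip a x n) m = g n (endo g x a m) := by
  rw [apply_endo, ← LinearMap.flip_apply g, apply_endo, LinearMap.flip_flip, pair_comm g,
    pair_invo]

/-- Euler's identity. -/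
lemma euler {ι : Type*} [Fintype ι] (b : Module.Basis ι K M) (k : ℕ) (x : ExteriorAlgebra K M)
    (hx : x ∈ ⋀[K]^k M) :
    ∑ i, ExteriorAlgebra.ι K (b i) * con (b.coord i) x = (k : K) • x := by
  induction k generalizing x with
  | zero =>
    rw [power_zero] at hx
    obtain ⟨r, rfl⟩ := Submodule.mem_one.mp hx
    simp [con_algebraMap]
  | succ k ih =>
    rw [power_succ] at hx
    induction hx using Submodule.mul_induction_on' with
    | mem_mul_mem m hm y hy =>
      obtain ⟨m, rfl⟩ := hm
      have h2 : ∀ i, ExteriorAlgebra.ι K (b i) * (ExteriorAlgebra.ι K m * con (b.coord i) y) =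
          -(ExteriorAlgebra.ι K m * (ExteriorAlgebra.ι K (b i) * con (b.coord i) y)) := by
        intro i
        rw [← mul_assoc, ← mul_assoc, eq_neg_iff_add_eq_zero, ← add_mul,
          ExteriorAlgebra.ι_add_mul_swap, zero_mul]
      simp only [con_ι_mul, mul_sub, h2, sub_neg_eq_add, Finset.sum_add_distrib, ← Finset.mul_sum,
        ih y hy, mul_smul_comm, ← smul_mul_assoc, ← map_smul (ExteriorAlgebra.ι K) _ (b _)]
      rw [← Finset.sum_mul, ← map_sum]
      simp only [Module.Basis.coord_apply, b.sum_repr]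
      rw [Nat.cast_succ, add_smul, one_smul, add_mul, smul_mul_assoc]
      abel
    | add x hx y hy h1 h2 =>
      simp only [map_add, mul_add, Finset.sum_add_distrib, h1, h2, smul_add]

lemma act_con (g : N →ₗ[K] M →ₗ[K] K) (d : Module.Dual K M) (a : ExteriorAlgebra K N)
    (x : ExteriorAlgebra K M) : con d (act g a x) = act g (invo a) (con d x) := by
  induction a using left_ind with
  | h0 r => rw [act_algebraMap, AlgHom.commutes invo, act_algebraMap, map_smul]
  | hadd a b ha hb => rw [act_add_apply, map_add, map_add invo, act_add_apply, ha, hb]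
  | hm a n ha =>
    rw [map_mul, map_mul, invo_ι, map_mul, map_neg, Module.End.mul_apply, Module.End.mul_apply,
      LinearMap.neg_apply, act_ι, act_ι, con_comm, ha]

/-- `tr E(x, a) = k (a · x)` for `x ∈ ⋀^k M`. -/
lemma trace_endo [Module.Free K M] [Module.Finite K M] (g : N →ₗ[K] M →ₗ[K] K) (k : ℕ)
    (x : ExteriorAlgebra K M) (hx : x ∈ ⋀[K]^k M) (a : ExteriorAlgebra K N) :
    LinearMap.trace K M (endo g x a) = k * pair g a x := by
  classical
  let b := Module.Free.chooseBasis K M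
  rw [LinearMap.trace_eq_matrix_trace K b, Matrix.trace, ← pair_smul_right, ← euler b k x hx, pair,
    map_sum, map_sum]
  refine Finset.sum_congr rfl fun i _ => ?_
  rw [Matrix.diag_apply, LinearMap.toMatrix_apply, ← pair, ι_mul_eq, pair_mul_ι, ← pair_invo,
    pair, ← act_con, ← Module.Basis.coord_apply, ← act_ι]
  simp only [endo, LinearMap.coe_mk, AddHom.coe_mk]
  rw [apply_ιInv]

end Exterior

/-! ## The 5-graded algebras `Ẽ` and `E` -/

section Algebra

variable {K N M : Type*} [CommRing K] [AddCommGroup N] [Module K N] [AddCommGroup M] [Module K M]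
  (g : N →ₗ[K] M →ₗ[K] K)

@[simp] lemma derPow_add (n : ℕ) (A : Module.End K M) (x y : ⋀[K]^n M) :
    derPow n A (x + y) = derPow n A x + derPow n A y := Subtype.ext (map_add (der A) _ _)

@[simp] lemma derPow_smul (n : ℕ) (A : Module.End K M) (r : K) (x : ⋀[K]^n M) :
    derPow n A (r • x) = r • derPow n A x := Subtype.ext (map_smul (der A) _ _)

@[simp] lemma add_derPow (n : ℕ) (A B : Module.End K M) (x : ⋀[K]^n M) :
    derPow n (A + B) x = derPow n A x + derPow n B x :=
  Subtype.ext (congrArg (fun f => f (x : ExteriorAlgebra K M)) (der_add A B))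

@[simp] lemma smul_derPow (n : ℕ) (r : K) (A : Module.End K M) (x : ⋀[K]^n M) :
    derPow n (r • A) x = r • derPow n A x :=
  Subtype.ext (congrArg (fun f => f (x : ExteriorAlgebra K M)) (der_smul r A))

@[simp] lemma mul33_add (x y z : ⋀[K]^3 M) : mul33 x (y + z) = mul33 x y + mul33 x z :=
  Subtype.ext (mul_add _ _ _)

@[simp] lemma add_mul33 (x y z : ⋀[K]^3 M) : mul33 (x + y) z = mul33 x z + mul33 y z :=
  Subtype.ext (add_mul _ _ _)

@[simp] lemma mul33_smul (r : K) (x y : ⋀[K]^3 M) : mul33 x (r • y) = r • mul33 x y :=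
  Subtype.ext (mul_smul_comm _ _ _)

@[simp] lemma smul_mul33 (r : K) (x y : ⋀[K]^3 M) : mul33 (r • x) y = r • mul33 x y :=
  Subtype.ext (smul_mul_assoc _ _ _)

@[simp] lemma act36_add (a : ⋀[K]^3 N) (x y : ⋀[K]^6 M) :
    act36 g a (x + y) = act36 g a x + act36 g a y := Subtype.ext (map_add (act g a) _ _)

@[simp] lemma act36_smul (r : K) (a : ⋀[K]^3 N) (x : ⋀[K]^6 M) :
    act36 g a (r • x) = r • act36 g a x := Subtype.ext (map_smul (act g a) _ _)

@[simp] lemma add_act36 (a b : ⋀[K]^3 N) (x : ⋀[K]^6 M) :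
    act36 g (a + b) x = act36 g a x + act36 g b x := Subtype.ext (act_add_apply g _ _ _)

@[simp] lemma smul_act36 (r : K) (a : ⋀[K]^3 N) (x : ⋀[K]^6 M) :
    act36 g (r • a) x = r • act36 g a x :=
  Subtype.ext (congrArg (fun f => f (x : ExteriorAlgebra K M)) (map_smul (act g) r _))

/-- The space `S` of pairs `(A⁻, A⁺) ∈ End N × End M` with `g(A⁻ v, w) + g(v, A⁺ w) = 0`. -/
def S : Submodule K (Module.End K N × Module.End K M) where
  carrier := {A | ∀ v w, g (A.1 v) w + g v (A.2 w) = 0}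
  add_mem' {A B} hA hB v w := by
    have h1 := hA v w
    have h2 := hB v w
    simp only [Prod.fst_add, Prod.snd_add, LinearMap.add_apply, map_add]
    linear_combination h1 + h2
  zero_mem' v w := by simp
  smul_mem' c A hA v w := by
    have h1 := hA v w
    simp only [Prod.smul_fst, Prod.smul_snd, LinearMap.smul_apply, map_smul, smul_eq_mul]
    linear_combination c * h1

variable {g}

/-- The commutator on `S`. -/
def comm (A B : S g) : S g :=
  ⟨(A.1.1 * B.1.1 - B.1.1 * A.1.1, A.1.2 * B.1.2 - B.1.2 * A.1.2), fun v w => by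
    have h1 := A.2 (B.1.1 v) w
    have h2 := A.2 v (B.1.2 w)
    have h3 := B.2 (A.1.1 v) w
    have h4 := B.2 v (A.1.2 w)
    simp only [LinearMap.sub_apply, Module.End.mul_apply, map_sub]
    linear_combination h1 + h2 - h3 - h4⟩

variable (g)

/-- The element `h_M = (-id, id)` of `S`. -/
def hM : S g := ⟨(-1, 1), fun v w => by simp⟩

/-- The element `E(x⁻, x⁺) = (E(x⁻, x⁺), -E(x⁺, x⁻))` of `S` for `x⁻ ∈ ⋀^3 N`, `x⁺ ∈ ⋀^3 M`. -/
def endoS (x : ⋀[K]^3 N) (y : ⋀[K]^3 M) : S g :=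
  ⟨(endo g.flip x y, -endo g y x), fun v w => by
    rw [LinearMap.neg_apply, map_neg, endo_adjoint, add_neg_cancel]⟩

@[simp] lemma comm_add (A B C : S g) : comm A (B + C) = comm A B + comm A C := by
  ext1; ext1 <;> simp only [comm, Submodule.coe_add, Prod.fst_add, Prod.snd_add] <;> noncomm_ring

@[simp] lemma add_comm' (A B C : S g) : comm (A + B) C = comm A C + comm B C := by
  ext1; ext1 <;> simp only [comm, Submodule.coe_add, Prod.fst_add, Prod.snd_add] <;> noncomm_ring

@[simp] lemma comm_smul (r : K) (A B : S g) : comm A (r • B) = r • comm A B := by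
  ext1; ext1 <;> simp only [comm, Submodule.coe_smul, Prod.smul_fst, Prod.smul_snd, mul_smul_comm,
    smul_mul_assoc, smul_sub]

@[simp] lemma smul_comm' (r : K) (A B : S g) : comm (r • A) B = r • comm A B := by
  ext1; ext1 <;> simp only [comm, Submodule.coe_smul, Prod.smul_fst, Prod.smul_snd, mul_smul_comm,
    smul_mul_assoc, smul_sub]

@[simp] lemma endoS_add (x : ⋀[K]^3 N) (y z : ⋀[K]^3 M) :
    endoS g x (y + z) = endoS g x y + endoS g x z := by
  ext1; ext1
  · exact endo_add_right _ _ _ _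
  · simp only [endoS, Submodule.coe_add, Prod.snd_add, endo_add_left, neg_add]

@[simp] lemma add_endoS (x y : ⋀[K]^3 N) (z : ⋀[K]^3 M) :
    endoS g (x + y) z = endoS g x z + endoS g y z := by
  ext1; ext1
  · exact endo_add_left _ _ _ _
  · simp only [endoS, Submodule.coe_add, Prod.snd_add, endo_add_right, neg_add]

@[simp] lemma endoS_smul (r : K) (x : ⋀[K]^3 N) (y : ⋀[K]^3 M) :
    endoS g x (r • y) = r • endoS g x y := by
  ext1; ext1
  · exact endo_smul_right _ _ _ _
  · simp only [endoS, Submodule.coe_smul, Prod.smul_snd, endo_smul_left, smul_neg]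

@[simp] lemma smul_endoS (r : K) (x : ⋀[K]^3 N) (y : ⋀[K]^3 M) :
    endoS g (r • x) y = r • endoS g x y := by
  ext1; ext1
  · exact endo_smul_left _ _ _ _
  · simp only [endoS, Submodule.coe_smul, Prod.smul_snd, endo_smul_right, smul_neg]

/-- The 5-graded module `Ẽ = ⋀^6 N ⊕ ⋀^3 N ⊕ (S ⊕ K h₀) ⊕ ⋀^3 M ⊕ ⋀^6 M`, with components in
degrees `-2, -1, 0, 1, 2`.  The component in degree `0` is `s + c h₀`. -/
@[ext]
structure Etilde where
  /-- component in degree `-2` -/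
  n2 : ⋀[K]^6 N
  /-- component in degree `-1` -/
  n1 : ⋀[K]^3 N
  /-- component in `S` of the component in degree `0` -/
  s : S g
  /-- coefficient of `h₀` in the component in degree `0` -/
  c : K
  /-- component in degree `1` -/
  p1 : ⋀[K]^3 M
  /-- component in degree `2` -/
  p2 : ⋀[K]^6 M

namespace Etilde

/-- `Ẽ` as a product. -/
def equivProd : Etilde g ≃ (⋀[K]^6 N) × (⋀[K]^3 N) × (S g) × K × (⋀[K]^3 M) × (⋀[K]^6 M) where
  toFun x := (x.n2, x.n1, x.s, x.c, x.p1, x.p2)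
  invFun y := ⟨y.1, y.2.1, y.2.2.1, y.2.2.2.1, y.2.2.2.2.1, y.2.2.2.2.2⟩
  left_inv _ := rfl
  right_inv _ := rfl

instance : AddCommGroup (Etilde g) := (equivProd g).addCommGroup

instance : Module K (Etilde g) := (equivProd g).module K

variable {g}

@[simp] lemma n2_add (x y : Etilde g) : (x + y).n2 = x.n2 + y.n2 := rfl
@[simp] lemma n1_add (x y : Etilde g) : (x + y).n1 = x.n1 + y.n1 := rfl
@[simp] lemma s_add (x y : Etilde g) : (x + y).s = x.s + y.s := rfl
@[simp] lemma c_add (x y : Etilde g) : (x + y).c = x.c + y.c := rfl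
@[simp] lemma p1_add (x y : Etilde g) : (x + y).p1 = x.p1 + y.p1 := rfl
@[simp] lemma p2_add (x y : Etilde g) : (x + y).p2 = x.p2 + y.p2 := rfl
@[simp] lemma n2_smul (r : K) (x : Etilde g) : (r • x).n2 = r • x.n2 := rfl
@[simp] lemma n1_smul (r : K) (x : Etilde g) : (r • x).n1 = r • x.n1 := rfl
@[simp] lemma s_smul (r : K) (x : Etilde g) : (r • x).s = r • x.s := rfl
@[simp] lemma c_smul (r : K) (x : Etilde g) : (r • x).c = r * x.c := rfl
@[simp] lemma p1_smul (r : K) (x : Etilde g) : (r • x).p1 = r • x.p1 := rfl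
@[simp] lemma p2_smul (r : K) (x : Etilde g) : (r • x).p2 = r • x.p2 := rfl
@[simp] lemma s_zero : (0 : Etilde g).s = 0 := rfl
@[simp] lemma c_zero : (0 : Etilde g).c = 0 := rfl

/-- The product of `Ẽ`.  For `A ∈ S`, `p_j, q_j` in degree `j`, it is the skew-symmetric product
with `[A, p_i] = A ∘ p_i`, `[h₀, p_i] = i p_i`, the commutator on `S`, `[h₀, S] = 0`,
`[p₋₁, q₁] = E(p₋₁, q₁) + (p₋₁ · q₁) h₀`, `[p₋₂, q₂] = -(p₋₂ · q₂) (h_M - 2 h₀)`,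
`[p_i, q_i] = p_i q_i` and `[p_i, q_{-2i}] = p_i · q_{-2i}` for `i = ± 1`. -/
def bracket (x y : Etilde g) : Etilde g where
  n2 := derPow 6 x.s.1.1 y.n2 - derPow 6 y.s.1.1 x.n2 - (2 * x.c) • y.n2 + (2 * y.c) • x.n2 +
    mul33 x.n1 y.n1
  n1 := derPow 3 x.s.1.1 y.n1 - derPow 3 y.s.1.1 x.n1 - x.c • y.n1 + y.c • x.n1 +
    act36 g.flip x.p1 y.n2 - act36 g.flip y.p1 x.n2
  s := comm x.s y.s + endoS g x.n1 y.p1 - endoS g y.n1 x.p1 -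
    (pair g x.n2 y.p2 - pair g y.n2 x.p2) • hM g
  c := pair g x.n1 y.p1 - pair g y.n1 x.p1 + 2 * (pair g x.n2 y.p2 - pair g y.n2 x.p2)
  p1 := derPow 3 x.s.1.2 y.p1 - derPow 3 y.s.1.2 x.p1 + x.c • y.p1 - y.c • x.p1 +
    act36 g x.n1 y.p2 - act36 g y.n1 x.p2
  p2 := derPow 6 x.s.1.2 y.p2 - derPow 6 y.s.1.2 x.p2 + (2 * x.c) • y.p2 - (2 * y.c) • x.p2 +
    mul33 x.p1 y.p1

lemma bracket_add_left (x x' y : Etilde g) :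
    bracket (x + x') y = bracket x y + bracket x' y := by
  ext1 <;>
  · simp only [bracket, n2_add, n1_add, s_add, c_add, p1_add, p2_add,
      Submodule.coe_add, Prod.fst_add, Prod.snd_add,
      derPow_add, add_derPow, add_mul33, act36_add, add_act36,add_comm',
      endoS_add, add_endoS, pair_add_left, pair_add_right]
    first | module | ring1

lemma bracket_add_right (x y y' : Etilde g) :
    bracket x (y + y') = bracket x y + bracket x y' := by
  ext1 <;>
  · simp only [bracket, n2_add, n1_add, s_add, c_add, p1_add, p2_add,
      Submodule.coe_add, Prod.fst_add, Prod.snd_add,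
      derPow_add, add_derPow, mul33_add, act36_add, add_act36, comm_add, endoS_add, add_endoS, pair_add_left, pair_add_right]
    first | module | ring1

lemma bracket_smul_left (r : K) (x y : Etilde g) : bracket (r • x) y = r • bracket x y := by
  ext1 <;>
  · simp only [bracket, n2_smul, n1_smul, s_smul, c_smul, p1_smul, p2_smul,
      Submodule.coe_smul, Prod.smul_fst, Prod.smul_snd,
      derPow_smul, smul_derPow, smul_mul33, act36_smul, smul_act36,smul_comm', endoS_smul, smul_endoS, pair_smul_left, pair_smul_right]
    first | module | ring1

lemma bracket_smul_right (r : K) (x y : Etilde g) : bracket x (r • y) = r • bracket x y := by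
  ext1 <;>
  · simp only [bracket, n2_smul, n1_smul, s_smul, c_smul, p1_smul, p2_smul,
      Submodule.coe_smul, Prod.smul_fst, Prod.smul_snd,
      derPow_smul, smul_derPow, mul33_smul, act36_smul, smul_act36, comm_smul,
      endoS_smul, smul_endoS, pair_smul_left, pair_smul_right]
    first | module | ring1

end Etilde

/-- The submodule `E` of `Ẽ`: all elements for which the component `(A⁻, A⁺) + c h₀` in degree `0`
satisfies `tr A⁺ + 3 c = 0`. -/
def E : Submodule K (Etilde g) where
  carrier := {x | LinearMap.trace K M x.s.1.2 + 3 * x.c = 0}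
  add_mem' {x y} hx hy := by
    simp only [Set.mem_ofPred_eq, Etilde.s_add, Etilde.c_add, Submodule.coe_add, Prod.snd_add,
      map_add] at *
    linear_combination hx + hy
  zero_mem' := by simp
  smul_mem' r x hx := by
    simp only [Set.mem_ofPred_eq, Etilde.s_smul, Etilde.c_smul, Submodule.coe_smul, Prod.smul_snd,
      map_smul, smul_eq_mul] at *
    linear_combination r * hx

variable [Module.Free K M] [Module.Finite K M] [h6 : Fact (Module.finrank K M = 6)]

lemma bracket_mem (x y : Etilde g) : Etilde.bracket x y ∈ E g := by
  change LinearMap.trace K M (Etilde.bracket x y).s.1.2 + 3 * (Etilde.bracket x y).c = 0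
  have h1 : LinearMap.trace K M 1 = 6 := by
    rw [LinearMap.trace_one, h6.out]; norm_num
  have h2 := trace_endo g 3 y.p1 y.p1.2 x.n1
  have h3 := trace_endo g 3 x.p1 x.p1.2 y.n1
  simp only [Etilde.bracket, comm, endoS, hM, Submodule.coe_add, Submodule.coe_sub,
    Submodule.coe_smul, Prod.snd_add, Prod.snd_sub, Prod.smul_snd, map_add, map_sub, map_smul,
    map_neg, smul_eq_mul, h1, h2, h3, LinearMap.trace_mul_comm K x.s.1.2 y.s.1.2]
  push_cast
  ring

/-- The product of `E`, a bilinear map. -/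
def product : E g →ₗ[K] E g →ₗ[K] E g :=
  LinearMap.mk₂ K (fun x y => ⟨Etilde.bracket x.1 y.1, bracket_mem g x.1 y.1⟩)
    (fun x x' y => Subtype.ext (Etilde.bracket_add_left x.1 x'.1 y.1))
    (fun r x y => Subtype.ext (Etilde.bracket_smul_left r x.1 y.1))
    (fun x y y' => Subtype.ext (Etilde.bracket_add_right x.1 y.1 y'.1))
    (fun r x y => Subtype.ext (Etilde.bracket_smul_right r x.1 y.1))

end Algebra

/-! ## Lie algebras, type, Chevalley bases -/

section Lie

/-- A bilinear product `p` on a module `L` makes `L` a Lie algebra. -/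
structure IsLieProduct {K L : Type*} [CommRing K] [AddCommGroup L] [Module K L]
    (p : L →ₗ[K] L →ₗ[K] L) : Prop where
  self : ∀ x, p x x = 0
  jacobi : ∀ x y z, p x (p y z) = p (p x y) z + p y (p x z)

variable {K L : Type*} [CommRing K] [AddCommGroup L] [Module K L] {p : L →ₗ[K] L →ₗ[K] L}

/-- The Lie ring with underlying additive group `L` and bracket `p`. -/
abbrev IsLieProduct.lieRing (h : IsLieProduct p) : LieRing L where
  bracket x y := p x y
  add_lie x y z := by simp
  lie_add x y z := by simp
  lie_self := h.self
  leibniz_lie := h.jacobi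

/-- The Lie algebra with underlying module `L` and bracket `p`. -/
abbrev IsLieProduct.lieAlgebra (h : IsLieProduct p) : letI := h.lieRing; LieAlgebra K L :=
  letI := h.lieRing
  { lie_smul := fun r x y => (p x).map_smul r y }

end Lie

section Chevalley

open LieAlgebra.IsKilling

variable (K : Type*) [Field K] [CharZero K] [IsAlgClosed K]

/-- `L` is a finite dimensional simple Lie algebra whose type is given by the Cartan matrix `A`:
the root system of `L` with respect to some Cartan subalgebra has a base whose Cartan matrix is `A`,
up to a reordering of the simple roots. -/
def IsSimpleOfType {n : Type*} (A : Matrix n n ℤ) (L : Type*) [LieRing L] [LieAlgebra K L] : Prop :=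
  ∃ (_ : FiniteDimensional K L) (_ : LieAlgebra.IsSimple K L)
    (H : LieSubalgebra K L) (_ : H.IsCartanSubalgebra) (b : (rootSystem H).Base)
    (e : n ≃ b.support), ∀ i j, b.cartanMatrix (e i) (e j) = A i j

/-- The families `h` and `x` (that is, the set of all `h i` and `x k`) form a Chevalley basis of the
finite dimensional semisimple Lie algebra `L`.  That is, together they are a basis of `L`, and for
some Cartan subalgebra `H` and some base `b` of its root system:
* the `h i` are the coroots of the simple roots;
* the `x k` are root vectors `x_α`, one for each root `α`;
* `[x_α, x_{-α}]` is the coroot of `α`;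
* if `α`, `β`, `α + β` are roots, and `[x_α, x_β] = c x_{α + β}`, then
  `[x_{-α}, x_{-β}] = -c x_{-(α + β)}`. -/
def IsChevalleyBasis {ι κ L : Type*} [LieRing L] [LieAlgebra K L] (h : ι → L) (x : κ → L) : Prop :=
  LinearIndependent K (Sum.elim h x) ∧ Submodule.span K (Set.range (Sum.elim h x)) = ⊤ ∧
  ∃ (_ : FiniteDimensional K L) (_ : LieAlgebra.IsKilling K L)
    (H : LieSubalgebra K L) (_ : H.IsCartanSubalgebra) (b : (rootSystem H).Base)
    (e : ι ≃ b.support) (r : κ ≃ H.root),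
    (∀ i, h i = (rootSystem H).coroot (e i)) ∧
    (∀ k, x k ∈ LieAlgebra.rootSpace H (r k).1) ∧
    (∀ k k', (rootSystem H).root (r k') = -(rootSystem H).root (r k) →
      ⁅x k, x k'⁆ = ((rootSystem H).coroot (r k) : L)) ∧
    (∀ k l m k' l' m',
      (rootSystem H).root (r m) = (rootSystem H).root (r k) + (rootSystem H).root (r l) →
      (rootSystem H).root (r k') = -(rootSystem H).root (r k) →
      (rootSystem H).root (r l') = -(rootSystem H).root (r l) →
      (rootSystem H).root (r m') = -(rootSystem H).root (r m) →
      ∀ c : K, ⁅x k, x l⁆ = c • x m → ⁅x k', x l'⁆ = -c • x m')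

end Chevalley

/-! ## The algebra `E(K⁶, K⁶, ·)` and the set `B_E` -/

section Standard

variable (K : Type*) [Field K]

/-- The dot product on `K⁶`. -/
abbrev dot : (Fin 6 → K) →ₗ[K] (Fin 6 → K) →ₗ[K] K := dotProductBilin K K

instance : Fact (Module.finrank K (Fin 6 → K) = 6) := ⟨by simp⟩

/-- `ι⁺(A) = (-A*, A) ∈ S` for a matrix `A`, where the adjoint `A*` is the transpose of `A`. -/
def iotaPlus (A : Matrix (Fin 6) (Fin 6) K) : S (dot K) :=
  ⟨(-Matrix.toLin' A.transpose, Matrix.toLin' A), fun v w => by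
    simp [dotProductBilin, Matrix.mulVec_transpose, Matrix.dotProduct_mulVec]⟩

variable {K}

/-- The element `ι⁺(A) + c h₀` of `E`, where `tr A + 3 c = 0`. -/
def degZero (A : Matrix (Fin 6) (Fin 6) K) (c : K) (h : A.trace + 3 * c = 0) : E (dot K) :=
  ⟨⟨0, 0, iotaPlus K A, c, 0, 0⟩, by
    change LinearMap.trace K _ (Matrix.toLin' A) + 3 * c = 0
    rw [Matrix.trace_toLin'_eq, h]⟩

variable (K)

/-- The elements `h_1, …, h_6` (with indices `0, …, 5`): `h_i = ι⁺(E_{i,i} - E_{i+1,i+1})` for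
`1 ≤ i ≤ 5`, and `h_6 = ι⁺(E_{4,4} + E_{5,5} + E_{6,6}) - h₀`. -/
def hB : Fin 6 → E (dot K) :=
  Fin.snoc (α := fun _ => E (dot K))
    (fun i : Fin 5 => degZero
      (Matrix.single i.castSucc i.castSucc 1 - Matrix.single i.succ i.succ 1) 0 (by
        simp [Matrix.trace_sub]))
    (degZero (Matrix.single 3 3 1 + Matrix.single 4 4 1 + Matrix.single 5 5 1) (-1) (by
      simp [Matrix.trace_add]; norm_num))

/-- `v_S⁺ = v_{i_1} ⋯ v_{i_n}` for `S = {i_1 < ⋯ < i_n}`, with the standard basis of `K⁶`. -/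
def vPlus {n : ℕ} (s : Finset (Fin 6)) (hs : s.card = n) : ⋀[K]^n (Fin 6 → K) :=
  exteriorPower.ιMulti K n fun k => Pi.single (s.orderEmbOfFin hs k) 1

/-- `v_S⁻ = v_{i_n} ⋯ v_{i_1}` for `S = {i_1 < ⋯ < i_n}`, with the standard basis of `K⁶`. -/
def vMinus {n : ℕ} (s : Finset (Fin 6)) (hs : s.card = n) : ⋀[K]^n (Fin 6 → K) :=
  exteriorPower.ιMulti K n fun k => Pi.single (s.orderEmbOfFin hs k.rev) 1

/-- The labels of the elements of `B_E` other than the `h_i`. -/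
inductive Label
  /-- the label of `ι⁺(E_{ij})`, `i ≠ j` -/
  | unit (i j : Fin 6) (h : i ≠ j)
  /-- the label of `v_S⁺`, `|S| = 3` -/
  | plus (s : Finset (Fin 6)) (hs : s.card = 3)
  /-- the label of `v_S⁻`, `|S| = 3` -/
  | minus (s : Finset (Fin 6)) (hs : s.card = 3)
  /-- the label of `v_S⁺`, `S = {1, …, 6}` -/
  | topPlus
  /-- the label of `v_S⁻`, `S = {1, …, 6}` -/
  | topMinus

/-- The elements of `B_E` other than the `h_i`. -/
def xB : Label → E (dot K)
  | .unit i j h => degZero (Matrix.single i j 1) 0 (by simp [h])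
  | .plus s hs => ⟨⟨0, 0, 0, 0, vPlus K s hs, 0⟩, by simp [E]⟩
  | .minus s hs => ⟨⟨0, vMinus K s hs, 0, 0, 0, 0⟩, by simp [E]⟩
  | .topPlus => ⟨⟨0, 0, 0, 0, 0, vPlus K Finset.univ (by simp)⟩, by simp [E]⟩
  | .topMinus => ⟨⟨vMinus K Finset.univ (by simp), 0, 0, 0, 0, 0⟩, by simp [E]⟩

end Standard

end ExteriorE6

end

/-! The proof separates the Jacobi identity from the structure theory.

For the Jacobi identity, every product between graded pieces is built from the contraction of one
exterior algebra by the other. These products are equivariant under `S` (`der_act`, `pair_der`,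
`endo_der`), which settles the cases with an argument in `S`. Two further facts give the rest.
Contraction of a product of two cubic elements expands by the Leibniz rule into scalar terms and
derivation terms (`act_mul_of_mem`). A top-degree element `t` is killed by multiplication by
vectors, so `(x · a) · t = x (a · t)` (`act_act_of_ι_mul_eq_zero`). The resulting list of identities
is collected in `FiveGrading`, where the Jacobi identity is bilinear algebra (`FiveGrading.jacobi`).

The structure theory rests on a criterion, `IsSimplyLacedBasis`: a basis of commuting elements `h i`
and their eigenvectors `x k`, with integral weights, where `[x k, x (neg k)]` has the same
coordinates in the `h i` as the weight has in the simple weights. Eigenspace projections show that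
an ideal is generated by root vectors, and connectedness of the non-orthogonality graph gives
simplicity (`isSimple`). The span of the `h i` is self-normalizing, and its roots are exactly the
given weights (`isCartanSubalgebra`, `root_bijective`).

For the concrete algebra, a root is recorded by its diagonal weight `d` in `ℤ⁶` and its degree `e`,
subject to `∑ dᵢ = 3e`. The invariant form is `d · d' - e e'`, so the root lattice is realized
inside the orthogonal complement of `(1,1,1,1,1,1;3)` in the Lorentzian lattice `ℤ^{6,1}`. The 72
labels all have norm 2. The sign condition of a Chevalley basis follows from the involution that
exchanges degrees `i` and `-i`: it sends each `x k` to `-x (neg k)`, because reversing three or six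
factors is an odd permutation. -/

namespace ExteriorE6

/-! ### Derivations and contractions in exterior algebras. -/

section Identities

variable {K N M : Type*} [CommRing K] [AddCommGroup N] [Module K N] [AddCommGroup M] [Module K M]

open ExteriorAlgebra (algebraMapInv ιInv ι)

lemma der_algebraMap (A : Module.End K M) (r : K) : der A (algebraMap K _ r) = 0 := by
  rw [Algebra.algebraMap_eq_smul_one, map_smul, der_one, smul_zero]

lemma der_ι_mul (A : Module.End K M) (m : M) (x : ExteriorAlgebra K M) :
    der A (ι K m * x) = ι K m * der A x + ι K (A m) * x := by
  rw [der_mul, der_ι]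

lemma der_mul_apply (A B : Module.End K M) (x : ExteriorAlgebra K M) :
    der (A * B - B * A) x = der A (der B x) - der B (der A x) := by
  induction x using left_ind with
  | h0 r => simp [der_algebraMap]
  | hadd x y hx hy => simp only [map_add, hx, hy]; abel
  | hm x m hx =>
    simp only [der_ι_mul, map_add, hx, LinearMap.sub_apply, Module.End.mul_apply, map_sub, mul_sub,
      sub_mul]
    abel

lemma der_one_apply (n : ℕ) (x : ExteriorAlgebra K M) (hx : x ∈ ⋀[K]^n M) :
    der (1 : Module.End K M) x = (n : K) • x := by
  induction n generalizing x with
  | zero =>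
    rw [power_zero] at hx
    obtain ⟨r, rfl⟩ := Submodule.mem_one.mp hx
    simp [der_algebraMap]
  | succ n ih =>
    rw [power_succ] at hx
    induction hx using Submodule.mul_induction_on' with
    | mem_mul_mem m hm y hy =>
      obtain ⟨m, rfl⟩ := hm
      rw [der_ι_mul, ih y hy, Module.End.one_apply, mul_smul_comm, Nat.cast_succ, add_smul,
        one_smul]
    | add a ha b hb h1 h2 => rw [map_add, h1, h2, smul_add]

/-- Since `A'` is minus the adjoint of `A`, contraction is invariant under the pair. This is the
source of the equivariance of the action, of the pairing and of `endo`, and thus of every case of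
the Jacobi identity that has an argument in `S`. -/
lemma der_con {g : N →ₗ[K] M →ₗ[K] K} {A' : Module.End K N} {A : Module.End K M}
    (hA : ∀ v w, g (A' v) w + g v (A w) = 0) (v : N) (x : ExteriorAlgebra K M) :
    der A (con (g v) x) = con (g (A' v)) x + con (g v) (der A x) := by
  induction x using left_ind with
  | h0 r => simp [con_algebraMap, der_algebraMap]
  | hadd x y hx hy => simp only [map_add, hx, hy]; abel
  | hm x m hx =>
    simp only [con_ι_mul, der_ι_mul, map_sub, map_smul, map_add, hx, mul_add]
    rw [eq_neg_of_add_eq_zero_left (hA v m), neg_smul]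
    abel

lemma der_act {g : N →ₗ[K] M →ₗ[K] K} {A' : Module.End K N} {A : Module.End K M}
    (hA : ∀ v w, g (A' v) w + g v (A w) = 0) (a : ExteriorAlgebra K N) (x : ExteriorAlgebra K M) :
    der A (act g a x) = act g (der A' a) x + act g a (der A x) := by
  induction a using left_ind generalizing x with
  | h0 r => simp [der_algebraMap]
  | hadd a b ha hb => simp only [map_add, LinearMap.add_apply, ha, hb]; abel
  | hm a n ha =>
    simp only [der_ι_mul, map_add, map_mul, LinearMap.add_apply, Module.End.mul_apply, act_ι,
      der_con hA, ha]
    abel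

lemma scal_der (A : Module.End K M) (x : ExteriorAlgebra K M) :
    algebraMapInv (R := K) (der A x) = 0 := by
  induction x using left_ind with
  | h0 r => simp [der_algebraMap]
  | hadd x y hx hy => simp only [map_add, hx, hy, add_zero]
  | hm x m hx => rw [der_ι_mul, map_add, scal_ι_mul, scal_ι_mul, add_zero]

lemma pair_der {g : N →ₗ[K] M →ₗ[K] K} {A' : Module.End K N} {A : Module.End K M}
    (hA : ∀ v w, g (A' v) w + g v (A w) = 0) (a : ExteriorAlgebra K N) (x : ExteriorAlgebra K M) :
    pair g (der A' a) x + pair g a (der A x) = 0 := by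
  rw [pair, pair, ← map_add, ← der_act hA, scal_der]

lemma ιInv_der (A : Module.End K M) (x : ExteriorAlgebra K M) :
    ιInv (der A x) = A (ιInv x) := by
  induction x using left_ind with
  | h0 r => simp [der_algebraMap, ιInv_algebraMap]
  | hadd x y hx hy => simp only [map_add, hx, hy]
  | hm x m hx => rw [der_ι_mul, map_add, ιInv_ι_mul, ιInv_ι_mul, ιInv_ι_mul, scal_der, zero_smul,
      zero_add, map_smul]

lemma endo_apply (g : N →ₗ[K] M →ₗ[K] K) (x : ExteriorAlgebra K M) (a : ExteriorAlgebra K N)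
    (m : M) : endo g x a m = ιInv (act g (con (g.flip m) a) x) := by
  rw [← act_ι]; rfl

lemma endo_der {g : N →ₗ[K] M →ₗ[K] K} {A' : Module.End K N} {A : Module.End K M}
    (hA : ∀ v w, g (A' v) w + g v (A w) = 0) (x : ExteriorAlgebra K M) (a : ExteriorAlgebra K N) :
    A * endo g x a - endo g x a * A = endo g (der A x) a + endo g x (der A' a) := by
  have hA' : ∀ v w, g.flip (A v) w + g.flip v (A' w) = 0 := fun v w => by
    rw [LinearMap.flip_apply, LinearMap.flip_apply, add_comm, hA]
  ext m
  simp only [LinearMap.sub_apply, LinearMap.add_apply, Module.End.mul_apply, endo_apply]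
  rw [← ιInv_der, der_act hA, der_con hA', map_add (act g), LinearMap.add_apply, map_add, map_add]
  abel

lemma con_mul (d : Module.Dual K M) (x y : ExteriorAlgebra K M) :
    con d (x * y) = con d x * y + invo x * con d y := by
  induction x using left_ind with
  | h0 r => rw [con_algebraMap, AlgHom.commutes, ← Algebra.smul_def, ← Algebra.smul_def, map_smul,
      zero_mul, zero_add]
  | hadd x z hx hz => simp only [map_add, add_mul, hx, hz]; abel
  | hm x m hx =>
    simp only [mul_assoc, con_ι_mul, hx, map_mul, invo_ι, sub_mul, mul_add, neg_mul,
      smul_mul_assoc]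
    abel

lemma invo_mem (n : ℕ) (x : ExteriorAlgebra K M) (hx : x ∈ ⋀[K]^n M) :
    invo x = (-1 : K) ^ n • x := by
  induction n generalizing x with
  | zero =>
    rw [power_zero] at hx
    obtain ⟨r, rfl⟩ := Submodule.mem_one.mp hx
    rw [AlgHom.commutes, pow_zero, one_smul]
  | succ n ih =>
    rw [power_succ] at hx
    induction hx using Submodule.mul_induction_on' with
    | mem_mul_mem m hm y hy =>
      obtain ⟨m, rfl⟩ := hm
      rw [map_mul, invo_ι, ih y hy, neg_mul, mul_smul_comm, pow_succ, mul_neg_one, neg_smul]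
    | add a ha b hb h1 h2 => rw [map_add, h1, h2, smul_add]

lemma mul_comm_of_mem (k n : ℕ) (x y : ExteriorAlgebra K M) (hx : x ∈ ⋀[K]^k M)
    (hy : y ∈ ⋀[K]^n M) : x * y = (-1 : K) ^ (k * n) • (y * x) := by
  induction k generalizing x with
  | zero =>
    rw [power_zero] at hx
    obtain ⟨r, rfl⟩ := Submodule.mem_one.mp hx
    rw [zero_mul, pow_zero, one_smul, Algebra.commutes]
  | succ k ih =>
    rw [power_succ] at hx
    induction hx using Submodule.mul_induction_on' with
    | mem_mul_mem m hm z hz =>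
      obtain ⟨m, rfl⟩ := hm
      rw [mul_assoc, ih z hz, mul_smul_comm, ← mul_assoc, ι_mul_eq, invo_mem n y hy,
        smul_mul_assoc, smul_mul_assoc, smul_smul, mul_assoc, ← pow_add, add_mul k, one_mul]
    | add a ha b hb h1 h2 => rw [add_mul, h1, h2, mul_add, smul_add]

lemma power_one : ⋀[K]^1 M = LinearMap.range (ι K : M →ₗ[K] _) := pow_one _

lemma ι_ιInv (x : ExteriorAlgebra K M) (hx : x ∈ ⋀[K]^1 M) : ι K (ιInv x) = x := by
  rw [power_one] at hx
  obtain ⟨m, rfl⟩ := hx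
  rw [ExteriorAlgebra.ι_leftInverse]

/-- If `t` is annihilated by `M`, then `(x · a) · t = x (a · t)`. -/
lemma act_act_of_ι_mul_eq_zero (g : N →ₗ[K] M →ₗ[K] K) (x : ExteriorAlgebra K M)
    (a : ExteriorAlgebra K N) (t : ExteriorAlgebra K M) (ht : ∀ m, ι K m * t = 0) :
    act g (act g.flip x a) t = x * act g a t := by
  -- Moving left multiplication by a vector past the action of `a` costs, up to the grading sign,
  -- the action of the contraction of `a` by that vector. On `t` the term with `ι K m * t`
  -- disappears.
  have h (m : M) (a : ExteriorAlgebra K N) (y : ExteriorAlgebra K M) :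
      act g (con (g.flip m) a) y = ι K m * act g a y - act g (invo a) (ι K m * y) := by
    induction a using left_ind generalizing y with
    | h0 r => simp [con_algebraMap]
    | hadd a b ha hb => simp only [map_add, LinearMap.add_apply, ha, hb, mul_add]; abel
    | hm a n ha =>
      simp only [con_ι_mul, map_sub, map_smul, map_mul, LinearMap.sub_apply, LinearMap.smul_apply,
        Module.End.mul_apply, act_ι, ha, invo_ι, map_neg, LinearMap.neg_apply,
        LinearMap.flip_apply]
      abel
  induction x using left_ind with
  | h0 r => rw [act_algebraMap, map_smul, LinearMap.smul_apply, Algebra.smul_def]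
  | hadd x y hx hy => simp only [map_add, LinearMap.add_apply, hx, hy, add_mul]
  | hm x m hx =>
    rw [map_mul, Module.End.mul_apply, act_ι, h, ht, map_zero, sub_zero, hx, mul_assoc]

lemma der_toSpan (d : Module.Dual K M) (m : M) (x : ExteriorAlgebra K M) :
    der (d.smulRight m) x = ι K m * con d x := by
  induction x using left_ind with
  | h0 r => simp [con_algebraMap, der_algebraMap]
  | hadd x y hx hy => simp only [map_add, mul_add, hx, hy]
  | hm x n hx =>
    rw [der_ι_mul, con_ι_mul, hx, ← mul_assoc, eq_neg_of_add_eq_zero_left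
      (ExteriorAlgebra.ι_add_mul_swap n m), LinearMap.smulRight_apply, map_smul, mul_sub,
      mul_smul_comm, smul_mul_assoc, neg_mul, mul_assoc]
    abel

/-- Cubic elements are sums of products of three vectors; scalars can be absorbed into a vector, so
additivity is the only closure property needed. -/
lemma power_three_induction {P : ExteriorAlgebra K M → Prop}
    (h : ∀ u v w : M, P (ι K u * (ι K v * ι K w))) (hadd : ∀ x y, P x → P y → P (x + y))
    (x : ExteriorAlgebra K M) (hx : x ∈ ⋀[K]^3 M) : P x := by
  rw [show (3 : ℕ) = 2 + 1 from rfl, power_succ] at hx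
  induction hx using Submodule.mul_induction_on' with
  | mem_mul_mem u hu y hy =>
    obtain ⟨u, rfl⟩ := hu
    rw [show (2 : ℕ) = 1 + 1 from rfl, power_succ] at hy
    induction hy using Submodule.mul_induction_on' with
    | mem_mul_mem v hv w hw =>
      obtain ⟨v, rfl⟩ := hv
      rw [power_one] at hw
      obtain ⟨w, rfl⟩ := hw
      exact h u v w
    | add a ha b hb h1 h2 => rw [mul_add]; exact hadd _ _ h1 h2
  | add a ha b hb h1 h2 => exact hadd _ _ h1 h2

/-- The endomorphism `E(x, n₁ n₂ n₃)` as a sum of three endomorphisms of rank one. -/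
lemma endo_mul_mul (g : N →ₗ[K] M →ₗ[K] K) (x : ExteriorAlgebra K M) (u v w : N) :
    endo g x (ι K u * (ι K v * ι K w)) =
      (g u).smulRight (ιInv (con (g v) (con (g w) x))) -
      (g v).smulRight (ιInv (con (g u) (con (g w) x))) +
      (g w).smulRight (ιInv (con (g u) (con (g v) x))) := by
  ext m
  simp only [endo_apply, con_ι_mul, con_ι, map_sub, map_mul, map_smul, act_ι, mul_sub,
    LinearMap.sub_apply, LinearMap.smul_apply, Module.End.mul_apply, act_algebraMap,
    LinearMap.add_apply, LinearMap.smulRight_apply, LinearMap.flip_apply]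
  abel

lemma der_endo_mul_mul (g : N →ₗ[K] M →ₗ[K] K) (x : ExteriorAlgebra K M) (hx : x ∈ ⋀[K]^3 M)
    (u v w : N) (y : ExteriorAlgebra K M) :
    der (endo g x (ι K u * (ι K v * ι K w))) y =
      con (g v) (con (g w) x) * con (g u) y - con (g u) (con (g w) x) * con (g v) y +
      con (g u) (con (g v) x) * con (g w) y := by
  have h (n n' : N) : con (g n) (con (g n') x) ∈ ⋀[K]^1 M := con_mem _ 1 _ (con_mem _ 2 _ hx)
  rw [endo_mul_mul, der_add, sub_eq_add_neg, der_add, ← neg_one_smul K, der_smul]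
  simp only [LinearMap.add_apply, LinearMap.smul_apply, der_toSpan, ι_ιInv _ (h _ _)]
  module

/-- For `r = u v w` the Leibniz rule distributes three contractions over two factors. The two terms
with all three on one factor are the scalar terms; the three with two on `p` and one on `q` form the
derivation by `endo g p r`, and the remaining three form the one by `endo g q r`. -/
lemma act_mul_of_mem (g : N →ₗ[K] M →ₗ[K] K) (r : ExteriorAlgebra K N) (hr : r ∈ ⋀[K]^3 N)
    (p q : ExteriorAlgebra K M) (hp : p ∈ ⋀[K]^3 M) (hq : q ∈ ⋀[K]^3 M) :
    act g r (p * q) = pair g r p • q - pair g r q • p - der (endo g p r) q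
      + der (endo g q r) p := by
  -- With the scalars replaced by degree-0 elements of the exterior algebra, both sides can be
  -- compared directly by the Leibniz rule.
  have hpair (x : ExteriorAlgebra K M) (hx : x ∈ ⋀[K]^3 M) (r : ExteriorAlgebra K N)
      (hr : r ∈ ⋀[K]^3 N) : algebraMap K _ (pair g r x) = act g r x := by
    have := act_mem g 3 r hr 0 x hx
    rw [power_zero] at this
    obtain ⟨s, hs⟩ := Submodule.mem_one.mp this
    rw [pair, ← hs, ExteriorAlgebra.algebraMap_leftInverse]
  rw [Algebra.smul_def, Algebra.smul_def, hpair p hp r hr, hpair q hq r hr]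
  clear hpair
  refine power_three_induction (P := fun r => act g r (p * q) = act g r p * q - act g r q * p -
    der (endo g p r) q + der (endo g q r) p) (fun u v w => ?_) (fun a b ha hb => ?_) r hr
  swap
  · simp only [map_add, LinearMap.add_apply, endo_add_right, der_add, ha, hb, add_mul]
    abel
  · rw [der_endo_mul_mul g p hp, der_endo_mul_mul g q hq]
    have h1 (x) (hx : x ∈ ⋀[K]^3 M) (n : N) : con (g n) x ∈ ⋀[K]^2 M := con_mem _ 2 _ hx
    have h2 (x) (hx : x ∈ ⋀[K]^3 M) (n n' : N) : con (g n) (con (g n') x) ∈ ⋀[K]^1 M :=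
      con_mem _ 1 _ (h1 x hx n')
    -- Degrees 1 and 2 commute without a sign.
    have hc (n n' n'' : N) : con (g n) (con (g n') q) * con (g n'') p =
        con (g n'') p * con (g n) (con (g n') q) := by
      rw [mul_comm_of_mem 1 2 _ _ (h2 q hq n n') (h1 p hp n'')]; simp
    have hc0 : p * con (g u) (con (g v) (con (g w) q)) =
        con (g u) (con (g v) (con (g w) q)) * p := by
      rw [mul_comm_of_mem 3 0 _ _ hp (con_mem _ 0 _ (h2 q hq v w))]; simp
    simp only [map_mul, Module.End.mul_apply, act_ι, con_mul, map_add, invo_mem 3 p hp, hc,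
      invo_mem 2 _ (h1 p hp _), invo_mem 1 _ (h2 p hp _ _), map_smul,
      smul_mul_assoc, ← hc0]
    module

end Identities


/-! ### The products of the graded pieces as bilinear maps, and their identities. -/

section Jacobi

variable {K N M : Type*} [CommRing K] [AddCommGroup N] [Module K N] [AddCommGroup M] [Module K M]

open ExteriorAlgebra (algebraMapInv ιInv ι)

lemma algebraMap_pair (g : N →ₗ[K] M →ₗ[K] K) (k : ℕ) (a : ExteriorAlgebra K N)
    (ha : a ∈ ⋀[K]^k N) (x : ExteriorAlgebra K M) (hx : x ∈ ⋀[K]^k M) :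
    algebraMap K _ (pair g a x) = act g a x := by
  have := act_mem g k a ha 0 x (by rwa [zero_add])
  rw [power_zero] at this
  obtain ⟨s, hs⟩ := Submodule.mem_one.mp this
  rw [pair, ← hs, ExteriorAlgebra.algebraMap_leftInverse]

/-- Contracting the equation `m t = 0` by `d` gives `d(m) t = m (d · t)`. -/
lemma mul_con_of_ι_mul_eq_zero (d : Module.Dual K M) (z t : ExteriorAlgebra K M)
    (hz : z ∈ ⋀[K]^1 M) (ht : ∀ m, ι K m * t = 0) :
    z * con d t = algebraMapInv (R := K) (con d z) • t := by
  rw [power_one] at hz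
  obtain ⟨m, rfl⟩ := hz
  have := con_ι_mul d m t
  rw [ht, map_zero, eq_comm, sub_eq_zero] at this
  rw [← this, con_ι, ExteriorAlgebra.algebraMap_leftInverse]

lemma der_neg (A : Module.End K M) (x : ExteriorAlgebra K M) : der (-A) x = -der A x := by
  rw [← neg_one_smul K A, der_smul, LinearMap.smul_apply, neg_one_smul]

/-- On a top-degree element a derivation acts by a trace. Each of the three rank-one terms of `endo
g p r` contributes the same scalar `r · p`, whence the factor 3. -/
lemma der_endo_of_ι_mul_eq_zero (g : N →ₗ[K] M →ₗ[K] K) (r : ExteriorAlgebra K N)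
    (hr : r ∈ ⋀[K]^3 N) (p t : ExteriorAlgebra K M) (hp : p ∈ ⋀[K]^3 M)
    (ht : ∀ m, ι K m * t = 0) : der (endo g p r) t = (3 * pair g r p) • t := by
  refine power_three_induction (P := fun r => der (endo g p r) t = (3 * pair g r p) • t)
    (fun u v w => ?_) (fun a b ha hb => ?_) r hr
  · have h2 (n n' : N) : con (g n) (con (g n') p) ∈ ⋀[K]^1 M :=
      con_mem _ 1 _ (con_mem _ 2 _ hp)
    rw [der_endo_mul_mul g p hp]
    simp only [mul_con_of_ι_mul_eq_zero _ _ t (h2 _ _) ht]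
    -- Anticommuting the contractions brings all three scalars to the order `u`, `v`, `w`; the signs
    -- produced cancel those of the rank-one decomposition.
    rw [con_comm (g v) (g u), con_comm (g w) (g u), con_comm (g w) (g v)]
    simp only [pair, map_neg, map_mul, Module.End.mul_apply, act_ι]
    module
  · rw [endo_add_right, der_add, LinearMap.add_apply, ha, hb, pair_add_left]
    module

variable (g : N →ₗ[K] M →ₗ[K] K)

/-- The action of `S` on `⋀^n N`. -/
def actN (n : ℕ) : S g →ₗ[K] ⋀[K]^n N →ₗ[K] ⋀[K]^n N :=
  LinearMap.mk₂ K (fun A x => derPow n A.1.1 x) (fun A B x => add_derPow n A.1.1 B.1.1 x)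
    (fun r A x => smul_derPow n r A.1.1 x) (fun A x y => derPow_add n A.1.1 x y)
    (fun r A x => derPow_smul n A.1.1 r x)

/-- The action of `S` on `⋀^n M`. -/
def actM (n : ℕ) : S g →ₗ[K] ⋀[K]^n M →ₗ[K] ⋀[K]^n M :=
  LinearMap.mk₂ K (fun A x => derPow n A.1.2 x) (fun A B x => add_derPow n A.1.2 B.1.2 x)
    (fun r A x => smul_derPow n r A.1.2 x) (fun A x y => derPow_add n A.1.2 x y)
    (fun r A x => derPow_smul n A.1.2 r x)

variable (K M) in
/-- The product `⋀^3 M × ⋀^3 M → ⋀^6 M` as a bilinear map. -/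
def wedge : ⋀[K]^3 M →ₗ[K] ⋀[K]^3 M →ₗ[K] ⋀[K]^6 M :=
  LinearMap.mk₂ K mul33 add_mul33 smul_mul33 mul33_add mul33_smul

/-- The contraction `⋀^3 N × ⋀^6 M → ⋀^3 M` as a bilinear map. -/
def contr : ⋀[K]^3 N →ₗ[K] ⋀[K]^6 M →ₗ[K] ⋀[K]^3 M :=
  LinearMap.mk₂ K (act36 g) (add_act36 g) (smul_act36 g) (act36_add g) (act36_smul g)

/-- The commutator of `S` as a bilinear map. -/
def commS : S g →ₗ[K] S g →ₗ[K] S g :=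
  LinearMap.mk₂ K comm (add_comm' g) (smul_comm' g) (comm_add g) (comm_smul g)

/-- The map `endoS` as a bilinear map. -/
def endoL : ⋀[K]^3 N →ₗ[K] ⋀[K]^3 M →ₗ[K] S g :=
  LinearMap.mk₂ K (endoS g) (add_endoS g) (smul_endoS g) (endoS_add g) (endoS_smul g)

/-- The pairing of `⋀^n N` and `⋀^n M` as a bilinear map. -/
def pairL (n : ℕ) : ⋀[K]^n N →ₗ[K] ⋀[K]^n M →ₗ[K] K :=
  LinearMap.mk₂ K (fun a x => pair g a x) (fun _ _ _ => pair_add_left g _ _ _)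
    (fun _ _ _ => pair_smul_left g _ _ _) (fun _ _ _ => pair_add_right g _ _ _)
    (fun _ _ _ => pair_smul_right g _ _ _)

variable {g}

lemma S_apply (A : S g) (v : N) (w : M) : g (A.1.1 v) w + g v (A.1.2 w) = 0 := A.2 v w

lemma S_apply_flip (A : S g) (v : M) (w : N) :
    g.flip (A.1.2 v) w + g.flip v (A.1.1 w) = 0 := by
  rw [add_comm]; exact A.2 w v

lemma actN_comm (n : ℕ) (A B : S g) (x : ⋀[K]^n N) :
    actN g n (commS g A B) x = actN g n A (actN g n B x) - actN g n B (actN g n A x) :=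
  Subtype.ext (der_mul_apply A.1.1 B.1.1 x)

lemma actM_comm (n : ℕ) (A B : S g) (x : ⋀[K]^n M) :
    actM g n (commS g A B) x = actM g n A (actM g n B x) - actM g n B (actM g n A x) :=
  Subtype.ext (der_mul_apply A.1.2 B.1.2 x)

lemma actN_hM (n : ℕ) (x : ⋀[K]^n N) : actN g n (hM g) x = -(n : K) • x := by
  refine Subtype.ext (?_ : der (-1) (x : ExteriorAlgebra K N) = -(n : K) • (x : ExteriorAlgebra K N))
  rw [der_neg, der_one_apply n (x : ExteriorAlgebra K N) x.2, neg_smul]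

lemma actM_hM (n : ℕ) (x : ⋀[K]^n M) : actM g n (hM g) x = (n : K) • x :=
  Subtype.ext (der_one_apply n (x : ExteriorAlgebra K M) x.2)

lemma actN_wedge (A : S g) (x y : ⋀[K]^3 N) :
    actN g 6 A (wedge K N x y) = wedge K N (actN g 3 A x) y + wedge K N x (actN g 3 A y) :=
  Subtype.ext ((der_mul A.1.1 _ _).trans (add_comm _ _))

lemma actM_wedge (A : S g) (x y : ⋀[K]^3 M) :
    actM g 6 A (wedge K M x y) = wedge K M (actM g 3 A x) y + wedge K M x (actM g 3 A y) :=
  Subtype.ext ((der_mul A.1.2 _ _).trans (add_comm _ _))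

lemma wedge_skew (x y : ⋀[K]^3 M) : wedge K M x y = -wedge K M y x :=
  Subtype.ext ((mul_comm_of_mem 3 3 _ _ x.2 y.2).trans (by
    rw [Odd.neg_one_pow (by decide), neg_one_smul]; rfl))

lemma actM_contr (A : S g) (r : ⋀[K]^3 N) (t : ⋀[K]^6 M) :
    actM g 3 A (contr g r t) = contr g (actN g 3 A r) t + contr g r (actM g 6 A t) :=
  Subtype.ext (der_act (S_apply A) _ _)

lemma actN_contr (A : S g) (p : ⋀[K]^3 M) (u : ⋀[K]^6 N) :
    actN g 3 A (contr g.flip p u) =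
      contr g.flip (actM g 3 A p) u + contr g.flip p (actN g 6 A u) :=
  Subtype.ext (der_act (S_apply_flip A) _ _)

lemma pairL_act (n : ℕ) (A : S g) (a : ⋀[K]^n N) (x : ⋀[K]^n M) :
    pairL g n (actN g n A a) x = -pairL g n a (actM g n A x) :=
  eq_neg_of_add_eq_zero_left (pair_der (S_apply A) _ _)

lemma commS_endoL (A : S g) (r : ⋀[K]^3 N) (p : ⋀[K]^3 M) :
    commS g A (endoL g r p) = endoL g (actN g 3 A r) p + endoL g r (actM g 3 A p) := by
  refine Subtype.ext (Prod.ext (endo_der (S_apply_flip A) _ _) ?_)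
  have := endo_der (S_apply A) (p : ExteriorAlgebra K M) (r : ExteriorAlgebra K N)
  change A.1.2 * (-endo g p r) - (-endo g p r) * A.1.2 =
    -endo g p (der A.1.1 r) + -endo g (der A.1.2 p) r
  rw [mul_neg, neg_mul, ← neg_sub', this]
  abel

lemma commS_endoL' (A : S g) (r : ⋀[K]^3 N) (p : ⋀[K]^3 M) :
    commS g (endoL g r p) A = -endoL g (actN g 3 A r) p - endoL g r (actM g 3 A p) := by
  rw [← neg_add', ← commS_endoL]
  exact Subtype.ext (Prod.ext (neg_sub _ _).symm (neg_sub _ _).symm)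

lemma commS_hM (A : S g) : commS g A (hM g) = 0 := by
  refine Subtype.ext (Prod.ext ?_ ?_)
  · change A.1.1 * (-1) - (-1) * A.1.1 = 0
    simp
  · change A.1.2 * 1 - 1 * A.1.2 = 0
    simp

lemma hM_commS (A : S g) : commS g (hM g) A = 0 := by
  refine Subtype.ext (Prod.ext ?_ ?_)
  · change (-1) * A.1.1 - A.1.1 * (-1) = 0
    simp
  · change 1 * A.1.2 - A.1.2 * 1 = 0
    simp

lemma commS_jacobi (A B C : S g) :
    commS g A (commS g B C) = commS g (commS g A B) C + commS g B (commS g A C) := by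
  refine Subtype.ext (Prod.ext ?_ ?_)
  · change A.1.1 * (B.1.1 * C.1.1 - C.1.1 * B.1.1) - (B.1.1 * C.1.1 - C.1.1 * B.1.1) * A.1.1 =
      ((A.1.1 * B.1.1 - B.1.1 * A.1.1) * C.1.1 - C.1.1 * (A.1.1 * B.1.1 - B.1.1 * A.1.1)) +
      (B.1.1 * (A.1.1 * C.1.1 - C.1.1 * A.1.1) - (A.1.1 * C.1.1 - C.1.1 * A.1.1) * B.1.1)
    noncomm_ring
  · change A.1.2 * (B.1.2 * C.1.2 - C.1.2 * B.1.2) - (B.1.2 * C.1.2 - C.1.2 * B.1.2) * A.1.2 =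
      ((A.1.2 * B.1.2 - B.1.2 * A.1.2) * C.1.2 - C.1.2 * (A.1.2 * B.1.2 - B.1.2 * A.1.2)) +
      (B.1.2 * (A.1.2 * C.1.2 - C.1.2 * A.1.2) - (A.1.2 * C.1.2 - C.1.2 * A.1.2) * B.1.2)
    noncomm_ring

/-- This is the Jacobi identity for degrees -1, 1, 1. The signs of the derivation terms are reversed
from `act_mul_of_mem` because the second component of `endoS` is `-endo`. -/
lemma contr_wedge (r : ⋀[K]^3 N) (p q : ⋀[K]^3 M) :
    contr g r (wedge K M p q) = pairL g 3 r p • q - pairL g 3 r q • p +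
      actM g 3 (endoL g r p) q - actM g 3 (endoL g r q) p := by
  refine Subtype.ext ((act_mul_of_mem g r r.2 p q p.2 q.2).trans ?_)
  change _ = pair g r p • (q : ExteriorAlgebra K M) - pair g r q • (p : ExteriorAlgebra K M) +
    der (-endo g p r) q - der (-endo g q r) p
  rw [der_neg, der_neg]
  abel

lemma contr_wedge_flip (p : ⋀[K]^3 M) (r s : ⋀[K]^3 N) :
    contr g.flip p (wedge K N r s) = pairL g 3 r p • s - pairL g 3 s p • r -
      actN g 3 (endoL g r p) s + actN g 3 (endoL g s p) r := by
  refine Subtype.ext ((act_mul_of_mem g.flip p p.2 r s r.2 s.2).trans ?_)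
  rw [← pair_comm, ← pair_comm]
  rfl

lemma pairL_contr (r s : ⋀[K]^3 N) (t : ⋀[K]^6 M) :
    pairL g 3 r (contr g s t) = pairL g 6 (wedge K N r s) t :=
  (pair_mul g r s (t : ExteriorAlgebra K M)).symm

lemma pairL_contr_flip (p q : ⋀[K]^3 M) (u : ⋀[K]^6 N) :
    pairL g 3 (contr g.flip p u) q = pairL g 6 u (wedge K M q p) := by
  refine (pair_comm g _ _).trans (Eq.trans ?_ (pair_comm g _ _).symm)
  exact (pair_mul g.flip q p (u : ExteriorAlgebra K N)).symm

section Top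

variable (hM6 : ∀ (m : M) (t : ⋀[K]^6 M), ι K m * (t : ExteriorAlgebra K M) = 0)
  (hN6 : ∀ (n : N) (u : ⋀[K]^6 N), ι K n * (u : ExteriorAlgebra K N) = 0)

include hM6

/-- This identity, `wedge_contr`, `contr_contr` and `endo_contr` all come from `(x · a) · t = x (a ·
t)` for `t` of top degree, with `x` of degree 6, 3, 3 and 1. Here it expresses that the top degree
behaves like a module of rank one. -/
lemma pairL_smul_comm (u : ⋀[K]^6 N) (t t' : ⋀[K]^6 M) :
    pairL g 6 u t • t' = pairL g 6 u t' • t := by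
  refine Subtype.ext ?_
  have := act_act_of_ι_mul_eq_zero g (t : ExteriorAlgebra K M) u t' fun m => hM6 m t'
  rw [← algebraMap_pair g.flip 6 _ t.2 _ u.2, ← algebraMap_pair g 6 _ u.2 _ t'.2, act_algebraMap,
    ← Algebra.commutes, ← Algebra.smul_def, ← pair_comm] at this
  exact this

lemma wedge_contr (p : ⋀[K]^3 M) (r : ⋀[K]^3 N) (t : ⋀[K]^6 M) :
    wedge K M p (contr g r t) = pairL g 3 r p • t := by
  refine Subtype.ext ?_
  have := act_act_of_ι_mul_eq_zero g (p : ExteriorAlgebra K M) r t fun m => hM6 m t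
  rw [← algebraMap_pair g.flip 3 _ p.2 _ r.2, act_algebraMap, ← pair_comm] at this
  exact this.symm

lemma actM_endoL (r : ⋀[K]^3 N) (p : ⋀[K]^3 M) (t : ⋀[K]^6 M) :
    actM g 6 (endoL g r p) t = -(3 * pairL g 3 r p) • t := by
  refine Subtype.ext (?_ : der (-endo g p r) (t : ExteriorAlgebra K M) = _)
  rw [der_neg, der_endo_of_ι_mul_eq_zero g r r.2 p t p.2 fun m => hM6 m t, ← neg_smul]
  rfl

lemma contr_contr (p : ⋀[K]^3 M) (u : ⋀[K]^6 N) (t : ⋀[K]^6 M) :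
    contr g (contr g.flip p u) t = pairL g 6 u t • p := by
  refine Subtype.ext ?_
  have := act_act_of_ι_mul_eq_zero g (p : ExteriorAlgebra K M) u t fun m => hM6 m t
  rw [← algebraMap_pair g 6 _ u.2 _ t.2, ← Algebra.commutes, ← Algebra.smul_def] at this
  exact this

/-- Contracting the product `r s` by a vector `m` gives `(m · r) s - (m · s) r`, since degrees 3 and
2 commute. Acting on `t` yields the difference on the left, while the top-degree rule gives a
multiple of `m`. -/
lemma endo_contr (r s : ⋀[K]^3 N) (t : ⋀[K]^6 M) :
    endo g (contr g s t) (r : ExteriorAlgebra K N) - endo g (contr g r t) (s : ExteriorAlgebra K N) =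
      pairL g 6 (wedge K N r s) t • 1 := by
  ext m
  have h := act_act_of_ι_mul_eq_zero g (ι K m) (wedge K N r s) t fun m => hM6 m t
  rw [← algebraMap_pair g 6 _ (wedge K N r s).2 _ t.2, ← Algebra.commutes, ← Algebra.smul_def,
    act_ι] at h
  change act g (con (g.flip m) ((r : ExteriorAlgebra K N) * s)) t = _ at h
  rw [con_mul, invo_mem 3 (r : ExteriorAlgebra K N) r.2, smul_mul_assoc,
    mul_comm_of_mem 3 2 (r : ExteriorAlgebra K N) _ r.2 (con_mem (g.flip m) 2 _ s.2)] at h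
  have h' : act g (con (g.flip m) r) (act g s t) - act g (con (g.flip m) s) (act g r t) =
      pairL g 6 (wedge K N r s) t • ι K m := by
    refine Eq.trans ?_ h
    simp only [map_add, map_mul, LinearMap.add_apply, Module.End.mul_apply, map_smul,
      LinearMap.smul_apply]
    module
  rw [LinearMap.sub_apply, endo_apply, endo_apply, ← map_sub]
  change ιInv (act g (con (g.flip m) r) (act g s t) - act g (con (g.flip m) s) (act g r t)) = _
  rw [h', map_smul, ExteriorAlgebra.ι_leftInverse]
  rfl

end Top

/-- For a form that is nondegenerate on this side, `A⁻` is determined as minus the adjoint of `A⁺`,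
so identities in `S` need checking on one component only. -/
lemma S_ext_snd (hl : ∀ v, (∀ w, g v w = 0) → v = 0) {A B : S g} (h : A.1.2 = B.1.2) : A = B := by
  refine Subtype.ext (Prod.ext (LinearMap.ext fun v => ?_) h)
  refine sub_eq_zero.mp (hl _ fun w => ?_)
  rw [map_sub, LinearMap.sub_apply, eq_neg_of_add_eq_zero_left (S_apply A v w),
    eq_neg_of_add_eq_zero_left (S_apply B v w), h, sub_self]

lemma S_ext_fst (hr : ∀ w, (∀ v, g v w = 0) → w = 0) {A B : S g} (h : A.1.1 = B.1.1) : A = B := by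
  refine Subtype.ext (Prod.ext h (LinearMap.ext fun w => ?_))
  refine sub_eq_zero.mp (hr _ fun v => ?_)
  rw [map_sub, eq_neg_of_add_eq_zero_right (S_apply A v w),
    eq_neg_of_add_eq_zero_right (S_apply B v w), h, sub_self]

end Jacobi

/-! ### The Jacobi identity from a list of bilinear identities. -/

section Abstract

/-- Bilinear products between the components of a 5-graded module `V₆ ⊕ V₃ ⊕ (T ⊕ K) ⊕ W₃ ⊕ W₆`,
with the identities which make it a Lie algebra. -/
structure FiveGrading (K V₆ V₃ T W₃ W₆ : Type*) [CommRing K] [AddCommGroup V₆] [Module K V₆]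
    [AddCommGroup V₃] [Module K V₃] [AddCommGroup T] [Module K T] [AddCommGroup W₃] [Module K W₃]
    [AddCommGroup W₆] [Module K W₆] where
  aV₆ : T →ₗ[K] V₆ →ₗ[K] V₆
  aV₃ : T →ₗ[K] V₃ →ₗ[K] V₃
  aW₃ : T →ₗ[K] W₃ →ₗ[K] W₃
  aW₆ : T →ₗ[K] W₆ →ₗ[K] W₆
  wV : V₃ →ₗ[K] V₃ →ₗ[K] V₆
  wW : W₃ →ₗ[K] W₃ →ₗ[K] W₆
  kV : W₃ →ₗ[K] V₆ →ₗ[K] V₃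
  kW : V₃ →ₗ[K] W₆ →ₗ[K] W₃
  br : T →ₗ[K] T →ₗ[K] T
  e : V₃ →ₗ[K] W₃ →ₗ[K] T
  p₃ : V₃ →ₗ[K] W₃ →ₗ[K] K
  p₆ : V₆ →ₗ[K] W₆ →ₗ[K] K
  h : T
  aV₆_br : ∀ A B x, aV₆ (br A B) x = aV₆ A (aV₆ B x) - aV₆ B (aV₆ A x)
  aV₃_br : ∀ A B x, aV₃ (br A B) x = aV₃ A (aV₃ B x) - aV₃ B (aV₃ A x)
  aW₃_br : ∀ A B x, aW₃ (br A B) x = aW₃ A (aW₃ B x) - aW₃ B (aW₃ A x)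
  aW₆_br : ∀ A B x, aW₆ (br A B) x = aW₆ A (aW₆ B x) - aW₆ B (aW₆ A x)
  aV₆_h : ∀ x, aV₆ h x = -(6 : K) • x
  aV₃_h : ∀ x, aV₃ h x = -(3 : K) • x
  aW₃_h : ∀ x, aW₃ h x = (3 : K) • x
  aW₆_h : ∀ x, aW₆ h x = (6 : K) • x
  aV₆_wV : ∀ A x y, aV₆ A (wV x y) = wV (aV₃ A x) y + wV x (aV₃ A y)
  aW₆_wW : ∀ A x y, aW₆ A (wW x y) = wW (aW₃ A x) y + wW x (aW₃ A y)
  wV_skew : ∀ x y, wV x y = -wV y x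
  wW_skew : ∀ x y, wW x y = -wW y x
  wV_self : ∀ x, wV x x = 0
  wW_self : ∀ x, wW x x = 0
  aV₃_kV : ∀ A p u, aV₃ A (kV p u) = kV (aW₃ A p) u + kV p (aV₆ A u)
  aW₃_kW : ∀ A r t, aW₃ A (kW r t) = kW (aV₃ A r) t + kW r (aW₆ A t)
  p₃_a : ∀ A x y, p₃ (aV₃ A x) y = -p₃ x (aW₃ A y)
  p₆_a : ∀ A x y, p₆ (aV₆ A x) y = -p₆ x (aW₆ A y)
  br_e : ∀ A r p, br A (e r p) = e (aV₃ A r) p + e r (aW₃ A p)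
  e_br : ∀ A r p, br (e r p) A = -e (aV₃ A r) p - e r (aW₃ A p)
  br_h : ∀ A, br A h = 0
  h_br : ∀ A, br h A = 0
  br_self : ∀ A, br A A = 0
  br_br : ∀ A B C, br A (br B C) = br (br A B) C + br B (br A C)
  kW_wW : ∀ r p q, kW r (wW p q) = p₃ r p • q - p₃ r q • p + aW₃ (e r p) q - aW₃ (e r q) p
  kV_wV : ∀ p r s, kV p (wV r s) = p₃ r p • s - p₃ s p • r - aV₃ (e r p) s + aV₃ (e s p) r
  p₃_kW : ∀ r s t, p₃ r (kW s t) = p₆ (wV r s) t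
  p₃_kV : ∀ p q u, p₃ (kV p u) q = p₆ u (wW q p)
  p₆_W : ∀ u t t', p₆ u t • t' = p₆ u t' • t
  p₆_V : ∀ u u' t, p₆ u t • u' = p₆ u' t • u
  wW_kW : ∀ p r t, wW p (kW r t) = p₃ r p • t
  wV_kV : ∀ r p u, wV r (kV p u) = p₃ r p • u
  aW₆_e : ∀ r p t, aW₆ (e r p) t = -(3 * p₃ r p) • t
  aV₆_e : ∀ r p u, aV₆ (e r p) u = (3 * p₃ r p) • u
  kW_kV : ∀ p u t, kW (kV p u) t = p₆ u t • p
  kV_kW : ∀ r u t, kV (kW r t) u = p₆ u t • r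
  e_kW : ∀ r s t, e s (kW r t) = e r (kW s t) + p₆ (wV r s) t • h
  e_kV : ∀ p q u, e (kV p u) q = e (kV q u) p + p₆ u (wW p q) • h

namespace FiveGrading

variable {K V₆ V₃ T W₃ W₆ : Type*} [CommRing K] [AddCommGroup V₆] [Module K V₆]
    [AddCommGroup V₃] [Module K V₃] [AddCommGroup T] [Module K T] [AddCommGroup W₃] [Module K W₃]
    [AddCommGroup W₆] [Module K W₆] (G : FiveGrading K V₆ V₃ T W₃ W₆)

/-- The product of `V₆ ⊕ V₃ ⊕ (T ⊕ K) ⊕ W₃ ⊕ W₆`. -/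
def bracket (x y : V₆ × V₃ × T × K × W₃ × W₆) : V₆ × V₃ × T × K × W₃ × W₆ :=
  match x, y with
  | (x₁, x₂, A, a, x₃, x₄), (y₁, y₂, B, b, y₃, y₄) =>
    (G.aV₆ A y₁ - G.aV₆ B x₁ - (2 * a) • y₁ + (2 * b) • x₁ + G.wV x₂ y₂,
     G.aV₃ A y₂ - G.aV₃ B x₂ - a • y₂ + b • x₂ + G.kV x₃ y₁ - G.kV y₃ x₁,
     G.br A B + G.e x₂ y₃ - G.e y₂ x₃ - (G.p₆ x₁ y₄ - G.p₆ y₁ x₄) • G.h,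
     G.p₃ x₂ y₃ - G.p₃ y₂ x₃ + 2 * (G.p₆ x₁ y₄ - G.p₆ y₁ x₄),
     G.aW₃ A y₃ - G.aW₃ B x₃ + a • y₃ - b • x₃ + G.kW x₂ y₄ - G.kW y₂ x₄,
     G.aW₆ A y₄ - G.aW₆ B x₄ + (2 * a) • y₄ - (2 * b) • x₄ + G.wW x₃ y₃)

lemma bracket_self (x : V₆ × V₃ × T × K × W₃ × W₆) : G.bracket x x = 0 := by
  obtain ⟨x₁, x₂, A, a, x₃, x₄⟩ := x
  simp [bracket, G.wV_self, G.wW_self, G.br_self]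

lemma wW_kW' (p r t) : G.wW (G.kW r t) p = -(G.p₃ r p • t) := by rw [G.wW_skew, G.wW_kW]

lemma wV_kV' (r p u) : G.wV (G.kV p u) r = -(G.p₃ r p • u) := by rw [G.wV_skew, G.wV_kV]

-- The identity is checked one component at a time. In degrees ±1 and in the coefficient of `h₀`,
-- the listed identities reduce both sides to the same normal form. In degrees ±2 one also needs
-- that two top-degree vectors can be interchanged in `p₆ u t • t'`; in `T` one needs the Jacobi
-- identity of `br` and the exchange rules `e_kW` and `e_kV`.
set_option maxHeartbeats 1000000 in
theorem jacobi (x y z : V₆ × V₃ × T × K × W₃ × W₆) :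
    G.bracket x (G.bracket y z) = G.bracket (G.bracket x y) z + G.bracket y (G.bracket x z) := by
  obtain ⟨x₁, x₂, A, a, x₃, x₄⟩ := x
  obtain ⟨y₁, y₂, B, b, y₃, y₄⟩ := y
  obtain ⟨z₁, z₂, C, c, z₃, z₄⟩ := z
  simp only [bracket, Prod.mk_add_mk, Prod.mk.injEq]
  simp only [map_add, map_sub, map_smul, LinearMap.add_apply, LinearMap.sub_apply,
    LinearMap.smul_apply]
  refine ⟨?_, ?_, ?_, ?_, ?_, ?_⟩
  · simp only [G.aV₆_br, G.aV₆_wV, G.aV₆_e, G.wV_kV, G.wV_kV', G.aV₆_h]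
    rw [G.wV_skew y₂ (G.aV₃ C x₂), G.wV_skew y₂ x₂]
    linear_combination (norm := module) (-2 : K) • G.p₆_V y₁ x₁ z₄ + (2 : K) • G.p₆_V z₁ x₁ y₄ +
      (2 : K) • G.p₆_V y₁ z₁ x₄
  · simp only [G.aV₃_br, G.kV_wV, G.aV₃_kV, G.kV_kW, G.aV₃_h]
    module
  · simp only [G.br_e, G.e_br, G.br_h, G.h_br, G.p₆_a, smul_eq_mul]
    -- There is one exchange rule for each position of the argument of degree ±2, the other two
    -- arguments having degree ∓1.
    linear_combination (norm := module) G.br_br A B C - G.e_kW x₂ y₂ z₄ + G.e_kW x₂ z₂ y₄ -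
      G.e_kW y₂ z₂ x₄ + G.e_kV x₃ y₃ z₁ - G.e_kV x₃ z₃ y₁ + G.e_kV y₃ z₃ x₁
  · simp only [G.p₃_a, G.p₃_kV, G.p₃_kW, G.p₆_a, smul_eq_mul, G.wW_skew y₃ x₃, G.wW_skew z₃ x₃,
      G.wW_skew z₃ y₃, G.wV_skew y₂ x₂, G.wV_skew z₂ x₂, G.wV_skew z₂ y₂, map_neg,
      LinearMap.neg_apply]
    ring
  · simp only [G.aW₃_br, G.kW_wW, G.aW₃_kW, G.kW_kV, G.aW₃_h]
    module
  · simp only [G.aW₆_br, G.aW₆_wW, G.aW₆_e, G.wW_kW, G.wW_kW', G.aW₆_h]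
    rw [G.wW_skew y₃ (G.aW₃ C x₃), G.wW_skew y₃ x₃]
    linear_combination (norm := module) (-2 : K) • G.p₆_W z₁ y₄ x₄ + (2 : K) • G.p₆_W y₁ z₄ x₄ +
      (2 : K) • G.p₆_W x₁ y₄ z₄

end FiveGrading
end Abstract

/-! ### The exterior algebra construction satisfies these identities. -/

section Jacobi

variable {K N M : Type*} [CommRing K] [AddCommGroup N] [Module K N] [AddCommGroup M] [Module K M]

open ExteriorAlgebra (algebraMapInv ιInv ι)

variable {g : N →ₗ[K] M →ₗ[K] K}

lemma pairL_flip (n : ℕ) (a : ⋀[K]^n N) (x : ⋀[K]^n M) : pairL g.flip n x a = pairL g n a x :=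
  (pair_comm g _ _).symm

lemma endoL_contr (hM6 : ∀ (m : M) (t : ⋀[K]^6 M), ι K m * (t : ExteriorAlgebra K M) = 0)
    (hl : ∀ v, (∀ w, g v w = 0) → v = 0) (r s : ⋀[K]^3 N) (t : ⋀[K]^6 M) :
    endoL g s (contr g r t) = endoL g r (contr g s t) + pairL g 6 (wedge K N r s) t • hM g := by
  refine S_ext_snd hl ?_
  change -endo g (contr g r t) s = -endo g (contr g s t) r + pairL g 6 (wedge K N r s) t • 1
  rw [← endo_contr hM6]
  abel

lemma endoL_contr_flip (hN6 : ∀ (n : N) (u : ⋀[K]^6 N), ι K n * (u : ExteriorAlgebra K N) = 0)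
    (hr : ∀ w, (∀ v, g v w = 0) → w = 0) (p q : ⋀[K]^3 M) (u : ⋀[K]^6 N) :
    endoL g (contr g.flip p u) q = endoL g (contr g.flip q u) p +
      pairL g 6 u (wedge K M p q) • hM g := by
  refine S_ext_fst hr ?_
  have h := endo_contr (g := g.flip) hN6 p q u
  change endo g.flip (contr g.flip p u) q = endo g.flip (contr g.flip q u) p +
    pairL g 6 u (wedge K M p q) • (-1)
  rw [← pairL_flip, smul_neg, ← h]
  abel

lemma actN_endoL (hN6 : ∀ (n : N) (u : ⋀[K]^6 N), ι K n * (u : ExteriorAlgebra K N) = 0)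
    (r : ⋀[K]^3 N) (p : ⋀[K]^3 M) (u : ⋀[K]^6 N) :
    actN g 6 (endoL g r p) u = (3 * pairL g 3 r p) • u := by
  rw [← pairL_flip]
  exact Subtype.ext (der_endo_of_ι_mul_eq_zero g.flip p p.2 r u r.2 fun n => hN6 n u)

/-- Odd elements anticommute, so twice the square vanishes. -/
lemma wedge_self [Invertible (2 : K)] (x : ⋀[K]^3 M) : wedge K M x x = 0 := by
  have h : (2 : K) • wedge K M x x = 0 := by
    rw [two_smul]
    exact eq_neg_iff_add_eq_zero.mp (wedge_skew x x)
  rw [← invOf_smul_smul (2 : K) (wedge K M x x), h, smul_zero]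

section Flip

variable (hN6 : ∀ (n : N) (u : ⋀[K]^6 N), ι K n * (u : ExteriorAlgebra K N) = 0)

include hN6

lemma pairL_smul_comm_flip (u u' : ⋀[K]^6 N) (t : ⋀[K]^6 M) :
    pairL g 6 u t • u' = pairL g 6 u' t • u := by
  have h := pairL_smul_comm (g := g.flip) hN6 t u u'
  rwa [pairL_flip, pairL_flip] at h

lemma wedge_contr_flip (r : ⋀[K]^3 N) (p : ⋀[K]^3 M) (u : ⋀[K]^6 N) :
    wedge K N r (contr g.flip p u) = pairL g 3 r p • u := by
  have h := wedge_contr (g := g.flip) hN6 r p u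
  rwa [pairL_flip] at h

lemma contr_contr_flip (r : ⋀[K]^3 N) (u : ⋀[K]^6 N) (t : ⋀[K]^6 M) :
    contr g.flip (contr g r t) u = pairL g 6 u t • r := by
  have h := contr_contr (g := g.flip) hN6 r t u
  rwa [pairL_flip] at h

end Flip

lemma commS_self (A : S g) : commS g A A = 0 :=
  Subtype.ext (Prod.ext (sub_self _) (sub_self _))

variable (g) in
/-- The products between the components of `Ẽ`. -/
def fiveGrading [Invertible (2 : K)]
    (hM6 : ∀ (m : M) (t : ⋀[K]^6 M), ι K m * (t : ExteriorAlgebra K M) = 0)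
    (hN6 : ∀ (n : N) (u : ⋀[K]^6 N), ι K n * (u : ExteriorAlgebra K N) = 0)
    (hl : ∀ v, (∀ w, g v w = 0) → v = 0) (hr : ∀ w, (∀ v, g v w = 0) → w = 0) :
    FiveGrading K (⋀[K]^6 N) (⋀[K]^3 N) (S g) (⋀[K]^3 M) (⋀[K]^6 M) where
  aV₆ := actN g 6
  aV₃ := actN g 3
  aW₃ := actM g 3
  aW₆ := actM g 6
  wV := wedge K N
  wW := wedge K M
  kV := contr g.flip
  kW := contr g
  br := commS g
  e := endoL g
  p₃ := pairL g 3
  p₆ := pairL g 6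
  h := hM g
  aV₆_br := actN_comm 6
  aV₃_br := actN_comm 3
  aW₃_br := actM_comm 3
  aW₆_br := actM_comm 6
  aV₆_h := actN_hM 6
  aV₃_h := actN_hM 3
  aW₃_h := actM_hM 3
  aW₆_h := actM_hM 6
  aV₆_wV := actN_wedge
  aW₆_wW := actM_wedge
  wV_skew := wedge_skew
  wW_skew := wedge_skew
  wV_self := wedge_self
  wW_self := wedge_self
  aV₃_kV := actN_contr
  aW₃_kW := actM_contr
  p₃_a := pairL_act 3
  p₆_a := pairL_act 6
  br_e := commS_endoL
  e_br := commS_endoL'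
  br_h := commS_hM
  h_br := hM_commS
  br_self := commS_self
  br_br := commS_jacobi
  kW_wW := contr_wedge
  kV_wV := contr_wedge_flip
  p₃_kW := pairL_contr
  p₃_kV := pairL_contr_flip
  p₆_W := pairL_smul_comm hM6
  p₆_V := pairL_smul_comm_flip hN6
  wW_kW := wedge_contr hM6
  wV_kV := wedge_contr_flip hN6
  aW₆_e := actM_endoL hM6
  aV₆_e := actN_endoL hN6
  kW_kV := contr_contr hM6
  kV_kW := contr_contr_flip hN6
  e_kW := endoL_contr hM6 hl
  e_kV := endoL_contr_flip hN6 hr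

/-- The product lies in `⋀^(n+1)`, whose dimension is a vanishing binomial coefficient. -/
lemma ι_mul_eq_zero_of_finrank_lt {K M : Type*} [Field K] [AddCommGroup M] [Module K M]
    [Module.Finite K M] (n : ℕ) (hn : Module.finrank K M < n + 1) (m : M) (t : ⋀[K]^n M) :
    ι K m * (t : ExteriorAlgebra K M) = 0 := by
  have h : ι K m * (t : ExteriorAlgebra K M) ∈ ⋀[K]^(n + 1) M := by
    rw [power_succ]
    exact Submodule.mul_mem_mul ⟨m, rfl⟩ t.2
  have h0 : Module.finrank K (⋀[K]^(n + 1) M) = 0 := by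
    rw [exteriorPower.finrank_eq, Nat.choose_eq_zero_of_lt hn]
  have := Module.finrank_zero_iff.mp h0
  exact congrArg Subtype.val (Subsingleton.elim (⟨_, h⟩ : ⋀[K]^(n + 1) M) 0)

end Jacobi

/-- The product of `E` for the dot product on `K⁶` makes `E` a Lie algebra. -/
theorem isLieProduct_dot (K : Type*) [Field K] [CharZero K] : IsLieProduct (product (dot K)) := by
  have h6 (m : Fin 6 → K) (t : ⋀[K]^6 (Fin 6 → K)) := ι_mul_eq_zero_of_finrank_lt 6 (by simp) m t
  let : Invertible (2 : K) := invertibleOfNonzero two_ne_zero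
  let G := fiveGrading (dot K) h6 h6 (fun v hv => dotProduct_eq_zero v hv)
    (fun w hw => dotProduct_eq_zero w fun v => by rw [dotProduct_comm]; exact hw v)
  have hinj := (Etilde.equivProd (dot K)).injective
  refine ⟨fun x => Subtype.ext (hinj ?_), fun x y z => Subtype.ext (hinj ?_)⟩
  -- Under `Etilde.equivProd` the bracket of `Etilde` is `G.bracket` by definition.
  · exact G.bracket_self (Etilde.equivProd _ x.1)
  · exact G.jacobi (Etilde.equivProd _ x.1) (Etilde.equivProd _ y.1) (Etilde.equivProd _ z.1)


/-! ### A criterion for simplicity in terms of a weight basis. -/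

section SimplyLaced

open Matrix Module Polynomial

/-- A basis `h i`, `x k` of a Lie algebra which consists of eigenvectors of the commuting elements
`h i`, such that the eigenvalues are given by a symmetrizable integer matrix `A` and by vectors
`Q k`, the coordinates of a root and also of its coroot with respect to simple roots `σ i`. -/
structure IsSimplyLacedBasis {ι κ K L : Type*} [Fintype ι] [DecidableEq ι] [Field K] [LieRing L]
    [LieAlgebra K L] (A : Matrix ι ι ℤ) (Q : κ → ι → ℤ) (neg : κ → κ) (σ : ι → κ) (h : ι → L)
    (x : κ → L) : Prop where
  linearIndependent : LinearIndependent K (Sum.elim h x)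
  span_eq_top : Submodule.span K (Set.range (Sum.elim h x)) = ⊤
  det_ne_zero : A.det ≠ 0
  lie_h_h : ∀ i j, ⁅h i, h j⁆ = 0
  lie_h_x : ∀ i k, ⁅h i, x k⁆ = ((Q k ᵥ* A) i : K) • x k
  lie_x_x : ∀ k, ⁅x k, x (neg k)⁆ = ∑ i, (Q k i : K) • h i
  Q_neg : ∀ k, Q (neg k) = -Q k
  Q_norm : ∀ k, (Q k ᵥ* A) ⬝ᵥ Q k = 2
  Q_injective : Function.Injective Q
  Q_simple : ∀ i, Q (σ i) = Pi.single i 1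
  Q_sign : ∀ k, 0 ≤ Q k ∨ 0 ≤ -Q k
  connected : ∀ k l, Relation.ReflTransGen (fun k l => (Q l ᵥ* A) ⬝ᵥ Q k ≠ 0) k l

namespace IsSimplyLacedBasis

variable {ι κ K L : Type*} [Fintype ι] [DecidableEq ι] [Field K]
  [LieRing L] [LieAlgebra K L] {A : Matrix ι ι ℤ} {Q : κ → ι → ℤ} {neg : κ → κ} {σ : ι → κ}
  {h : ι → L} {x : κ → L} (D : IsSimplyLacedBasis (K := K) A Q neg σ h x)

/-- The basis of `L` formed by the `h i` and `x k`. -/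
noncomputable def basis : Basis (ι ⊕ κ) K L :=
  Basis.mk D.linearIndependent D.span_eq_top.ge

@[simp] lemma basis_inl (i : ι) : D.basis (Sum.inl i) = h i := by simp [basis]

@[simp] lemma basis_inr (k : κ) : D.basis (Sum.inr k) = x k := by simp [basis]

include D

lemma x_ne_zero (k : κ) : x k ≠ 0 := by
  rw [← D.basis_inr]; exact D.basis.ne_zero _

lemma finiteDimensional [Finite κ] : FiniteDimensional K L := D.basis.finiteDimensional_of_finite

lemma vecMul_ne_zero (k : κ) : Q k ᵥ* A ≠ 0 := by
  intro h0
  have := D.Q_norm k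
  rw [h0, zero_dotProduct] at this
  norm_num at this

lemma vecMul_injective : Function.Injective fun k => Q k ᵥ* A := by
  intro k l hkl
  apply D.Q_injective
  rw [← sub_eq_zero]
  refine eq_zero_of_vecMul_eq_zero D.det_ne_zero ?_
  rw [sub_vecMul]
  exact sub_eq_zero.mpr hkl

lemma lie_sum_x (a : ι → K) (k : κ) :
    ⁅∑ i, a i • h i, x k⁆ = (∑ i, a i * ((Q k ᵥ* A) i : K)) • x k := by
  simp only [sum_lie, smul_lie, D.lie_h_x, Finset.sum_smul, smul_smul]

lemma lie_sum_h (a : ι → K) (j : ι) : ⁅∑ i, a i • h i, h j⁆ = 0 := by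
  simp only [sum_lie, smul_lie, D.lie_h_h, smul_zero, Finset.sum_const_zero]

/-- The values of the simple weights on the `h i` form the nonsingular matrix `A`, so no nonzero
combination of the `h i` commutes with all simple root vectors. -/
lemma exists_weight_ne_zero [CharZero K] (a : ι → K) (ha : a ≠ 0) :
    ∃ j, ∑ i, a i * ((Q (σ j) ᵥ* A) i : K) ≠ 0 := by
  by_contra! hcon
  refine ha (eq_zero_of_mulVec_eq_zero (M := A.map (Int.castRingHom K)) ?_ (funext fun j => ?_))
  · rw [← RingHom.mapMatrix_apply, ← RingHom.map_det]
    simpa using D.det_ne_zero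
  · have := hcon j
    simp only [D.Q_simple, single_one_vecMul] at this
    simpa [mulVec, dotProduct, mul_comm, Matrix.row] using this

variable [Fintype κ] [CharZero K]

/-- There is an element of the span of the `h i` which separates the `x k` from each other and from
the `h i`. -/
lemma exists_regular : ∃ (a : ι → K) (c : κ → K), Function.Injective c ∧ (∀ k, c k ≠ 0) ∧
    ∀ k, ⁅∑ i, a i • h i, x k⁆ = c k • x k := by
  -- The weights and their pairwise differences are finitely many nonzero vectors, so over an
  -- infinite field some linear form vanishes on none of them. Its values on the standard basis are
  -- the coefficients sought.
  let v : κ ⊕ {p : κ × κ // p.1 ≠ p.2} → ι → K := Sum.elim (fun k i => ((Q k ᵥ* A) i : K))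
    fun p i => ((Q p.1.1 ᵥ* A) i : K) - ((Q p.1.2 ᵥ* A) i : K)
  obtain ⟨f, hf⟩ := exists_dual_forall_apply_ne_zero (K := K) v (by
    rintro (k | ⟨p, hp⟩) h0
    · exact D.vecMul_ne_zero k (funext fun i => by simpa [v] using congrFun h0 i)
    · exact hp (D.vecMul_injective (funext fun i => by
        simpa [v, sub_eq_zero] using congrFun h0 i)))
  have key (w : ι → K) : ∑ i, f (Pi.single i 1) * w i = f w := by
    conv_rhs => rw [pi_eq_sum_univ' w]
    simp [mul_comm]
  refine ⟨fun i => f (Pi.single i 1), fun k => f fun i => ((Q k ᵥ* A) i : K), fun k l hkl => ?_,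
    fun k => hf (.inl k), fun k => ?_⟩
  · by_contra hne
    refine hf (.inr ⟨(k, l), hne⟩) ?_
    change f ((fun i => ((Q k ᵥ* A) i : K)) - fun i => ((Q l ᵥ* A) i : K)) = 0
    rw [map_sub, sub_eq_zero]
    exact hkl
  · rw [D.lie_sum_x, key]

/-- A subspace which is invariant under all `h i` contains the components of its elements. -/
lemma repr_smul_mem (I : Submodule K L) (hI : ∀ i, ∀ y ∈ I, ⁅h i, y⁆ ∈ I) {y : L} (hy : y ∈ I)
    (k : κ) : D.basis.repr y (Sum.inr k) • x k ∈ I := by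
  classical
  obtain ⟨a, c, hc, hc0, hx⟩ := D.exists_regular
  let T : End K L := LieAlgebra.ad K L (∑ i, a i • h i)
  have hT : ∀ z ∈ I, T z ∈ I := fun z hz => by
    simp only [T, LieAlgebra.ad_apply, sum_lie, smul_lie]
    exact Submodule.sum_mem _ fun i _ => Submodule.smul_mem _ _ (hI i z hz)
  have hpoly : ∀ p : K[X], ∀ z ∈ I, aeval T p z ∈ I := by
    intro p
    induction p using Polynomial.induction_on' with
    | add p q hp hq => intro z hz; rw [map_add]; exact I.add_mem (hp z hz) (hq z hz)
    | monomial n r =>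
      intro z hz
      rw [aeval_monomial, End.mul_apply, Module.algebraMap_end_apply]
      refine I.smul_mem _ ?_
      induction n generalizing z with
      | zero => exact hz
      | succ n ih => rw [pow_succ]; exact ih _ (hT z hz)
  let lam : ι ⊕ κ → K := Sum.elim 0 c
  have hlam (j : ι ⊕ κ) : T (D.basis j) = lam j • D.basis j := by
    rcases j with i | k
    · rw [D.basis_inl]
      exact (D.lie_sum_h a i).trans (zero_smul K _).symm
    · rw [D.basis_inr]
      exact hx k
  have hinj (j : ι ⊕ κ) (hj : j ≠ Sum.inr k) : lam j ≠ c k := by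
    rcases j with i | l
    · exact (hc0 k).symm
    · exact fun h => hj (congrArg Sum.inr (hc h))
  -- This polynomial vanishes at every eigenvalue of `T` except `c k`. As `c k` belongs to `x k`
  -- alone, `p(T)` is a nonzero multiple of the projection onto the line of `x k`.
  let p : K[X] := ∏ μ ∈ (Finset.univ.image lam).erase (c k), (X - C μ)
  have hp (j : ι ⊕ κ) (hj : j ≠ Sum.inr k) : p.eval (lam j) = 0 := by
    rw [eval_prod]
    refine Finset.prod_eq_zero (i := lam j) ?_ (by simp)
    simp [hinj j hj]
  have hpk : p.eval (c k) ≠ 0 := by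
    rw [eval_prod]
    refine Finset.prod_ne_zero_iff.mpr fun μ hμ => ?_
    simpa [sub_eq_zero] using (Finset.ne_of_mem_erase hμ).symm
  have hmem := hpoly p y hy
  have : aeval T p y = p.eval (c k) • (D.basis.repr y (Sum.inr k) • x k) := by
    conv_lhs => rw [← D.basis.sum_repr y]
    rw [map_sum, Finset.sum_eq_single (Sum.inr k)]
    · rw [map_smul, End.aeval_apply_of_mem_apply_eq_smul (hlam _), smul_comm, D.basis_inr]
      rfl
    · intro j _ hj
      rw [map_smul, End.aeval_apply_of_mem_apply_eq_smul (hlam _), hp j hj, zero_smul, smul_zero]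
    · simp
  rw [this] at hmem
  exact (I.smul_mem_iff hpk).mp hmem

/-- A nonzero ideal contains some `x k`: either an element has a nonzero coordinate there, which can
be projected out, or it lies in the span of the `h i` and acts on a simple root vector by a nonzero
scalar. The ideal then contains `[x k, x (neg k)]`, hence every `x l` not orthogonal to `x k`.
Connectedness gives all root vectors, and their brackets give the `h i`. -/
lemma isSimple [Nonempty ι] : LieAlgebra.IsSimple K L where
  non_abelian hab := by
    let i := Classical.arbitrary ι
    -- The bracket `[x (σ i), x (neg (σ i))]` acts on `x (σ i)` by the norm 2, so the algebra is not
    -- abelian.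
    have h1 := D.lie_sum_x (fun j => (Q (σ i) j : K)) (σ i)
    have h2 : ∑ j, (Q (σ i) j : K) * ((Q (σ i) ᵥ* A) j : K) = 2 := by
      have := D.Q_norm (σ i)
      rw [dotProduct_comm] at this
      exact_mod_cast this
    rw [trivial_lie_zero, h2, eq_comm, smul_eq_zero] at h1
    exact h1.elim two_ne_zero (D.x_ne_zero _)
  eq_bot_or_eq_top I := by
    by_cases hI : I = ⊥
    · exact Or.inl hI
    right
    have hIh : ∀ i, ∀ y ∈ I.toSubmodule, ⁅h i, y⁆ ∈ I.toSubmodule := fun i y hy => I.lie_mem hy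
    have hx1 : ∃ k, x k ∈ I := by
      obtain ⟨y, hy, hy0⟩ := I.toSubmodule.ne_bot_iff.mp (by simpa using hI)
      by_cases hk : ∃ k, D.basis.repr y (Sum.inr k) ≠ 0
      · obtain ⟨k, hk⟩ := hk
        exact ⟨k, (I.toSubmodule.smul_mem_iff hk).mp (D.repr_smul_mem I.toSubmodule hIh hy k)⟩
      · push Not at hk
        have hy' : y = ∑ i, D.basis.repr y (Sum.inl i) • h i := by
          conv_lhs => rw [← D.basis.sum_repr y]
          rw [Fintype.sum_sum_type]
          simp only [hk, zero_smul, Finset.sum_const_zero, add_zero, basis_inl]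
        obtain ⟨j, hj⟩ := D.exists_weight_ne_zero (fun i => D.basis.repr y (Sum.inl i)) (by
          intro h0
          rw [hy'] at hy0
          exact hy0 (Finset.sum_eq_zero fun i _ => by rw [congrFun h0 i]; exact zero_smul _ _))
        refine ⟨σ j, (I.toSubmodule.smul_mem_iff hj).mp ?_⟩
        rw [← D.lie_sum_x, ← hy']
        exact lie_mem_left K L I y _ hy
    have hh (k : κ) (hk : x k ∈ I) : ∑ i, (Q k i : K) • h i ∈ I := by
      rw [← D.lie_x_x]
      exact lie_mem_left K L I _ _ hk
    have hstep (k l : κ) (hkl : (Q l ᵥ* A) ⬝ᵥ Q k ≠ 0) (hk : x k ∈ I) : x l ∈ I := by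
      have hne : ∑ i, (Q k i : K) * ((Q l ᵥ* A) i : K) ≠ 0 := by
        rw [dotProduct_comm] at hkl
        exact_mod_cast hkl
      refine (I.toSubmodule.smul_mem_iff hne).mp ?_
      rw [← D.lie_sum_x]
      exact lie_mem_left K L I _ _ (hh k hk)
    obtain ⟨k, hk⟩ := hx1
    have hall (l : κ) : x l ∈ I := by
      induction D.connected k l with
      | refl => exact hk
      | tail _ hbc ih => exact hstep _ _ hbc ih
    rw [← LieSubmodule.toSubmodule_eq_top, eq_top_iff, ← D.span_eq_top, Submodule.span_le]
    rintro _ ⟨i | k, rfl⟩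
    · have := hh (σ i) (hall _)
      rw [D.Q_simple, Finset.sum_eq_single i (fun j _ hj => by simp [hj]) (by simp)] at this
      simpa using this
    · exact hall k

end IsSimplyLacedBasis
end SimplyLaced

/-! ### Cartan subalgebra, roots, base and Chevalley basis. -/

section SimplyLaced

open Matrix Module LieAlgebra LieAlgebra.IsKilling LieModule

namespace IsSimplyLacedBasis

variable {ι κ K L : Type*} [Fintype ι] [DecidableEq ι] [Field K]
  [LieRing L] [LieAlgebra K L] {A : Matrix ι ι ℤ} {Q : κ → ι → ℤ} {neg : κ → κ} {σ : ι → κ}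
  {h : ι → L} {x : κ → L} (D : IsSimplyLacedBasis (K := K) A Q neg σ h x)

/-- The span of the `h i`. -/
def cartan : LieSubalgebra K L where
  __ := Submodule.span K (Set.range h)
  lie_mem' {y z} hy hz := by
    suffices ⁅y, z⁆ = 0 by rw [this]; exact Submodule.zero_mem _
    refine Submodule.span_induction₂ (p := fun y z _ _ => ⁅y, z⁆ = 0) ?_ ?_ ?_ ?_ ?_ ?_ ?_ hy hz
    · rintro _ _ ⟨i, rfl⟩ ⟨j, rfl⟩
      exact D.lie_h_h i j
    · simp
    · simp
    · intro a b c _ _ _ h1 h2; rw [add_lie, h1, h2, add_zero]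
    · intro a b c _ _ _ h1 h2; rw [lie_add, h1, h2, add_zero]
    · intro r a b _ _ h1; rw [smul_lie, h1, smul_zero]
    · intro r a b _ _ h1; rw [lie_smul, h1, smul_zero]

lemma h_mem (i : ι) : h i ∈ D.cartan := Submodule.subset_span ⟨i, rfl⟩

lemma sum_mem (a : ι → K) : ∑ i, a i • h i ∈ D.cartan :=
  Submodule.sum_mem _ fun i _ => Submodule.smul_mem _ _ (D.h_mem i)

lemma exists_of_mem {y : L} (hy : y ∈ D.cartan) : ∃ a : ι → K, ∑ i, a i • h i = y :=
  (Submodule.mem_span_range_iff_exists_fun K).mp hy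

lemma repr_sum (a : ι → K) (i : ι) : D.basis.repr (∑ i, a i • h i) (Sum.inl i) = a i := by
  simp only [← D.basis_inl, map_sum, map_smul, Basis.repr_self, Finsupp.coe_finsetSum,
    Finset.sum_apply, Finsupp.smul_apply]
  rw [Finset.sum_eq_single i (fun j _ hj => by simp [hj]) (by simp)]
  simp

instance isMulCommutative_cartan : IsLieAbelian D.cartan where
  trivial := by
    rintro ⟨y, hy⟩ ⟨z, hz⟩
    obtain ⟨a, rfl⟩ := D.exists_of_mem hy
    obtain ⟨b, rfl⟩ := D.exists_of_mem hz
    refine Subtype.ext ?_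
    change ⁅∑ i, a i • h i, ∑ i, b i • h i⁆ = 0
    simp only [lie_sum, lie_smul, D.lie_sum_h, smul_zero, Finset.sum_const_zero]

/-- The root with root vector `x k`, as a linear form. -/
noncomputable def weight (k : κ) : Dual K D.cartan :=
  (∑ i, ((Q k ᵥ* A) i : K) • D.basis.coord (Sum.inl i)) ∘ₗ D.cartan.toSubmodule.subtype

lemma weight_sum (k : κ) (a : ι → K) :
    D.weight k ⟨∑ i, a i • h i, D.sum_mem a⟩ = ∑ i, a i * ((Q k ᵥ* A) i : K) := by
  simp only [weight, LinearMap.comp_apply, LinearMap.sum_apply, LinearMap.smul_apply,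
    Basis.coord_apply]
  refine Finset.sum_congr rfl fun i _ => ?_
  rw [smul_eq_mul, mul_comm]
  exact congrArg (· * _) (D.repr_sum a i)

lemma weight_h (k : κ) (i : ι) : D.weight k ⟨h i, D.h_mem i⟩ = ((Q k ᵥ* A) i : K) := by
  have := D.weight_sum k (Pi.single i 1)
  simpa [Pi.single_apply] using this

lemma lie_x (y : D.cartan) (k : κ) : ⁅y, x k⁆ = D.weight k y • x k := by
  obtain ⟨y, hy⟩ := y
  obtain ⟨a, rfl⟩ := D.exists_of_mem hy
  rw [D.weight_sum]
  exact D.lie_sum_x a k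

lemma weight_ext {α β : Dual K D.cartan} (hαβ : ∀ i, α ⟨h i, D.h_mem i⟩ = β ⟨h i, D.h_mem i⟩) :
    α = β := by
  ext ⟨y, hy⟩
  obtain ⟨a, rfl⟩ := D.exists_of_mem hy
  have : (⟨∑ i, a i • h i, hy⟩ : D.cartan) = ∑ i, a i • (⟨h i, D.h_mem i⟩ : D.cartan) :=
    Subtype.ext (by simp)
  rw [this]
  simp only [map_sum, map_smul, hαβ]

lemma weight_neg (k : κ) : D.weight (neg k) = -D.weight k :=
  D.weight_ext fun i => by
    rw [LinearMap.neg_apply, D.weight_h, D.weight_h, D.Q_neg, neg_vecMul]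
    simp

lemma weight_eq_sum (k : κ) : D.weight k = ∑ i, (Q k i) • D.weight (σ i) :=
  D.weight_ext fun j => by
    rw [D.weight_h, LinearMap.sum_apply]
    simp only [LinearMap.smul_apply, D.weight_h, D.Q_simple, single_one_vecMul]
    simp [vecMul, dotProduct]

lemma x_mem_rootSpace (k : κ) : x k ∈ rootSpace D.cartan (D.weight k) :=
  (mem_genWeightSpace _ _ _).mpr fun y => ⟨1, by simp [D.lie_x]⟩

variable [CharZero K]

lemma weight_injective : Function.Injective D.weight := by
  intro k l hkl
  refine D.vecMul_injective (funext fun i => ?_)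
  have := D.weight_h k i
  rw [hkl, D.weight_h] at this
  exact_mod_cast this.symm

lemma weight_ne_zero (k : κ) : D.weight k ≠ 0 := by
  intro h0
  refine D.vecMul_ne_zero k (funext fun i => ?_)
  have := (D.weight_h k i).symm
  rw [h0, LinearMap.zero_apply] at this
  exact Int.cast_eq_zero.mp this

lemma linearIndependent_weight : LinearIndependent K fun i => D.weight (σ i) := by
  rw [Fintype.linearIndependent_iff]
  intro a ha
  have h0 : a ᵥ* A.map (Int.castRingHom K) = 0 := funext fun j => by
    have := LinearMap.congr_fun ha ⟨h j, D.h_mem j⟩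
    rw [LinearMap.sum_apply] at this
    simp only [LinearMap.smul_apply, D.weight_h, D.Q_simple, single_one_vecMul] at this
    exact this
  refine congrFun (eq_zero_of_vecMul_eq_zero ?_ h0)
  rw [← RingHom.mapMatrix_apply, ← RingHom.map_det]
  simpa using D.det_ne_zero

/-- If `y` normalizes the span of the `h i`, its bracket with a regular element has no component
along any `x k`. That component is `c k` times the coordinate of `y`, and `c k ≠ 0`. -/
lemma isCartanSubalgebra [Fintype κ] : D.cartan.IsCartanSubalgebra where
  nilpotent := inferInstance
  self_normalizing := by
    refine le_antisymm (fun y hy => ?_) D.cartan.le_normalizer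
    obtain ⟨a, c, hc, hc0, hx⟩ := D.exists_regular
    rw [LieSubalgebra.mem_normalizer_iff'] at hy
    have hy' := hy _ (D.sum_mem a)
    obtain ⟨b, hb⟩ := D.exists_of_mem hy'
    have hr (k : κ) : D.basis.repr y (Sum.inr k) = 0 := by
      have h1 : ⁅∑ i, a i • h i, y⁆ = ∑ k, (D.basis.repr y (Sum.inr k) * c k) • x k := by
        conv_lhs => rw [← D.basis.sum_repr y, Fintype.sum_sum_type]
        simp only [basis_inl, basis_inr, lie_add, lie_sum, lie_smul, D.lie_sum_h, hx, smul_zero,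
          Finset.sum_const_zero, zero_add, smul_smul]
      rw [← hb] at h1
      have h2 := Fintype.linearIndependent_iff.mp D.basis.linearIndependent
        (Sum.elim b fun k => -(D.basis.repr y (Sum.inr k) * c k)) (by
          simp [Fintype.sum_sum_type, h1]) (Sum.inr k)
      simpa [hc0 k] using h2
    rw [← D.basis.sum_repr y, Fintype.sum_sum_type]
    simp only [hr, zero_smul, Finset.sum_const_zero, add_zero, basis_inl]
    exact D.sum_mem _

section Roots

variable [FiniteDimensional K L] [IsKilling K L] [D.cartan.IsCartanSubalgebra]
  [IsTriangularizable K D.cartan L]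

/-- The root with root vector `x k`. -/
noncomputable def root (k : κ) : D.cartan.root :=
  ⟨⟨D.weight k, fun h0 => D.x_ne_zero k
    ((LieSubmodule.mem_bot _).mp (h0.le (D.x_mem_rootSpace k)))⟩, by
    simpa [Weight.IsNonZero, Weight.IsZero] using D.weight_ne_zero k⟩

lemma root_root (k : κ) : (rootSystem D.cartan).root (D.root k) = D.weight k := rfl

/-- The coroot is the only element of `[L_α, L_{-α}]` on which `α` takes the value 2. The bracket
`[x k, x (neg k)]` qualifies, the value 2 being `Q_norm`. -/
lemma coroot_root (k : κ) :
    ((rootSystem D.cartan).coroot (D.root k) : L) = ∑ i, (Q k i : K) • h i := by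
  have hx2 : x (neg k) ∈ rootSpace D.cartan (-D.weight k) := by
    have := D.x_mem_rootSpace (neg k)
    rwa [D.weight_neg] at this
  have hmem : (⟨∑ i, (Q k i : K) • h i, D.sum_mem _⟩ : D.cartan) ∈ corootSpace (D.root k).1 := by
    refine (mem_corootSpace _).mpr (Submodule.subset_span ?_)
    exact ⟨x k, D.x_mem_rootSpace k, x (neg k), hx2, D.lie_x_x k⟩
  have h2 : (D.root k).1 ⟨∑ i, (Q k i : K) • h i, D.sum_mem _⟩ = 2 := by
    have := D.Q_norm k
    rw [dotProduct_comm] at this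
    refine (D.weight_sum k _).trans ?_
    exact_mod_cast this
  exact (congrArg Subtype.val (eq_coroot_of_mem_corootSpace_of_two _ hmem h2)).symm

variable [Fintype κ]

/-- For surjectivity, a vector in the root space of `α` has a nonzero coordinate at some basis
vector. Comparing eigenvalues at that coordinate shows that `α` is the weight of that basis vector,
which cannot be an `h i` because `α` is nonzero. -/
lemma root_bijective : Function.Bijective D.root := by
  refine ⟨fun k l hkl => D.weight_injective ?_, fun α => ?_⟩
  · rw [← D.root_root, hkl, D.root_root]
  · obtain ⟨y, hy, hy0⟩ := (LieSubmodule.toSubmodule _).ne_bot_iff.mp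
      (by simpa using α.1.genWeightSpace_ne_bot)
    have hlie (z : D.cartan) : ⁅z, y⁆ = α.1 z • y := lie_eq_smul_of_mem_rootSpace hy z
    obtain ⟨j, hj⟩ : ∃ j, D.basis.repr y j ≠ 0 := by
      by_contra! hcon
      exact hy0 (D.basis.repr.injective (by ext j; simp [hcon]))
    let f : ι ⊕ κ → Dual K D.cartan := Sum.elim 0 D.weight
    have hf (z : D.cartan) : f j z = α.1 z := by
      have hb (j' : ι ⊕ κ) : ⁅z, D.basis j'⁆ = f j' z • D.basis j' := by
        rcases j' with i | k
        · obtain ⟨z, hz⟩ := z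
          obtain ⟨a, rfl⟩ := D.exists_of_mem hz
          rw [D.basis_inl]
          exact (D.lie_sum_h a i).trans (zero_smul K _).symm
        · rw [D.basis_inr]
          exact D.lie_x z k
      have h1 : ⁅z, y⁆ = ∑ j', (D.basis.repr y j' * f j' z) • D.basis j' := by
        conv_lhs => rw [← D.basis.sum_repr y]
        simp only [lie_sum, lie_smul, hb, smul_smul]
      have h2 := D.basis.repr_sum_self (fun j' => D.basis.repr y j' * f j' z)
      rw [← h1, hlie] at h2
      have h3 := congrFun h2 j
      rw [map_smul, Finsupp.smul_apply, smul_eq_mul, mul_comm] at h3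
      exact (mul_left_cancel₀ hj h3).symm
    rcases j with i | k
    · have hα : α.1.IsNonZero := (Finset.mem_filter.mp α.2).2
      exact absurd (funext fun z => (hf z).symm) hα
    · exact ⟨k, Subtype.ext (Weight.ext fun z => hf z)⟩

lemma root_σ_injective : Function.Injective fun i => D.root (σ i) := fun i j hij => by
  have := D.Q_simple i
  rw [D.root_bijective.1 hij, D.Q_simple] at this
  by_contra hne
  simpa [Pi.single_apply, hne] using congrFun this i

/-- The base of the root system formed by the roots with root vectors `x (σ i)`. -/
noncomputable def base : (rootSystem D.cartan).Base :=
  RootPairing.Base.mk' (rootSystem D.cartan) (Set.range fun i => D.root (σ i))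
    (by
      rw [LinearIndepOn, ← linearIndependent_equiv (Equiv.ofInjective _ D.root_σ_injective)]
      exact D.linearIndependent_weight)
    (fun α => by
      obtain ⟨k, rfl⟩ := D.root_bijective.2 α
      have key (q : ι → ℤ) (hq : 0 ≤ q) : ∑ i, q i • D.weight (σ i) ∈
          AddSubmonoid.closure ((rootSystem D.cartan).root '' Set.range fun i => D.root (σ i)) := by
        refine AddSubmonoid.sum_mem _ fun i _ => ?_
        lift q i to ℕ using hq i with n
        rw [natCast_zsmul]
        refine AddSubmonoid.nsmul_mem _ (AddSubmonoid.subset_closure ?_) n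
        exact ⟨D.root (σ i), ⟨i, rfl⟩, rfl⟩
      rw [D.root_root, D.weight_eq_sum k]
      refine (D.Q_sign k).imp (key _) fun hk => ?_
      rw [← Finset.sum_neg_distrib]
      simpa only [Pi.neg_apply, neg_smul] using key _ hk)

/-- The roots in `base`, indexed by `ι`. -/
noncomputable def supportEquiv : ι ≃ D.base.support :=
  (Equiv.ofInjective _ D.root_σ_injective).trans (Set.Finite.subtypeEquivToFinset _)

lemma coe_supportEquiv (i : ι) : (D.supportEquiv i : D.cartan.root) = D.root (σ i) := rfl

lemma cartanMatrix_base (i j : ι) :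
    D.base.cartanMatrix (D.supportEquiv i) (D.supportEquiv j) = A i j := by
  apply Int.cast_injective (α := K)
  have h1 := D.base.algebraMap_cartanMatrixIn_apply ℤ (D.supportEquiv i) (D.supportEquiv j)
  refine h1.trans ?_
  rw [← RootPairing.root_coroot_eq_pairing, coe_supportEquiv, coe_supportEquiv, D.root_root]
  have h2 : (rootSystem D.cartan).coroot (D.root (σ j)) = ⟨h j, D.h_mem j⟩ := Subtype.ext (by
    rw [D.coroot_root, D.Q_simple, Finset.sum_eq_single j (fun j' _ hj => by simp [hj]) (by simp)]
    simp)
  rw [h2]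
  refine (D.weight_h _ _).trans ?_
  rw [D.Q_simple, single_one_vecMul]
  rfl

end Roots

section Conclusions

include D

variable [Fintype κ] [IsAlgClosed K] [Nonempty ι]

theorem isSimpleOfType {n : Type*} (A' : Matrix n n ℤ) (e : n ≃ ι)
    (he : ∀ i j, A (e i) (e j) = A' i j) : IsSimpleOfType K A' L := by
  have := D.finiteDimensional
  have := D.isSimple
  have := D.isCartanSubalgebra
  refine ⟨‹_›, ‹_›, D.cartan, ‹_›, D.base, e.trans D.supportEquiv, fun i j => ?_⟩
  rw [← he]
  exact D.cartanMatrix_base _ _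

/-- If there is an involution with `x k ↦ -x (neg k)`, then a simply laced basis is a Chevalley
basis. -/
theorem isChevalleyBasis (θ : L →ₗ[K] L) (hθ : ∀ y z, θ ⁅y, z⁆ = ⁅θ y, θ z⁆)
    (hx : ∀ k, θ (x k) = -x (neg k)) : IsChevalleyBasis K h x := by
  have := D.finiteDimensional
  have := D.isSimple
  have := D.isCartanSubalgebra
  have hneg (k k' : κ) (hk : (rootSystem D.cartan).root (D.root k') =
      -(rootSystem D.cartan).root (D.root k)) : k' = neg k :=
    D.weight_injective (hk.trans (D.weight_neg k).symm)
  refine ⟨D.linearIndependent, D.span_eq_top, ‹_›, inferInstance, D.cartan, ‹_›, D.base,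
    D.supportEquiv, Equiv.ofBijective D.root D.root_bijective, fun i => ?_, D.x_mem_rootSpace,
    fun k k' hk => ?_, fun k l m k' l' m' _ hk hl hm c hc => ?_⟩
  · rw [D.coe_supportEquiv, D.coroot_root, D.Q_simple,
      Finset.sum_eq_single i (fun j _ hj => by simp [hj]) (by simp)]
    simp
  · rw [hneg k k' hk, D.lie_x_x]
    exact (D.coroot_root k).symm
  · rw [hneg k k' hk, hneg l l' hl, hneg m m' hm]
    -- Both factors of the bracket change sign under `θ`, so the left side gets no sign and the
    -- right side gets one.
    have := congrArg θ hc
    rw [hθ, map_smul, hx, hx, hx, neg_lie, lie_neg, neg_neg] at this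
    rw [this, smul_neg, neg_smul]

end Conclusions

end IsSimplyLacedBasis
end SimplyLaced

/-! ### The combinatorial root system of type `E₆`. -/

section Roots

open Matrix

namespace Label

/-- The labels as a sum of simpler types. -/
def equivSum : Label ≃ {p : Fin 6 × Fin 6 // p.1 ≠ p.2} ⊕ {s : Finset (Fin 6) // s.card = 3} ⊕
    {s : Finset (Fin 6) // s.card = 3} ⊕ Bool where
  toFun
    | .unit i j h => .inl ⟨(i, j), h⟩
    | .plus s hs => .inr (.inl ⟨s, hs⟩)
    | .minus s hs => .inr (.inr (.inl ⟨s, hs⟩))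
    | .topPlus => .inr (.inr (.inr true))
    | .topMinus => .inr (.inr (.inr false))
  invFun
    | .inl p => .unit p.1.1 p.1.2 p.2
    | .inr (.inl s) => .plus s.1 s.2
    | .inr (.inr (.inl s)) => .minus s.1 s.2
    | .inr (.inr (.inr true)) => .topPlus
    | .inr (.inr (.inr false)) => .topMinus
  left_inv k := by cases k <;> rfl
  right_inv k := by
    rcases k with p | s | s | b
    · rfl
    · rfl
    · rfl
    · cases b <;> rfl

instance : Fintype Label := Fintype.ofEquiv _ equivSum.symm

lemma card_eq : Fintype.card Label = 72 := by
  rw [Fintype.card_congr equivSum, Fintype.card_sum, Fintype.card_sum, Fintype.card_sum]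
  have h1 : Fintype.card {p : Fin 6 × Fin 6 // p.1 ≠ p.2} = 30 := by decide
  have h2 : Fintype.card {s : Finset (Fin 6) // s.card = 3} = 20 := by
    rw [Fintype.card_finset_len]; rfl
  rw [h1, h2, Fintype.card_bool]

/-- The label of the root vector for the negative root. -/
def neg : Label → Label
  | .unit i j h => .unit j i h.symm
  | .plus s hs => .minus s hs
  | .minus s hs => .plus s hs
  | .topPlus => .topMinus
  | .topMinus => .topPlus

/-- The restriction to diagonal matrices of the root with the given label. -/
def diag : Label → Fin 6 → ℤ
  | .unit i j _ => Pi.single i 1 - Pi.single j 1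
  | .plus s _ => fun i => if i ∈ s then 1 else 0
  | .minus s _ => fun i => -if i ∈ s then 1 else 0
  | .topPlus => 1
  | .topMinus => -1

/-- The degree of the root vector with the given label. -/
def deg : Label → ℤ
  | .unit _ _ _ => 0
  | .plus _ _ => 1
  | .minus _ _ => -1
  | .topPlus => 2
  | .topMinus => -2

lemma diag_neg (k : Label) : k.neg.diag = -k.diag := by
  cases k <;> ext i <;> simp [neg, diag]

lemma deg_neg (k : Label) : k.neg.deg = -k.deg := by
  cases k <;> rfl

lemma sum_diag (k : Label) : ∑ i, k.diag i = 3 * k.deg := by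
  cases k with
  | unit i j h => simp [diag, deg]
  | plus s hs => simp [diag, deg, hs]
  | minus s hs => simp [diag, deg, hs]
  | topPlus => simp [diag, deg]
  | topMinus => simp [diag, deg]

/-- The coordinates of a root with respect to the simple roots. -/
def coords (k : Label) : Fin 6 → ℤ :=
  -- Only the last simple root has nonzero degree, so its coefficient is `deg`. The others come from
  -- partial sums of `diag`; the last simple root, supported on the indices 3, 4, 5, enters the
  -- fourth sum once, whence `- k.deg`. The coefficient of `unit 4 5` is read off at index 5.
  ![k.diag 0, k.diag 0 + k.diag 1, k.diag 0 + k.diag 1 + k.diag 2,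
    k.diag 0 + k.diag 1 + k.diag 2 + k.diag 3 - k.deg, k.deg - k.diag 5, k.deg]

lemma coords_neg (k : Label) : k.neg.coords = -k.coords := by
  ext i
  fin_cases i <;> simp [coords, diag_neg, deg_neg] <;> ring

/-- The labels of the simple roots. -/
def simple : Fin 6 → Label :=
  ![.unit 0 1 (by decide), .unit 1 2 (by decide), .unit 2 3 (by decide), .unit 3 4 (by decide),
    .unit 4 5 (by decide), .plus {3, 4, 5} (by decide)]

lemma coords_simple (i : Fin 6) : (simple i).coords = Pi.single i 1 := by
  revert i; decide

/-- The Cartan matrix of type `E₆`, for the order of the simple roots given by `simple`. -/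
def cartan : Matrix (Fin 6) (Fin 6) ℤ :=
  !![ 2, -1,  0,  0,  0,  0;
     -1,  2, -1,  0,  0,  0;
      0, -1,  2, -1,  0, -1;
      0,  0, -1,  2, -1,  0;
      0,  0,  0, -1,  2,  0;
      0,  0, -1,  0,  0,  2]

/-- The order of the simple roots for which `cartan` is the Cartan matrix of Bourbaki. -/
def order : Fin 6 ≃ Fin 6 where
  toFun := ![0, 5, 1, 2, 3, 4]
  invFun := ![0, 2, 3, 4, 5, 1]
  left_inv := by decide
  right_inv := by decide

lemma cartan_order (i j : Fin 6) : cartan (order i) (order j) = CartanMatrix.E₆ i j := by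
  fin_cases i <;> fin_cases j <;> simp [cartan, order, CartanMatrix.E₆]

lemma det_cartan_ne_zero : cartan.det ≠ 0 := by
  intro h0
  obtain ⟨v, hv, hv0⟩ := exists_mulVec_eq_zero_iff.mpr h0
  refine hv (funext fun i => ?_)
  have h (i : Fin 6) := congrFun hv0 i
  simp only [cartan, mulVec, dotProduct, Fin.sum_univ_six, Pi.zero_apply] at h
  have e0 := h 0; have e1 := h 1; have e2 := h 2; have e3 := h 3; have e4 := h 4; have e5 := h 5
  simp at e0 e1 e2 e3 e4 e5
  fin_cases i <;> simp <;> omega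

lemma coords_vecMul_cartan (k : Label) : k.coords ᵥ* cartan =
    ![k.diag 0 - k.diag 1, k.diag 1 - k.diag 2, k.diag 2 - k.diag 3, k.diag 3 - k.diag 4,
      k.diag 4 - k.diag 5, k.diag 3 + k.diag 4 + k.diag 5 - k.deg] := by
  have hs := k.sum_diag
  rw [Fin.sum_univ_six] at hs
  ext i
  fin_cases i <;> simp [vecMul, dotProduct, cartan, coords, Fin.sum_univ_six] <;> linarith

/-- The form of the Cartan matrix is the restriction of the Lorentzian form on pairs `(diag, deg)`
satisfying `sum_diag`. Norms and orthogonality of roots are computed from this. -/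
lemma coords_dotProduct (k l : Label) :
    (k.coords ᵥ* cartan) ⬝ᵥ l.coords = k.diag ⬝ᵥ l.diag - k.deg * l.deg := by
  have hs := k.sum_diag
  have hl := l.sum_diag
  rw [Fin.sum_univ_six] at hs hl
  rw [coords_vecMul_cartan]
  simp [dotProduct, coords, Fin.sum_univ_six]
  linear_combination -k.diag 4 * hl

lemma coords_norm (k : Label) : (k.coords ᵥ* cartan) ⬝ᵥ k.coords = 2 := by
  rw [coords_dotProduct]
  cases k with
  | unit i j h => simp [diag, deg, dotProduct_sub, h, h.symm]
  | plus s hs => simp [diag, deg, dotProduct, hs]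
  | minus s hs => simp [diag, deg, dotProduct, hs]
  | topPlus => simp [diag, deg, dotProduct]
  | topMinus => simp [diag, deg, dotProduct]

lemma eq_of_diag_eq {k l : Label} (h1 : k.diag = l.diag) (h2 : k.deg = l.deg) : k = l := by
  cases k <;> cases l <;> simp only [deg] at h2 <;> try (exact absurd h2 (by decide))
  · rename_i i j h i' j' h'
    have hi := congrFun h1 i
    have hj := congrFun h1 j
    simp only [diag, Pi.sub_apply, Pi.single_apply] at hi hj
    grind
  · rename_i s hs s' hs'
    obtain rfl : s = s' := by
      ext i
      have := congrFun h1 i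
      simp only [diag] at this
      grind
    rfl
  · rename_i s hs s' hs'
    obtain rfl : s = s' := by
      ext i
      have := congrFun h1 i
      simp only [diag] at this
      grind
    rfl
  · rfl
  · rfl

/-- The coordinates recover `deg` and every entry of `diag` except the one at index 4, which
`sum_diag` supplies. -/
lemma coords_injective : Function.Injective coords := by
  intro k l hkl
  have h (i : Fin 6) := congrFun hkl i
  have e0 := h 0; have e1 := h 1; have e2 := h 2; have e3 := h 3; have e4 := h 4; have e5 := h 5
  have hk := k.sum_diag
  have hl := l.sum_diag
  rw [Fin.sum_univ_six] at hk hl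
  simp [coords] at e0 e1 e2 e3 e4 e5
  refine eq_of_diag_eq (funext fun i => ?_) e5
  fin_cases i <;> simp <;> omega

/-- Only `plus s` needs an argument: at most two of its three indices lie outside `{0,1,2,3}`, so
the partial sum minus 1 is nonnegative. Negation handles `minus s`, and the other labels are
finitely many explicit cases. -/
lemma coords_sign (k : Label) : 0 ≤ k.coords ∨ 0 ≤ -k.coords := by
  have hp (s : Finset (Fin 6)) (hs : s.card = 3) : 0 ≤ (plus s hs).coords := by
    have h3 := (plus s hs).sum_diag
    have hb (i : Fin 6) : 0 ≤ (plus s hs).diag i ∧ (plus s hs).diag i ≤ 1 := by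
      simp only [diag]
      split_ifs <;> simp
    have b0 := hb 0; have b1 := hb 1; have b2 := hb 2
    have b3 := hb 3; have b4 := hb 4; have b5 := hb 5
    have hd : (plus s hs).deg = 1 := rfl
    rw [Fin.sum_univ_six, hd] at h3
    intro i
    fin_cases i <;> simp [coords, hd] <;> omega
  cases k with
  | unit i j h =>
    simp only [Pi.le_def]
    revert i j
    decide
  | plus s hs => exact Or.inl (hp s hs)
  | minus s hs =>
    right
    rw [← coords_neg]
    exact hp s hs
  | topPlus => left; simp only [Pi.le_def]; decide
  | topMinus => right; simp only [Pi.le_def]; decide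

/-- The root `topPlus` is a hub: its product with `k` is `3 deg - 2 deg = deg`, so it is adjacent to
every root of nonzero degree. A root `unit i j` reaches it through `plus s` with `i ∈ s` and `j ∉
s`. -/
lemma connected (k l : Label) :
    Relation.ReflTransGen (fun k l : Label => (l.coords ᵥ* cartan) ⬝ᵥ k.coords ≠ 0) k l := by
  have hsymm (k l : Label) : (l.coords ᵥ* cartan) ⬝ᵥ k.coords = (k.coords ᵥ* cartan) ⬝ᵥ l.coords := by
    rw [coords_dotProduct, coords_dotProduct, dotProduct_comm, mul_comm]
  have htop (k : Label) (hk : k.deg ≠ 0) : (k.coords ᵥ* cartan) ⬝ᵥ topPlus.coords ≠ 0 := by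
    rw [coords_dotProduct]
    have := k.sum_diag
    change k.diag ⬝ᵥ 1 - k.deg * 2 ≠ 0
    rw [dotProduct_one]
    omega
  have hdeg (k : Label) :
      Relation.ReflTransGen (fun k l : Label => (l.coords ᵥ* cartan) ⬝ᵥ k.coords ≠ 0) topPlus k ∧
      Relation.ReflTransGen (fun k l : Label => (l.coords ᵥ* cartan) ⬝ᵥ k.coords ≠ 0) k topPlus := by
    by_cases hk : k.deg = 0
    · cases k with
      | unit i j h =>
        obtain ⟨s, hs, his, hjs⟩ : ∃ s : Finset (Fin 6), s.card = 3 ∧ i ∈ s ∧ j ∉ s := by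
          obtain ⟨s, hs1, hs2, hs3⟩ := Finset.exists_subsuperset_card_eq (n := 3)
            (s := {i}) (t := {j}ᶜ) (by simpa using h.symm) (by simp) (by simp [Finset.card_compl])
          exact ⟨s, hs3, hs1 (by simp), fun hj => by simpa using hs2 hj⟩
        have h1 : ((unit i j h).coords ᵥ* cartan) ⬝ᵥ (plus s hs).coords ≠ 0 := by
          rw [coords_dotProduct]
          simp [diag, deg, his, hjs]
        have h2 := htop (plus s hs) (by simp [deg])
        exact ⟨.tail (.single h2) h1, .tail (.single (by rwa [hsymm])) (by rwa [hsymm])⟩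
      | _ => simp [deg] at hk
    · exact ⟨.single (htop k hk), .single (by rw [hsymm]; exact htop k hk)⟩
  exact (hdeg k).2.trans (hdeg l).1

end Label
end Roots

/-! ### Zero arguments, and products of eigenvectors. -/

section Zero

variable {K N M : Type*} [CommRing K] [AddCommGroup N] [Module K N] [AddCommGroup M] [Module K M]
  (g : N →ₗ[K] M →ₗ[K] K)

@[simp] lemma derPow_zero (n : ℕ) (A : Module.End K M) : derPow n A 0 = 0 :=
  Subtype.ext (map_zero (der A))

@[simp] lemma zero_derPow (n : ℕ) (x : ⋀[K]^n M) : derPow n 0 x = 0 := by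
  simpa using smul_derPow n (0 : K) 0 x

@[simp] lemma mul33_zero (x : ⋀[K]^3 M) : mul33 x 0 = 0 := Subtype.ext (mul_zero _)

@[simp] lemma zero_mul33 (x : ⋀[K]^3 M) : mul33 0 x = 0 := Subtype.ext (zero_mul _)

@[simp] lemma act36_zero (a : ⋀[K]^3 N) : act36 g a 0 = 0 := map_zero (contr g a)

@[simp] lemma zero_act36 (x : ⋀[K]^6 M) : act36 g 0 x = 0 :=
  LinearMap.map_zero₂ (contr g) x

@[simp] lemma endoS_zero (a : ⋀[K]^3 N) : endoS g a 0 = 0 := map_zero (endoL g a)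

@[simp] lemma zero_endoS (x : ⋀[K]^3 M) : endoS g 0 x = 0 := LinearMap.map_zero₂ (endoL g) x

variable {g} in
@[simp] lemma comm_zero (A : S g) : comm A 0 = 0 := map_zero (commS g A)

@[simp] lemma pair_zero (a : ExteriorAlgebra K N) : pair g a 0 = 0 := by simp [pair]

@[simp] lemma zero_pair (x : ExteriorAlgebra K M) : pair g 0 x = 0 := by simp [pair]

/-- By the Leibniz rule, eigenvalues add in a product of eigenvectors. -/
lemma derPow_ιMulti {n : ℕ} {A : Module.End K M} {v : Fin n → M} {a : Fin n → K}
    (h : ∀ i, A (v i) = a i • v i) :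
    derPow n A (exteriorPower.ιMulti K n v) = (∑ i, a i) • exteriorPower.ιMulti K n v := by
  refine Subtype.ext (?_ : der A (ExteriorAlgebra.ιMulti K n v) =
    (∑ i, a i) • ExteriorAlgebra.ιMulti K n v)
  induction n with
  | zero => simp [der_one]
  | succ n ih =>
    rw [ExteriorAlgebra.ιMulti_succ_apply, der_ι_mul, Fin.sum_univ_succ, h, map_smul,
      Matrix.vecTail, ih (v := v ∘ Fin.succ) (a := a ∘ Fin.succ) fun i => h _]
    simp only [Function.comp_apply, smul_mul_assoc, mul_smul_comm, add_smul]
    exact add_comm _ _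

end Zero

/-! ### Diagonal elements of degree zero. -/

section Standard

open Matrix

variable {K : Type*} [Field K]

lemma dot_eq_zero (v : Fin 6 → K) (h : ∀ w, dot K v w = 0) : v = 0 :=
  dotProduct_eq_zero v h

lemma dot_flip : (dot K).flip = dot K :=
  LinearMap.ext₂ fun v w => dotProduct_comm w v

lemma sum_orderEmbOfFin {n : ℕ} (s : Finset (Fin 6)) (hs : s.card = n) {V : Type*}
    [AddCommMonoid V] (f : Fin 6 → V) : ∑ k, f (s.orderEmbOfFin hs k) = ∑ i ∈ s, f i := by
  conv_rhs => rw [← Finset.image_orderEmbOfFin_univ s hs]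
  rw [Finset.sum_image fun _ _ _ _ h => (s.orderEmbOfFin hs).injective h]

lemma toLin'_diagonal_single (d : Fin 6 → K) (i : Fin 6) :
    toLin' (diagonal d) (Pi.single i 1) = d i • Pi.single i 1 := by
  ext j
  rcases eq_or_ne j i with rfl | h
  · simp [mulVec_diagonal]
  · simp [mulVec_diagonal, h]

lemma derPow_vPlus {n : ℕ} (s : Finset (Fin 6)) (hs : s.card = n) (d : Fin 6 → K) :
    derPow n (toLin' (diagonal d)) (vPlus K s hs) = (∑ i ∈ s, d i) • vPlus K s hs := by
  rw [vPlus, derPow_ιMulti fun _ => toLin'_diagonal_single d _, sum_orderEmbOfFin]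

lemma derPow_vMinus {n : ℕ} (s : Finset (Fin 6)) (hs : s.card = n) (d : Fin 6 → K) :
    derPow n (toLin' (diagonal d)) (vMinus K s hs) = (∑ i ∈ s, d i) • vMinus K s hs := by
  have := Equiv.sum_comp Fin.revPerm fun k => d (s.orderEmbOfFin hs k)
  simp only [Fin.revPerm_apply] at this
  rw [vMinus, derPow_ιMulti fun _ => toLin'_diagonal_single d _, this, sum_orderEmbOfFin]

variable (K) in
/-- The map `ι⁺` as a linear map. -/
def iotaL : Matrix (Fin 6) (Fin 6) K →ₗ[K] S (dot K) where
  toFun := iotaPlus K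
  map_add' A B := S_ext_snd dot_eq_zero (map_add toLin' A B)
  map_smul' c A := S_ext_snd dot_eq_zero (map_smul toLin' c A)

variable (K) in
/-- The map `(A, c) ↦ ι⁺(A) + c h₀`. -/
def iotaE : Matrix (Fin 6) (Fin 6) K × K →ₗ[K] Etilde (dot K) where
  toFun A := ⟨0, 0, iotaL K A.1, A.2, 0, 0⟩
  map_add' A B := by ext1 <;> simp
  map_smul' c A := by ext1 <;> simp

lemma coe_degZero (A : Matrix (Fin 6) (Fin 6) K) (c : K) (h : A.trace + 3 * c = 0) :
    (degZero A c h : Etilde (dot K)) = iotaE K (A, c) := rfl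

lemma comm_iotaPlus (A B : Matrix (Fin 6) (Fin 6) K) :
    comm (iotaPlus K A) (iotaPlus K B) = iotaPlus K (A * B - B * A) :=
  S_ext_snd dot_eq_zero (by
    change toLin' A * toLin' B - toLin' B * toLin' A = toLin' (A * B - B * A)
    rw [map_sub, toLin'_mul, toLin'_mul]
    rfl)

lemma Label.simple_castSucc (i : Fin 5) :
    simple i.castSucc = .unit i.castSucc i.succ (by simp [Fin.ext_iff]) := by
  fin_cases i <;> rfl

/-- The element `ι⁺(D) + c h₀` for the diagonal matrix `D` with diagonal `d`. -/
def diagZero (d : Fin 6 → K) (c : K) (h : ∑ i, d i + 3 * c = 0) : E (dot K) :=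
  degZero (diagonal d) c (by rw [trace_diagonal, h])

/-- Each `hB K i` is its simple root read as a diagonal element. The coefficient `-deg` of `h₀`
matches the negative sign of the degree part of the form, so that acting by this element computes
the form. -/
lemma coe_hB (i : Fin 6) : (hB K i : Etilde (dot K)) =
    iotaE K (diagonal fun j => ((Label.simple i).diag j : K), -((Label.simple i).deg : K)) := by
  refine Fin.lastCases ?_ (fun i => ?_) i
  · have h : single 3 3 1 + single 4 4 1 + single 5 5 1 =
        diagonal fun j => ((Label.simple (Fin.last 5)).diag j : K) := by
      simp only [← diagonal_single, diagonal_add]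
      refine congrArg diagonal (funext fun j => ?_)
      fin_cases j <;> simp [Label.simple, Label.diag]
    rw [hB, Fin.snoc_last, coe_degZero, h]
    simp [Label.simple, Label.deg]
  · have h : single i.castSucc i.castSucc 1 - single i.succ i.succ 1 =
        diagonal fun j => ((Label.simple i.castSucc).diag j : K) := by
      rw [Label.simple_castSucc]
      simp only [← diagonal_single, diagonal_sub]
      refine congrArg diagonal (funext fun j => ?_)
      simp [Label.diag, Pi.single_apply]
    rw [hB, Fin.snoc_castSucc, coe_degZero, h, Label.simple_castSucc]
    simp [Label.deg]

/-- These are the formulas of `Label.coords`, with `d` for `diag` and `-c` for `deg`. -/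
lemma diagZero_eq_sum (d : Fin 6 → K) (c : K) (h : ∑ i, d i + 3 * c = 0) :
    diagZero d c h = ∑ i, (![d 0, d 0 + d 1, d 0 + d 1 + d 2, d 0 + d 1 + d 2 + d 3 + c,
      -c - d 5, -c] : Fin 6 → K) i • hB K i := by
  refine Subtype.ext ?_
  rw [AddSubmonoidClass.coe_finsetSum]
  simp only [SetLike.val_smul, coe_hB, ← map_smul, ← map_sum]
  rw [diagZero, coe_degZero]
  congr 1
  rw [Fin.sum_univ_six] at h ⊢
  refine Prod.ext ?_ ?_
  · simp only [Prod.fst_add, Prod.smul_fst, ← diagonal_smul, diagonal_add]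
    refine congrArg diagonal (funext fun j => ?_)
    fin_cases j <;> simp [Label.simple, Label.diag] <;> first | ring1 | linear_combination h
  · simp [Label.simple, Label.deg]

end Standard

/-! ### Brackets of the basis elements. -/

section Standard

open Matrix

variable {K : Type*} [Field K]

lemma degZero_congr {A B : Matrix (Fin 6) (Fin 6) K} {c d : K} {h : A.trace + 3 * c = 0}
    {h' : B.trace + 3 * d = 0} (hAB : A = B) (hcd : c = d) : degZero A c h = degZero B d h' := by
  subst hAB hcd; rfl

@[simp] lemma S_sub_zero {N M : Type*} [AddCommGroup N] [Module K N] [AddCommGroup M] [Module K M]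
    {g : N →ₗ[K] M →ₗ[K] K} (A : S g) : A - 0 = A := sub_zero A

@[simp] lemma S_zero_sub {N M : Type*} [AddCommGroup N] [Module K N] [AddCommGroup M] [Module K M]
    {g : N →ₗ[K] M →ₗ[K] K} (A : S g) : 0 - A = -A := zero_sub A

@[simp] lemma S_neg_neg {N M : Type*} [AddCommGroup N] [Module K N] [AddCommGroup M] [Module K M]
    {g : N →ₗ[K] M →ₗ[K] K} (A : S g) : - -A = A := neg_neg A

@[simp] lemma S_neg_zero {N M : Type*} [AddCommGroup N] [Module K N] [AddCommGroup M] [Module K M]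
    {g : N →ₗ[K] M →ₗ[K] K} : -(0 : S g) = 0 := neg_zero

namespace Etilde

variable {N M : Type*} [AddCommGroup N] [Module K N] [AddCommGroup M] [Module K M]
  {g : N →ₗ[K] M →ₗ[K] K} (x : Etilde g)

@[simp] lemma n2_neg : (-x).n2 = -x.n2 := rfl
@[simp] lemma n1_neg : (-x).n1 = -x.n1 := rfl
@[simp] lemma s_neg : (-x).s = -x.s := rfl
@[simp] lemma c_neg : (-x).c = -x.c := rfl
@[simp] lemma p1_neg : (-x).p1 = -x.p1 := rfl
@[simp] lemma p2_neg : (-x).p2 = -x.p2 := rfl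

end Etilde

lemma bracket_iotaE (A : Matrix (Fin 6) (Fin 6) K) (c : K) (y : Etilde (dot K)) :
    (iotaE K (A, c)).bracket y =
      ⟨derPow 6 (toLin' (-Aᵀ)) y.n2 - (2 * c) • y.n2, derPow 3 (toLin' (-Aᵀ)) y.n1 - c • y.n1,
        comm (iotaPlus K A) y.s, 0, derPow 3 (toLin' A) y.p1 + c • y.p1,
        derPow 6 (toLin' A) y.p2 + (2 * c) • y.p2⟩ := by
  rw [map_neg]
  ext1 <;> simp [iotaE, iotaL, Etilde.bracket, iotaPlus]

lemma product_degZero (A B : Matrix (Fin 6) (Fin 6) K) (c d : K) (h : A.trace + 3 * c = 0)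
    (h' : B.trace + 3 * d = 0) : product (dot K) (degZero A c h) (degZero B d h') =
      degZero (A * B - B * A) 0 (by rw [trace_sub, trace_mul_comm, sub_self, mul_zero, add_zero]) := by
  refine Subtype.ext ((bracket_iotaE A c _).trans ?_)
  ext1 <;> simp [degZero, comm_iotaPlus]

lemma diagonal_mul_single_sub (d : Fin 6 → K) (i j : Fin 6) :
    diagonal d * single i j 1 - single i j 1 * diagonal d = (d i - d j) • single i j (1 : K) := by
  ext k l
  rw [Matrix.sub_apply, diagonal_mul, mul_diagonal, Matrix.smul_apply, single_apply, smul_eq_mul]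
  split_ifs with h
  · rw [h.1, h.2]; ring
  · simp

lemma product_diagZero_xB (d : Fin 6 → K) (c : K) (h : ∑ i, d i + 3 * c = 0) (k : Label) :
    product (dot K) (diagZero d c h) (xB K k) = (∑ i, d i * k.diag i + c * k.deg) • xB K k := by
  -- On the components of negative degree `ι⁺(D)` acts through `-Dᵀ`, again diagonal but with
  -- entries `-d`.
  have ht : toLin' (-(diagonal d)ᵀ) = toLin' (diagonal (-d)) := by
    rw [diagonal_transpose]
    exact congrArg toLin' (diagonal_neg d)
  refine Subtype.ext ((bracket_iotaE (diagonal d) c _).trans ?_)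
  rw [ht, SetLike.val_smul]
  cases k with
  | unit i j hij =>
    have : ∑ l, d l * ((Label.unit i j hij).diag l : K) + c * ((Label.unit i j hij).deg : K) =
        d i - d j := by
      simp [Label.diag, Label.deg, mul_sub, Finset.sum_sub_distrib, Pi.single_apply]
    rw [this, xB, coe_degZero, ← map_smul]
    ext1 <;> simp [iotaE, iotaL, comm_iotaPlus, diagonal_mul_single_sub]
  | plus s hs =>
    have := derPow_vPlus s hs d
    ext1 <;> simp [Label.diag, Label.deg, xB, this, add_smul, Finset.sum_ite_mem]
  | minus s hs =>
    have := derPow_vMinus s hs (-d)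
    ext1 <;> simp [Label.diag, Label.deg, xB, this, add_smul, Finset.sum_ite_mem, sub_eq_add_neg]
    exact neg_smul (∑ i ∈ s, d i) (vMinus K s hs)
  | topPlus =>
    have := derPow_vPlus Finset.univ (Finset.card_fin 6) d
    ext1 <;> simp [Label.diag, Label.deg, xB, this, add_smul, mul_comm]
  | topMinus =>
    have := derPow_vMinus Finset.univ (Finset.card_fin 6) (-d)
    ext1 <;> simp [Label.diag, Label.deg, xB, this, add_smul, sub_eq_add_neg, mul_comm]
    exact neg_smul (∑ i, d i) (vMinus K Finset.univ (Finset.card_fin 6))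

lemma card_orderEmb (s : Finset (Fin 6)) (hs : s.card = 3) {V : Type*} [AddCommMonoid V]
    (f : Fin 6 → V) : f (s.orderEmbOfFin hs 0) + f (s.orderEmbOfFin hs 1) +
      f (s.orderEmbOfFin hs 2) = ∑ i ∈ s, f i := by
  rw [← sum_orderEmbOfFin s hs, Fin.sum_univ_three]

/-- The rank-one decomposition has one term for each index in `s`. Because `v_S⁻` is written in
reverse order, the alternating signs cancel and the sum is the coordinate projection onto the span
of the `vᵢ` with `i ∈ s`. -/
lemma endo_vPlus_vMinus (s : Finset (Fin 6)) (hs : s.card = 3) :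
    endo (dot K) (vPlus K s hs) (vMinus K s hs) =
      toLin' (diagonal fun i => if i ∈ s then 1 else 0) := by
  have hd : toLin' (diagonal fun i => if i ∈ s then (1 : K) else 0) =
      ∑ i ∈ s, (dot K (Pi.single i 1)).smulRight (Pi.single i 1) := by
    ext i j
    rcases eq_or_ne j i with rfl | h
    · have (c : Fin 6) : (if c = j then Pi.single c 1 else 0 : Fin 6 → K) j =
          if c = j then 1 else 0 := by
        split_ifs with h
        · rw [h, Pi.single_eq_same]
        · rfl
      simp [mulVec_diagonal, Finset.sum_apply, Pi.single_apply, this]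
    · have (c : Fin 6) : (if c = i then Pi.single c 1 else 0 : Fin 6 → K) j = 0 := by
        split_ifs with hc
        · rw [hc, Pi.single_eq_of_ne h]
        · rfl
      simp [mulVec_diagonal, Finset.sum_apply, h, Pi.single_apply, this]
  have hne {i j : Fin 3} (h : i ≠ j) : dot K (Pi.single (s.orderEmbOfFin hs i) 1)
      (Pi.single (s.orderEmbOfFin hs j) 1) = 0 := by
    simp [h.symm]
  have heq (i : Fin 3) : dot K (Pi.single (s.orderEmbOfFin hs i) 1)
      (Pi.single (s.orderEmbOfFin hs i) 1) = 1 := by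
    simp
  rw [hd, ← card_orderEmb s hs]
  have hv : (vPlus K s hs : ExteriorAlgebra K (Fin 6 → K)) =
      ExteriorAlgebra.ι K (Pi.single (s.orderEmbOfFin hs 0) 1) *
        (ExteriorAlgebra.ι K (Pi.single (s.orderEmbOfFin hs 1) 1) *
          ExteriorAlgebra.ι K (Pi.single (s.orderEmbOfFin hs 2) 1)) := by
    simp [vPlus, ExteriorAlgebra.ιMulti_apply]
    rfl
  have hw : (vMinus K s hs : ExteriorAlgebra K (Fin 6 → K)) =
      ExteriorAlgebra.ι K (Pi.single (s.orderEmbOfFin hs 2) 1) *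
        (ExteriorAlgebra.ι K (Pi.single (s.orderEmbOfFin hs 1) 1) *
          ExteriorAlgebra.ι K (Pi.single (s.orderEmbOfFin hs 0) 1)) := by
    simp [vMinus, ExteriorAlgebra.ιMulti_apply]
    rfl
  have h01 : (0 : Fin 3) ≠ 1 := by decide
  have h02 : (0 : Fin 3) ≠ 2 := by decide
  have h12 : (1 : Fin 3) ≠ 2 := by decide
  rw [hw, endo_mul_mul, hv]
  simp only [con_ι_mul, con_ι, heq, hne h01, hne h02, hne h12, hne h01.symm,
    hne h02.symm, hne h12.symm, one_smul, zero_smul, map_one, map_zero, mul_zero, zero_sub,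
    sub_zero, map_neg, ExteriorAlgebra.ι_leftInverse _, mul_one, neg_neg]
  refine LinearMap.ext fun v => ?_
  simp only [LinearMap.add_apply, LinearMap.sub_apply, LinearMap.smulRight_apply, smul_neg]
  abel

lemma con_prod_eq_zero (l : List (Fin 6)) (i : Fin 6) (hi : i ∉ l) :
    con (dot K (Pi.single i 1))
      (l.map fun i => ExteriorAlgebra.ι K (Pi.single i 1 : Fin 6 → K)).prod = 0 := by
  induction l with
  | nil => simpa using con_algebraMap (dot K (Pi.single i 1)) 1
  | cons j l ih =>
    simp only [List.mem_cons, not_or] at hi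
    simp [con_ι_mul, ih hi.2, hi.1]

/-- With the left factor reversed, each contraction removes the current first factor of the right
one, so no signs arise. -/
lemma pair_reverse_prod (l : List (Fin 6)) (hl : l.Nodup) :
    pair (dot K) (l.map fun i => ExteriorAlgebra.ι K (Pi.single i 1 : Fin 6 → K)).reverse.prod
      (l.map fun i => ExteriorAlgebra.ι K (Pi.single i 1 : Fin 6 → K)).prod = 1 := by
  induction l with
  | nil => simp [pair]
  | cons i l ih =>
    rw [List.nodup_cons] at hl
    rw [List.map_cons, List.reverse_cons, List.prod_append, List.prod_cons, List.prod_cons, List.prod_nil, mul_one,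
      pair_mul, act_ι, con_ι_mul, con_prod_eq_zero l i hl.1, mul_zero, sub_zero]
    simpa using ih hl.2

lemma pair_vMinus_vPlus {n : ℕ} (s : Finset (Fin 6)) (hs : s.card = n) :
    pair (dot K) (vMinus K s hs : ExteriorAlgebra K (Fin 6 → K)) (vPlus K s hs) = 1 := by
  have := pair_reverse_prod (K := K) (List.ofFn (s.orderEmbOfFin hs))
    (List.nodup_ofFn.mpr (s.orderEmbOfFin hs).injective)
  have h (f : Fin n → ExteriorAlgebra K (Fin 6 → K)) :
      (List.ofFn f).reverse = List.ofFn fun i => f i.rev :=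
    List.ext_getElem (by simp) fun i h1 h2 => by simp [Fin.rev]; congr 2; omega
  rw [List.map_ofFn, h, Function.comp_def] at this
  simpa [vMinus, vPlus, ExteriorAlgebra.ιMulti_apply] using this

lemma endoS_vMinus_vPlus (s : Finset (Fin 6)) (hs : s.card = 3) :
    endoS (dot K) (vMinus K s hs) (vPlus K s hs) =
      -iotaPlus K (diagonal fun i => if i ∈ s then 1 else 0) :=
  S_ext_snd dot_eq_zero (congrArg Neg.neg (endo_vPlus_vMinus s hs))

lemma hM_dot : hM (dot K) = iotaPlus K 1 :=
  S_ext_snd dot_eq_zero toLin'_one.symm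

lemma neg_diagonal (d : Fin 6 → K) : -diagonal d = diagonal (-d) := diagonal_neg d

lemma iotaPlus_neg (A : Matrix (Fin 6) (Fin 6) K) : iotaPlus K (-A) = -iotaPlus K A :=
  map_neg (iotaL K) A

lemma bracket_neg_pos {N M : Type*} [AddCommGroup N] [Module K N] [AddCommGroup M] [Module K M]
    (g : N →ₗ[K] M →ₗ[K] K) (a : ⋀[K]^3 N) (x : ⋀[K]^3 M) :
    (⟨0, a, 0, 0, 0, 0⟩ : Etilde g).bracket ⟨0, 0, 0, 0, x, 0⟩ =
      ⟨0, 0, endoS g a x, pair g a x, 0, 0⟩ := by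
  ext1 <;> simp [Etilde.bracket]

lemma bracket_neg_pos_two {N M : Type*} [AddCommGroup N] [Module K N] [AddCommGroup M]
    [Module K M] (g : N →ₗ[K] M →ₗ[K] K) (a : ⋀[K]^6 N) (x : ⋀[K]^6 M) :
    (⟨a, 0, 0, 0, 0, 0⟩ : Etilde g).bracket ⟨0, 0, 0, 0, 0, x⟩ =
      ⟨0, 0, -(pair g a x • hM g), 2 * pair g a x, 0, 0⟩ := by
  ext1 <;> simp [Etilde.bracket]

lemma bracket_pos_neg_two {N M : Type*} [AddCommGroup N] [Module K N] [AddCommGroup M]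
    [Module K M] (g : N →ₗ[K] M →ₗ[K] K) (a : ⋀[K]^6 N) (x : ⋀[K]^6 M) :
    (⟨0, 0, 0, 0, 0, x⟩ : Etilde g).bracket ⟨a, 0, 0, 0, 0, 0⟩ =
      ⟨0, 0, pair g a x • hM g, -2 * pair g a x, 0, 0⟩ := by
  ext1 <;> simp [Etilde.bracket]
  exact (congrArg Neg.neg (neg_smul (pair g a x) (hM g))).trans (neg_neg _)

/-- The bracket is the root of `k` read as a diagonal element, in the same way as in `coe_hB`. Hence
its coordinates in the `hB K i` are `Label.coords k`. -/
lemma product_xB_neg (k : Label) (h) :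
    product (dot K) (xB K k) (xB K k.neg) = diagZero (fun i => (k.diag i : K)) (-k.deg) h := by
  cases k with
  | unit i j hij =>
    rw [Label.neg, xB, xB, product_degZero, diagZero]
    refine degZero_congr ?_ ?_
    · rw [single_mul_single_same, single_mul_single_same, ← diagonal_single, ← diagonal_single,
        diagonal_sub]
      refine congrArg diagonal (funext fun l => ?_)
      simp [Label.diag, Pi.single_apply]
    · simp [Label.deg]
  | plus s hs =>
    have hd : (fun i => ((Label.plus s hs).diag i : K)) = fun i => if i ∈ s then 1 else 0 := by
      ext i; simp [Label.diag]
    refine Subtype.ext (?_ : Etilde.bracket _ _ = _)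
    rw [diagZero, coe_degZero, hd]
    ext1 <;> simp [Label.deg, xB, Label.neg, Etilde.bracket, iotaE, iotaL, pair_vMinus_vPlus,
      endoS_vMinus_vPlus]
  | minus s hs =>
    have hd : (fun i => ((Label.minus s hs).diag i : K)) = -fun i => if i ∈ s then 1 else 0 := by
      ext i; simp [Label.diag]
    refine Subtype.ext (?_ : Etilde.bracket _ _ = _)
    rw [diagZero, coe_degZero, hd, ← neg_diagonal, Label.neg, xB, xB, bracket_neg_pos,
      endoS_vMinus_vPlus, pair_vMinus_vPlus, ← iotaPlus_neg]
    ext1 <;> simp [Label.deg, iotaE, iotaL]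
  | topPlus =>
    have hd : (fun i => (Label.topPlus.diag i : K)) = 1 := by
      ext i; simp [Label.diag]
    refine Subtype.ext ((bracket_pos_neg_two _ _ _).trans ?_)
    rw [diagZero, coe_degZero, hd, pair_vMinus_vPlus, one_smul, hM_dot, mul_one]
    simp only [iotaE, iotaL, Label.deg, ← diagonal_one]
    exact congrArg (fun c => (⟨0, 0, iotaPlus K (diagonal 1), c, 0, 0⟩ : Etilde (dot K))) (by simp)
  | topMinus =>
    have hd : (fun i => (Label.topMinus.diag i : K)) = -1 := by
      ext i; simp [Label.diag]
    refine Subtype.ext ((bracket_neg_pos_two _ _ _).trans ?_)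
    rw [diagZero, coe_degZero, hd, pair_vMinus_vPlus, one_smul, hM_dot, mul_one, ← neg_diagonal,
      ← iotaPlus_neg]
    simp only [iotaE, iotaL, Label.deg, ← diagonal_one]
    exact congrArg (fun c => (⟨0, 0, iotaPlus K (-diagonal 1), c, 0, 0⟩ : Etilde (dot K)))
      (by simp)

end Standard

/-! ### Spanning, dimension and linear independence. -/

section Standard

open Matrix

variable {K : Type*} [Field K]

/-- For `n = 3` the reversal is one transposition and for `n = 6` it is three. Both are odd, so
`v_S⁻` and `v_S⁺` are opposite as elements of the same exterior power of `K⁶`. -/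
lemma vMinus_eq {n : ℕ} (s : Finset (Fin 6)) (hs : s.card = n) :
    vMinus K s hs = Equiv.Perm.sign (Fin.revPerm (n := n)) • vPlus K s hs :=
  AlternatingMap.map_perm (exteriorPower.ιMulti K n)
    (fun k => (Pi.single (s.orderEmbOfFin hs k) 1 : Fin 6 → K)) Fin.revPerm

lemma vMinus_three (s : Finset (Fin 6)) (hs : s.card = 3) : vMinus K s hs = -vPlus K s hs := by
  rw [vMinus_eq, show Equiv.Perm.sign (Fin.revPerm (n := 3)) = -1 by decide, Units.neg_smul,
    one_smul]

lemma vMinus_six (s : Finset (Fin 6)) (hs : s.card = 6) : vMinus K s hs = -vPlus K s hs := by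
  rw [vMinus_eq, show Equiv.Perm.sign (Fin.revPerm (n := 6)) = -1 by decide, Units.neg_smul,
    one_smul]

lemma span_vPlus (n : ℕ) :
    Submodule.span K (Set.range fun s : {s : Finset (Fin 6) // s.card = n} => vPlus K s.1 s.2) =
      ⊤ := by
  rw [eq_top_iff, ← exteriorPower.ιMulti_family_span_of_span K (n := n)
    (Pi.basisFun K (Fin 6)).span_eq, Submodule.span_le]
  rintro _ ⟨s, rfl⟩
  refine Submodule.subset_span ⟨⟨s.1, s.2⟩, Subtype.ext ?_⟩
  simp [vPlus, Function.comp_def, Set.powersetCard.ofFinEmbEquiv_symm_apply,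
    ExteriorAlgebra.ιMulti_family]

lemma eq_iotaPlus (A : S (dot K)) : A = iotaPlus K (LinearMap.toMatrix' A.1.2) :=
  S_ext_snd dot_eq_zero (toLin'_toMatrix' A.1.2).symm

lemma trace_fst (A : S (dot K)) :
    LinearMap.trace K _ A.1.1 = -LinearMap.trace K _ A.1.2 := by
  rw [eq_iotaPlus A]
  change LinearMap.trace K _ (-toLin' _) = -LinearMap.trace K _ (toLin' _)
  rw [map_neg, trace_toLin'_eq, trace_toLin'_eq, trace_transpose]

variable [CharZero K]

variable (K) in
/-- The algebra `E` as a direct sum of its components, where the component in degree `0` is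
identified with the space of matrices. -/
def coordEquiv : ((⋀[K]^6 (Fin 6 → K)) × (⋀[K]^3 (Fin 6 → K)) × Matrix (Fin 6) (Fin 6) K ×
    (⋀[K]^3 (Fin 6 → K)) × (⋀[K]^6 (Fin 6 → K))) ≃ₗ[K] E (dot K) where
  toFun y := ⟨⟨y.1, y.2.1, iotaL K y.2.2.1, -(y.2.2.1.trace / 3), y.2.2.2.1, y.2.2.2.2⟩, by
    change LinearMap.trace K _ (toLin' y.2.2.1) + 3 * -(y.2.2.1.trace / 3) = 0
    rw [trace_toLin'_eq]
    field_simp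
    ring⟩
  map_add' x y := Subtype.ext (by ext1 <;> simp; ring)
  map_smul' c x := Subtype.ext (by ext1 <;> simp; ring)
  invFun x := (x.1.n2, x.1.n1, LinearMap.toMatrix' x.1.s.1.2, x.1.p1, x.1.p2)
  left_inv y := by
    refine Prod.ext rfl (Prod.ext rfl (Prod.ext ?_ rfl))
    exact LinearMap.toMatrix'_toLin' y.2.2.1
  right_inv x := by
    have h : LinearMap.trace K _ x.1.s.1.2 + 3 * x.1.c = 0 := x.2
    refine Subtype.ext ?_
    ext1
    · rfl
    · rfl
    · exact (eq_iotaPlus x.1.s).symm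
    · change -((LinearMap.toMatrix' x.1.s.1.2).trace / 3) = x.1.c
      rw [← trace_toLin'_eq, toLin'_toMatrix']
      field_simp
      linear_combination -h
    · rfl
    · rfl

/-- The count is `1 + 20 + 36 + 20 + 1`. -/
lemma finrank_E : Module.finrank K (E (dot K)) = 78 := by
  rw [← (coordEquiv K).finrank_eq]
  simp only [Module.finrank_prod, exteriorPower.finrank_eq, Module.finrank_matrix,
    Module.finrank_pi, Module.finrank_self, Fintype.card_fin]
  rfl

lemma span_hB_xB : Submodule.span K (Set.range (Sum.elim (hB K) (xB K))) = ⊤ := by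
  set T := Submodule.span K (Set.range (Sum.elim (hB K) (xB K))) with hT
  have hh (i : Fin 6) : hB K i ∈ T := Submodule.subset_span ⟨.inl i, rfl⟩
  have hx (k : Label) : xB K k ∈ T := Submodule.subset_span ⟨.inr k, rfl⟩
  have key (n : ℕ) (f : (⋀[K]^n (Fin 6 → K)) →ₗ[K] E (dot K))
      (hf : ∀ s hs, f (vPlus K s hs) ∈ T) (p) : f p ∈ T := by
    have : (⊤ : Submodule K (⋀[K]^n (Fin 6 → K))) ≤ T.comap f := by
      rw [← span_vPlus, Submodule.span_le]
      rintro _ ⟨s, rfl⟩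
      exact hf s.1 s.2
    exact this Submodule.mem_top
  have h6 {s : Finset (Fin 6)} (hs : s.card = 6) : s = Finset.univ :=
    Finset.card_eq_iff_eq_univ s |>.mp hs
  have hn2 (p) : coordEquiv K (p, 0, 0, 0, 0) ∈ T := by
    refine key 6 ((coordEquiv K).toLinearMap ∘ₗ LinearMap.inl K _ _) (fun s hs => ?_) p
    obtain rfl := h6 hs
    rw [← neg_neg (vPlus K _ hs), ← vMinus_six, map_neg]
    refine T.neg_mem ?_
    convert hx .topMinus using 1
    refine Subtype.ext ?_
    ext1 <;> simp [coordEquiv, xB]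
  have hn1 (p) : coordEquiv K (0, p, 0, 0, 0) ∈ T := by
    refine key 3 ((coordEquiv K).toLinearMap ∘ₗ LinearMap.inr K _ _ ∘ₗ LinearMap.inl K _ _)
      (fun s hs => ?_) p
    rw [← neg_neg (vPlus K _ hs), ← vMinus_three, map_neg]
    refine T.neg_mem ?_
    convert hx (.minus s hs) using 1
    refine Subtype.ext ?_
    ext1 <;> simp [coordEquiv, xB]
  have hp1 (p) : coordEquiv K (0, 0, 0, p, 0) ∈ T := by
    refine key 3 ((coordEquiv K).toLinearMap ∘ₗ LinearMap.inr K _ _ ∘ₗ LinearMap.inr K _ _ ∘ₗ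
      LinearMap.inr K _ _ ∘ₗ LinearMap.inl K _ _) (fun s hs => ?_) p
    convert hx (.plus s hs) using 1
    refine Subtype.ext ?_
    ext1 <;> simp [coordEquiv, xB]
  have hp2 (p) : coordEquiv K (0, 0, 0, 0, p) ∈ T := by
    refine key 6 ((coordEquiv K).toLinearMap ∘ₗ LinearMap.inr K _ _ ∘ₗ LinearMap.inr K _ _ ∘ₗ
      LinearMap.inr K _ _ ∘ₗ LinearMap.inr K _ _) (fun s hs => ?_) p
    obtain rfl := h6 hs
    convert hx .topPlus using 1
    refine Subtype.ext ?_
    ext1 <;> simp [coordEquiv, xB]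
  have hs (A) : coordEquiv K (0, 0, A, 0, 0) ∈ T := by
    suffices (⊤ : Submodule K (Matrix (Fin 6) (Fin 6) K)) ≤
        T.comap ((coordEquiv K).toLinearMap ∘ₗ LinearMap.inr K _ _ ∘ₗ LinearMap.inr K _ _ ∘ₗ
          LinearMap.inl K _ _) from this Submodule.mem_top
    rw [← (Matrix.stdBasis K (Fin 6) (Fin 6)).span_eq, Submodule.span_le]
    rintro _ ⟨⟨i, j⟩, rfl⟩
    rw [Matrix.stdBasis_eq_single]
    change coordEquiv K (0, 0, single i j 1, 0, 0) ∈ T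
    rcases eq_or_ne i j with rfl | hij
    -- A diagonal matrix unit has trace 1, so in `E` it must be accompanied by `-(1/3) h₀`.
    · have h : ∑ l, (Pi.single i 1 : Fin 6 → K) l + 3 * -(1 / 3) = 0 := by
        simp
      have hd : diagZero (Pi.single i 1) (-(1 / 3)) h ∈ T := by
        rw [diagZero_eq_sum]
        exact T.sum_mem fun i _ => T.smul_mem _ (hh i)
      convert hd using 1
      refine Subtype.ext ?_
      rw [diagZero, coe_degZero, diagonal_single]
      ext1 <;> simp [coordEquiv, iotaE]
    · convert hx (.unit i j hij) using 1
      refine Subtype.ext ?_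
      rw [xB, coe_degZero]
      ext1 <;> simp [coordEquiv, iotaE, hij]
  refine eq_top_iff.mpr fun y _ => ?_
  obtain ⟨⟨a, b, A, p, q⟩, rfl⟩ := (coordEquiv K).surjective y
  have : (a, b, A, p, q) = (a, 0, 0, 0, 0) + (0, b, 0, 0, 0) + (0, 0, A, 0, 0) +
      ((0, 0, 0, p, 0) + (0, 0, 0, 0, q)) := by simp
  rw [this, map_add, map_add, map_add, map_add]
  exact T.add_mem (T.add_mem (T.add_mem (hn2 a) (hn1 b)) (hs A)) (T.add_mem (hp1 p) (hp2 q))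

/-- A spanning family of `6 + 72` elements in dimension 78 is independent. -/
lemma linearIndependent_hB_xB : LinearIndependent K (Sum.elim (hB K) (xB K)) :=
  linearIndependent_of_top_le_span_of_card_eq_finrank span_hB_xB.ge (by
    rw [Fintype.card_sum, Label.card_eq, finrank_E, Fintype.card_fin])

end Standard

/-! ### The involution exchanging opposite degrees, and the conclusion. -/

section Standard

open Matrix

variable {K : Type*} [Field K]

variable (K) in
/-- The exchange of the two components of an element of `S`. -/
def swapS : S (dot K) →ₗ[K] S (dot K) where
  toFun A := ⟨(A.1.2, A.1.1), fun v w => by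
    have h := S_apply A w v
    simp only [dotProductBilin_apply_apply] at h ⊢
    rwa [dotProduct_comm, dotProduct_comm v, add_comm]⟩
  map_add' _ _ := rfl
  map_smul' _ _ := rfl

lemma swapS_iotaPlus (A : Matrix (Fin 6) (Fin 6) K) :
    swapS K (iotaPlus K A) = -iotaPlus K Aᵀ :=
  S_ext_snd dot_eq_zero rfl

lemma pair_dot_comm (a x : ExteriorAlgebra K (Fin 6 → K)) :
    pair (dot K) a x = pair (dot K) x a := by
  rw [pair_comm, dot_flip]

variable (K) in
/-- The automorphism of `Ẽ` that exchanges the components of degrees `i` and `-i`. -/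
def swapTilde : Etilde (dot K) →ₗ[K] Etilde (dot K) where
  toFun x := ⟨x.p2, x.p1, swapS K x.s, -x.c, x.n1, x.n2⟩
  map_add' x y := by ext1 <;> simp [add_comm]
  map_smul' c x := by ext1 <;> simp

/-- The dot product is symmetric, so the construction is unchanged when the two copies of `K⁶` are
exchanged. The exchange negates `h_M` and `h₀` and turns `endoS a x` into `-endoS x a`, which agrees
with skew-symmetry of the bracket. -/
lemma swapTilde_bracket (x y : Etilde (dot K)) :
    swapTilde K (x.bracket y) = (swapTilde K x).bracket (swapTilde K y) := by
  have hs : swapS K (comm x.s y.s + endoS (dot K) x.n1 y.p1 - endoS (dot K) y.n1 x.p1 -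
      (pair (dot K) x.n2 y.p2 - pair (dot K) y.n2 x.p2) • hM (dot K)) =
      comm (swapS K x.s) (swapS K y.s) + endoS (dot K) x.p1 y.n1 - endoS (dot K) y.p1 x.n1 -
      (pair (dot K) x.p2 y.n2 - pair (dot K) y.p2 x.n2) • hM (dot K) := by
    rw [pair_dot_comm (x.n2 : ExteriorAlgebra K (Fin 6 → K)),
      pair_dot_comm (y.n2 : ExteriorAlgebra K (Fin 6 → K))]
    refine S_ext_snd dot_eq_zero ?_
    change x.s.1.1 * y.s.1.1 - y.s.1.1 * x.s.1.1 + endo (dot K).flip x.n1 y.p1 -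
        endo (dot K).flip y.n1 x.p1 -
        (pair (dot K) y.p2 x.n2 - pair (dot K) x.p2 y.n2) • (-1 : Module.End K (Fin 6 → K)) =
      x.s.1.1 * y.s.1.1 - y.s.1.1 * x.s.1.1 + -endo (dot K) y.n1 x.p1 - -endo (dot K) x.n1 y.p1 -
        (pair (dot K) x.p2 y.n2 - pair (dot K) y.p2 x.n2) • (1 : Module.End K (Fin 6 → K))
    rw [dot_flip]
    module
  ext1
  · simp only [swapTilde, Etilde.bracket, LinearMap.coe_mk, AddHom.coe_mk, swapS]
    module
  · simp only [swapTilde, Etilde.bracket, LinearMap.coe_mk, AddHom.coe_mk, swapS, dot_flip]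
    module
  · exact hs
  · simp only [swapTilde, Etilde.bracket, LinearMap.coe_mk, AddHom.coe_mk,
      pair_dot_comm (x.p1 : ExteriorAlgebra K (Fin 6 → K)),
      pair_dot_comm (y.p1 : ExteriorAlgebra K (Fin 6 → K)),
      pair_dot_comm (x.p2 : ExteriorAlgebra K (Fin 6 → K)),
      pair_dot_comm (y.p2 : ExteriorAlgebra K (Fin 6 → K))]
    ring
  · simp only [swapTilde, Etilde.bracket, LinearMap.coe_mk, AddHom.coe_mk, swapS, dot_flip]
    module
  · simp only [swapTilde, Etilde.bracket, LinearMap.coe_mk, AddHom.coe_mk, swapS]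
    module

variable (K) in
/-- The automorphism of `E` that exchanges the components of degrees `i` and `-i`. -/
def swap : E (dot K) →ₗ[K] E (dot K) :=
  (swapTilde K).restrict fun x hx => by
    change LinearMap.trace K _ x.s.1.1 + 3 * -x.c = 0
    have : LinearMap.trace K _ x.s.1.2 + 3 * x.c = 0 := hx
    rw [trace_fst]
    linear_combination -this

lemma swap_product (x y : E (dot K)) :
    swap K (product (dot K) x y) = product (dot K) (swap K x) (swap K y) :=
  Subtype.ext (swapTilde_bracket x.1 y.1)

/-- On matrix units the sign comes from `A ↦ -Aᵀ`; on the exterior powers it is the sign of the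
order reversal. -/
lemma swap_xB (k : Label) : swap K (xB K k) = -xB K k.neg := by
  refine Subtype.ext ?_
  change swapTilde K (xB K k).1 = -(xB K k.neg).1
  cases k with
  | unit i j hij => ext1 <;> simp [swapTilde, xB, Label.neg, degZero, swapS_iotaPlus]
  | plus s hs => ext1 <;> simp [swapTilde, xB, Label.neg, vMinus_three]
  | minus s hs => ext1 <;> simp [swapTilde, xB, Label.neg, vMinus_three]
  | topPlus => ext1 <;> simp [swapTilde, xB, Label.neg, vMinus_six]
  | topMinus => ext1 <;> simp [swapTilde, xB, Label.neg, vMinus_six]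

lemma hB_eq_diagZero (i : Fin 6) : hB K i = diagZero
    (fun j => ((Label.simple i).diag j : K)) (-((Label.simple i).deg : K)) (by
      rw [← Int.cast_sum, Label.sum_diag]; push_cast; ring) :=
  Subtype.ext (coe_hB i)

lemma isSimplyLacedBasis [CharZero K] (hE : IsLieProduct (product (dot K))) :
    letI := hE.lieRing
    letI := hE.lieAlgebra
    IsSimplyLacedBasis (K := K) Label.cartan Label.coords Label.neg Label.simple (hB K) (xB K) :=
  letI := hE.lieRing
  letI := hE.lieAlgebra
  { linearIndependent := linearIndependent_hB_xB
    span_eq_top := span_hB_xB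
    det_ne_zero := Label.det_cartan_ne_zero
    lie_h_h := fun i j => by
      change product (dot K) (hB K i) (hB K j) = 0
      rw [hB_eq_diagZero, hB_eq_diagZero, diagZero, diagZero, product_degZero]
      refine Subtype.ext ?_
      rw [coe_degZero, diagonal_mul_diagonal, diagonal_mul_diagonal]
      simp only [mul_comm, sub_self]
      exact map_zero (iotaE K)
    lie_h_x := fun i k => by
      change product (dot K) (hB K i) (xB K k) = _
      -- Pairing with a simple root extracts one entry of the weight, and the Lorentzian form then
      -- equals the eigenvalue given by `product_diagZero_xB`.
      have h := Label.coords_dotProduct k (Label.simple i)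
      rw [Label.coords_simple, dotProduct_single, mul_one] at h
      rw [hB_eq_diagZero, product_diagZero_xB, h]
      congr 1
      simp only [dotProduct, Int.cast_sub, Int.cast_sum, Int.cast_mul, mul_comm]
      ring
    lie_x_x := fun k => by
      change product (dot K) (xB K k) (xB K k.neg) = _
      rw [product_xB_neg k (by rw [← Int.cast_sum, Label.sum_diag]; push_cast; ring),
        diagZero_eq_sum]
      refine Finset.sum_congr rfl fun i _ => ?_
      congr 1
      fin_cases i <;> simp [Label.coords, sub_eq_add_neg]
    Q_neg := Label.coords_neg
    Q_norm := Label.coords_norm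
    Q_injective := Label.coords_injective
    Q_simple := Label.coords_simple
    Q_sign := Label.coords_sign
    connected := Label.connected }

end Standard
end ExteriorE6

theorem proposition7p7p9 :
    ∃ hE : ExteriorE6.IsLieProduct (ExteriorE6.product (ExteriorE6.dot ℂ)),
      letI := hE.lieRing
      letI := hE.lieAlgebra
      ExteriorE6.IsSimpleOfType ℂ CartanMatrix.E₆ (ExteriorE6.E (ExteriorE6.dot ℂ)) ∧
        ExteriorE6.IsChevalleyBasis ℂ (ExteriorE6.hB ℂ) (ExteriorE6.xB ℂ) := by
  refine ⟨ExteriorE6.isLieProduct_dot ℂ, ?_⟩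
  have D := ExteriorE6.isSimplyLacedBasis (ExteriorE6.isLieProduct_dot ℂ)
  let := (ExteriorE6.isLieProduct_dot ℂ).lieRing
  let := (ExteriorE6.isLieProduct_dot ℂ).lieAlgebra
  exact ⟨D.isSimpleOfType CartanMatrix.E₆ ExteriorE6.Label.order ExteriorE6.Label.cartan_order,
    D.isChevalleyBasis (ExteriorE6.swap ℂ) ExteriorE6.swap_product ExteriorE6.swap_xB⟩
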